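/- **Notation.** For $z\in\mathbb C^\times$ put $[z]=z/|z|$; $\mathscr S(\mathbb C)$ is the Schwartz space. On $\mathbb C\times\mathbb Z$ write $(\lambda,k)\preccurlyeq(\lambda',k')$ if $\lambda'-\lambda\in|k'-k|+2\mathbb N$. For $(\boldsymbol\mu,\boldsymbol m)\in\mathbb C^n\times\mathbb Z^n$ and $(\lambda,k)\in\mathbb C\times\mathbb Z$ let $N_{(\boldsymbol\mu,\boldsymbol m)}(\lambda,k)=\#\{l:(\lambda,k)\preccurlyeq(2\mu_l,m_l)\}$, and define the space of functions on $\mathbb C^\times$ $$\mathscr S_{\mathrm{sis}}^{(\boldsymbol\mu,\boldsymbol m)}(\mathbb C^\times)=\sum_{(\lambda,k)\in\mathbb C\times\mathbb Z}\ \sum_{0\le j<N_{(\boldsymbol\mu,\boldsymbol m)}(\lambda,k)}[z]^{-k}|z|^{-\lambda}(\log|z|)^j\,\mathscr S(\mathbb C)$$ (algebraic sum). (When any two entries $(2\mu_l,m_l)$, $(2\mu_{l'},m_{l'})$ with $2\mu_{l'}-2\mu_l-|m_{l'}-m_l|\in2\mathbb Z$ are comparable for $\preccurlyeq$, it suffices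 to sum over the entries $(\lambda,k)=(2\mu_l,m_l)$, $1\le l\le n$.) For $k\in\mathbb Z$ the Mellin transform $\mathcal M_k\upsilon$ is the meromorphic function on $\mathbb C$ which for $\mathrm{Re}\,s$ sufficiently large is given by the absolutely convergent integral $$\mathcal M_k\upsilon(s)=4\pi\int_0^\infty\upsilon_{-k}(x)\,x^{s-1}\,dx,\qquad \upsilon_{k}(x)=\frac1{2\pi}\int_0^{2\pi}\upsilon(xe^{i\theta})e^{-ik\theta}\,d\theta .$$ Put $$G_k(s)=i^{|k|}(2\pi)^{1-2s}\frac{\Gamma(s+|k|/2)}{\Gamma(1-s+|k|/2)},\qquad G_{(\boldsymbol\mu,\boldsymbol m)}(s)=\prod_{l=1}^nG_{m_l}(s-\mu_l),$$ and let $\boldsymbol e^n=(1,\dots,1)$ and $|\boldsymbol m|=\sum_l m_l$. **Theorem.** Let $(\boldsymbol\mu,\boldsymbol m)\in\mathbb C^n\times\mathbb Z^n$ and $\upsilon\in\mathscr S_{\mathrm{sis}}^{(-\boldsymbol\mu,-\boldsymbol m)}(\mathbb C^\times)$. There is a unique function $\Upsilon\in\mathscr S_{\mathrm{sis}}^{(\boldsymbol\mu,\boldsymbol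 m)}(\mathbb C^\times)$ such that, for every $k\in\mathbb Z$, the Mellin transforms $\mathcal M_{-k}\Upsilon$ and $\mathcal M_k\upsilon$ exist as meromorphic functions on $\mathbb C$ and $$\mathcal M_{-k}\Upsilon(2s)=G_{(\boldsymbol\mu,\boldsymbol m+k\boldsymbol e^n)}(s)\,\mathcal M_k\upsilon(2(1-s))$$ as meromorphic functions of $s$. This $\Upsilon$ is called the Hankel transform $\mathcal H_{(\boldsymbol\mu,\boldsymbol m)}\upsilon$. Moreover, the inversion formula $$\bigl(\mathcal H_{(-\boldsymbol\mu,-\boldsymbol m)}\mathcal H_{(\boldsymbol\mu,\boldsymbol m)}\upsilon\bigr)(z)=(-1)^{|\boldsymbol m|}\,\upsilon\bigl((-1)^nz\bigr),\qquad z\in\mathbb C^\times,$$ holds. -/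

import Mathlib

open scoped SchwartzMap

/-- The order relation `(λ, m) ≼ (λ', m')` on `ℂ × ℤ`: `λ' - λ ∈ |m' - m| + 2ℕ`. -/
def SisLE (p q : ℂ × ℤ) : Prop :=
  ∃ k : ℕ, q.1 - p.1 = ((|q.2 - p.2| : ℤ) : ℂ) + 2 * (k : ℂ)

/-- The equivalence relation `(λ, m) ∼ (λ', m')` on `ℂ × ℤ`: `λ' - λ - |m' - m| ∈ 2ℤ`. -/
def SisEquiv (p q : ℂ × ℤ) : Prop :=
  ∃ k : ℤ, q.1 - p.1 - ((|q.2 - p.2| : ℤ) : ℂ) = 2 * (k : ℂ)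

/-- The number of indices `l` with `p ≼ (2 μ_l, m_l)`. -/
noncomputable def sisMult {n : ℕ} (μ : Fin n → ℂ) (m : Fin n → ℤ) (p : ℂ × ℤ) : ℕ :=
  Nat.card {l : Fin n // SisLE p (2 * μ l, m l)}

/-- For `p = (λ, m)` and `j`, the linear map from Schwartz functions on `ℂ` to functions on `ℂˣ`
sending `φ` to `z ↦ [z]^(-m) |z|^(-λ) (log |z|)^j φ(z)`, where `[z] = z / |z|`. -/
noncomputable def sisMap (p : ℂ × ℤ) (j : ℕ) : 𝓢(ℂ, ℂ) →ₗ[ℂ] (ℂˣ → ℂ) where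
  toFun φ := fun z =>
    ((z : ℂ) / (‖(z : ℂ)‖ : ℂ)) ^ (-p.2) * (‖(z : ℂ)‖ : ℂ) ^ (-p.1)
      * (Real.log ‖(z : ℂ)‖ : ℂ) ^ j * φ (z : ℂ)
  map_add' φ ψ := by
    funext z
    simp only [add_apply, Pi.add_apply]
    ring
  map_smul' c φ := by
    funext z
    simp only [smul_apply, Pi.smul_apply, smul_eq_mul, RingHom.id_apply]
    ring

/-- The space `[z]^(-m) |z|^(-λ) (log |z|)^j 𝓢(ℂ)` of functions on `ℂˣ`, with `p = (λ, m)`. -/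
noncomputable def sisPiece (p : ℂ × ℤ) (j : ℕ) : Submodule ℂ (ℂˣ → ℂ) :=
  LinearMap.range (sisMap p j)

/-- The space of functions on `ℂˣ` with simple singularities at zero of type `(μ, m)`: the sum of
the spaces `[z]^(-k) |z|^(-λ) (log |z|)^j 𝓢(ℂ)` over all `p = (λ, k)` in `ℂ × ℤ` and all `j` that
are smaller than the number of indices `l` with `p ≼ (2 μ_l, m_l)`.

If comparable and equivalent entries `(2 μ_l, m_l)` are the same thing, then it is enough to let `p`
run through these entries themselves: see `sisSpace_eq_of_chain`. -/
noncomputable def sisSpace {n : ℕ} (μ : Fin n → ℂ) (m : Fin n → ℤ) : Submodule ℂ (ℂˣ → ℂ) :=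
  ⨆ (p : ℂ × ℤ) (j : ℕ) (_ : j < sisMult μ m p), sisPiece p j

/-- The `k`-th Fourier coefficient `υ_k(x) = (2π)⁻¹ ∫_0^{2π} υ(x e^{iθ}) e^{-ikθ} dθ`, `x > 0`.
(A function on `ℂˣ` is extended to `ℂ` by zero, which plays no role for `x > 0`.) -/
noncomputable def fourierCoeffC (υ : ℂˣ → ℂ) (k : ℤ) (x : ℝ) : ℂ :=
  (2 * (Real.pi : ℂ))⁻¹ * ∫ θ in (0 : ℝ)..(2 * Real.pi),
    Function.extend (Units.val : ℂˣ → ℂ) υ 0 ((x : ℂ) * Complex.exp (Complex.I * (θ : ℂ)))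
      * Complex.exp (-(Complex.I * (k : ℂ) * (θ : ℂ)))

/-- `H` is the Mellin transform `M_k υ` of order `k`: the meromorphic function on `ℂ` that is given,
on some right half-plane, by the absolutely convergent integral
`M_k υ(s) = 2 ∫_0^∞ ∫_0^{2π} υ(x e^{iθ}) e^{ikθ} dθ x^{s-1} dx = 4π ∫_0^∞ υ_{-k}(x) x^{s-1} dx`. -/
def IsMellinC (k : ℤ) (υ : ℂˣ → ℂ) (H : ℂ → ℂ) : Prop :=
  Meromorphic H ∧ ∃ σ : ℝ, ∀ s : ℂ, σ < s.re →
    HasMellin (fun x : ℝ => 4 * (Real.pi : ℂ) * fourierCoeffC υ (-k) x) s (H s)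

/-- The gamma factor `G_k(s) = i^|k| (2π)^(1-2s) Γ(s + |k|/2) / Γ(1 - s + |k|/2)`. -/
noncomputable def gammaFactorOne (k : ℤ) (s : ℂ) : ℂ :=
  Complex.I ^ k.natAbs * (2 * (Real.pi : ℂ)) ^ (1 - 2 * s)
    * Complex.Gamma (s + (k.natAbs : ℂ) / 2) / Complex.Gamma (1 - s + (k.natAbs : ℂ) / 2)

/-- The gamma factor `G_{(μ, m)}(s) = ∏_l G_{m_l}(s - μ_l)`. -/
noncomputable def gammaFactor {n : ℕ} (μ : Fin n → ℂ) (m : Fin n → ℤ) (s : ℂ) : ℂ :=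
  ∏ l, gammaFactorOne (m l) (s - μ l)

/-- The identities `M_{-k} Υ(2s) = G_{(μ, m + k eⁿ)}(s) M_k υ(2(1-s))`, `k ∈ ℤ`, of meromorphic
functions of `s`; the Mellin transforms are required to exist as meromorphic functions on `ℂ`. -/
def HankelIdentity {n : ℕ} (μ : Fin n → ℂ) (m : Fin n → ℤ) (υ Υ : ℂˣ → ℂ) : Prop :=
  ∀ k : ℤ, ∃ H K : ℂ → ℂ, IsMellinC (-k) Υ H ∧ IsMellinC k υ K ∧
    (fun s : ℂ => H (2 * s)) =ᶠ[Filter.codiscrete ℂ]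
      fun s : ℂ => gammaFactor μ (fun l => m l + k) s * K (2 * (1 - s))

/-- The Hankel transform of index `(μ, m)`: the function in `sisSpace μ m` that satisfies the
identities `HankelIdentity` (an arbitrary function if there is none). -/
noncomputable def hankel {n : ℕ} (μ : Fin n → ℂ) (m : Fin n → ℤ) (υ : ℂˣ → ℂ) : ℂˣ → ℂ :=
  Classical.epsilon fun Υ => Υ ∈ sisSpace μ m ∧ HankelIdentity μ m υ Υ

theorem SisLE.trans {p q r : ℂ × ℤ} (h : SisLE p q) (h' : SisLE q r) : SisLE p r := by
  obtain ⟨k, hk⟩ := h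
  obtain ⟨k', hk'⟩ := h'
  have key : ∃ c : ℕ, |q.2 - p.2| + |r.2 - q.2| = |r.2 - p.2| + 2 * (c : ℤ) := by
    refine ⟨((|q.2 - p.2| + |r.2 - q.2| - |r.2 - p.2|) / 2).toNat, ?_⟩
    grind
  obtain ⟨c, hc⟩ := key
  refine ⟨k + k' + c, ?_⟩
  have hc' := congrArg (Int.cast : ℤ → ℂ) hc
  push_cast at hc' hk hk' ⊢
  linear_combination hk + hk' + hc'

theorem SisLE.sisPiece_le {p q : ℂ × ℤ} (h : SisLE p q) (j : ℕ) : sisPiece p j ≤ sisPiece q j := by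
  obtain ⟨k, hk⟩ := h
  have key : ∃ a b : ℕ, ∀ z : ℂˣ,
      ((z : ℂ) / (‖(z : ℂ)‖ : ℂ)) ^ (-p.2) * (‖(z : ℂ)‖ : ℂ) ^ (-p.1) =
      ((z : ℂ) / (‖(z : ℂ)‖ : ℂ)) ^ (-q.2) * (‖(z : ℂ)‖ : ℂ) ^ (-q.1) *
        ((z : ℂ) ^ a * (starRingEnd ℂ (z : ℂ)) ^ b) := by
    have main : ∃ a b : ℕ, ∀ z : ℂˣ, ((z : ℂ) / (‖(z : ℂ)‖ : ℂ)) ^ (q.2 - p.2) *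
        (‖(z : ℂ)‖ : ℂ) ^ (|q.2 - p.2| + 2 * (k : ℤ)) =
        (z : ℂ) ^ a * (starRingEnd ℂ (z : ℂ)) ^ b := by
      rcases le_total 0 (q.2 - p.2) with hd | hd
      · obtain ⟨d, hd'⟩ := Int.eq_ofNat_of_zero_le hd
        refine ⟨d + k, k, fun z => ?_⟩
        have hz : (‖(z : ℂ)‖ : ℂ) ≠ 0 := by simp
        have h2 : (z : ℂ) * starRingEnd ℂ (z : ℂ) = (‖(z : ℂ)‖ : ℂ) ^ 2 := Complex.mul_conj' _
        rw [hd', Nat.abs_cast, zpow_add₀ hz, zpow_natCast, zpow_natCast, zpow_mul,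
          zpow_natCast, zpow_ofNat, ← h2, div_pow, mul_pow, pow_add]
        field_simp
      · obtain ⟨d, hd'⟩ := Int.exists_eq_neg_ofNat hd
        refine ⟨k, d + k, fun z => ?_⟩
        have hz : (‖(z : ℂ)‖ : ℂ) ≠ 0 := by simp
        have hz' : (z : ℂ) ≠ 0 := z.ne_zero
        have h2 : (z : ℂ) * starRingEnd ℂ (z : ℂ) = (‖(z : ℂ)‖ : ℂ) ^ 2 := Complex.mul_conj' _
        rw [hd', abs_neg, Nat.abs_cast, zpow_add₀ hz, zpow_neg, zpow_natCast, zpow_natCast,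
          zpow_mul, zpow_natCast, zpow_ofNat, ← h2, div_pow, mul_pow, pow_add]
        have h3 : (‖(z : ℂ)‖ : ℂ) ^ d * (‖(z : ℂ)‖ : ℂ) ^ d =
            (z : ℂ) ^ d * starRingEnd ℂ (z : ℂ) ^ d := by
          rw [← mul_pow, ← mul_pow, h2, sq]
        field_simp
        linear_combination h3
    obtain ⟨a, b, hab⟩ := main
    refine ⟨a, b, fun z => ?_⟩
    have hz : (‖(z : ℂ)‖ : ℂ) ≠ 0 := by simp
    have hu : (z : ℂ) / (‖(z : ℂ)‖ : ℂ) ≠ 0 := div_ne_zero z.ne_zero hz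
    have e1 : ((z : ℂ) / (‖(z : ℂ)‖ : ℂ)) ^ (-p.2) =
        ((z : ℂ) / (‖(z : ℂ)‖ : ℂ)) ^ (-q.2) * ((z : ℂ) / (‖(z : ℂ)‖ : ℂ)) ^ (q.2 - p.2) := by
      rw [← zpow_add₀ hu]; congr 1; ring
    have e2 : (‖(z : ℂ)‖ : ℂ) ^ (-p.1) =
        (‖(z : ℂ)‖ : ℂ) ^ (-q.1) * (‖(z : ℂ)‖ : ℂ) ^ (|q.2 - p.2| + 2 * (k : ℤ)) := by
      rw [← Complex.cpow_intCast, ← Complex.cpow_add _ _ hz]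
      congr 1
      push_cast at hk ⊢
      linear_combination hk
    rw [← hab z, e1, e2]
    ring
  obtain ⟨a, b, hab⟩ := key
  rintro _ ⟨φ, rfl⟩
  have hg : Function.HasTemperateGrowth (fun z : ℂ => z ^ a * (starRingEnd ℂ z) ^ b) := by
    have h1 : Function.HasTemperateGrowth (fun z : ℂ => z) := by fun_prop
    have h2 : Function.HasTemperateGrowth (fun z : ℂ => starRingEnd ℂ z) :=
      Complex.conjCLE.toContinuousLinearMap.hasTemperateGrowth
    exact (h1.pow a).mul (h2.pow b)
  refine ⟨SchwartzMap.smulLeftCLM ℂ (fun z : ℂ => z ^ a * (starRingEnd ℂ z) ^ b) φ, ?_⟩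
  funext z
  simp only [sisMap, LinearMap.coe_mk, AddHom.coe_mk,
    SchwartzMap.smulLeftCLM_apply_apply hg, smul_eq_mul]
  rw [hab z]
  ring

/-- If any two equivalent entries `(2 μ_l, m_l)` are comparable, then `sisSpace μ m` is the sum of
the spaces `[z]^(-m_l) |z|^(-2 μ_l) (log |z|)^j 𝓢(ℂ)` over all `l` and all `j` smaller than
the number of `l'` with `(2 μ_l, m_l) ≼ (2 μ_l', m_l')`. -/
theorem sisSpace_eq_of_chain {n : ℕ} (μ : Fin n → ℂ) (m : Fin n → ℤ)
    (h : ∀ l l', SisEquiv (2 * μ l, m l) (2 * μ l', m l') →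
      SisLE (2 * μ l, m l) (2 * μ l', m l') ∨ SisLE (2 * μ l', m l') (2 * μ l, m l)) :
    sisSpace μ m = ⨆ (l : Fin n) (j : ℕ) (_ : j < sisMult μ m (2 * μ l, m l)),
      sisPiece (2 * μ l, m l) j := by
  classical
  apply le_antisymm
  · refine iSup_le fun p => iSup_le fun j => iSup_le fun hj => ?_
    let F : Finset (Fin n) := Finset.univ.filter fun l => SisLE p (2 * μ l, m l)
    have hF : sisMult μ m p = F.card := by
      rw [sisMult, Nat.card_eq_fintype_card, Fintype.card_subtype]
    have hne : F.Nonempty := by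
      rw [← Finset.card_pos, ← hF]; omega
    have hcomp : ∀ l ∈ F, ∀ l' ∈ F, SisLE (2 * μ l, m l) (2 * μ l', m l') ∨
        SisLE (2 * μ l', m l') (2 * μ l, m l) := by
      intro l hl l' hl'
      apply h
      obtain ⟨k, hk⟩ := (Finset.mem_filter.1 hl).2
      obtain ⟨k', hk'⟩ := (Finset.mem_filter.1 hl').2
      have key : ∃ c : ℤ, |m l' - p.2| - |m l - p.2| - |m l' - m l| = 2 * c := by
        refine ⟨(|m l' - p.2| - |m l - p.2| - |m l' - m l|) / 2, ?_⟩
        grind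
      obtain ⟨c, hc⟩ := key
      refine ⟨k' - k + c, ?_⟩
      have hc' := congrArg (Int.cast : ℤ → ℂ) hc
      push_cast at hc' hk hk' ⊢
      linear_combination hk' - hk + hc'
    have hmin : ∃ l₀ ∈ F, ∀ l ∈ F, SisLE (2 * μ l₀, m l₀) (2 * μ l, m l) := by
      obtain ⟨l₀, hl₀, hmin⟩ := F.exists_min_image (fun l => (2 * μ l).re) hne
      refine ⟨l₀, hl₀, fun l hl => ?_⟩
      rcases hcomp l₀ hl₀ l hl with h1 | ⟨k, hk⟩
      · exact h1
      · have hre := congrArg Complex.re hk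
        have hle := hmin l hl
        have hcast : (((|m l₀ - m l| : ℤ) : ℂ) + 2 * (k : ℂ)).re =
            ((|m l₀ - m l| : ℤ) : ℝ) + 2 * (k : ℝ) := by simp
        rw [hcast, Complex.sub_re] at hre
        have h0 : (0 : ℝ) ≤ ((|m l₀ - m l| : ℤ) : ℝ) := by positivity
        have hk0 : (0 : ℝ) ≤ (k : ℝ) := by positivity
        have hk1 : (k : ℝ) = 0 := by linarith
        have hm1 : ((|m l₀ - m l| : ℤ) : ℝ) = 0 := by linarith
        have hk2 : k = 0 := by exact_mod_cast hk1
        have hm2 : |m l₀ - m l| = 0 := by exact_mod_cast hm1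
        refine ⟨0, ?_⟩
        rw [abs_sub_comm] at hm2
        rw [abs_sub_comm] at hk
        simp only [hm2, hk2] at hk ⊢
        linear_combination -hk
    obtain ⟨l₀, hl₀, hall⟩ := hmin
    have hj' : j < sisMult μ m (2 * μ l₀, m l₀) := by
      refine lt_of_lt_of_le hj ?_
      rw [hF, sisMult, Nat.card_eq_fintype_card, Fintype.card_subtype]
      apply Finset.card_le_card
      intro l hl
      exact Finset.mem_filter.2 ⟨Finset.mem_univ _, hall l hl⟩
    have hle := SisLE.sisPiece_le (Finset.mem_filter.1 hl₀).2 j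
    exact hle.trans (le_iSup_of_le l₀ (le_iSup_of_le j (le_iSup_of_le hj' le_rfl)))
  · refine iSup_le fun l => iSup_le fun j => iSup_le fun hj => ?_
    exact le_iSup_of_le _ (le_iSup_of_le j (le_iSup_of_le hj le_rfl))

/-!
The proof characterises `sisSpace μ m`, `n ≥ 1`, by Mellin transforms. A continuous function on `ℂˣ`
lies in it if and only if its Mellin transforms `M_k`, `k ∈ ℤ`, are meromorphic, have at every point
`s` a pole of order at most `sisMult μ m (s, k)`, and decay rapidly on vertical strips, jointly in
`k` and `Im s` (`SisData`).

* One direction is `exists_mellinData_of_mem_sisSpace`. Integration by parts with the Wirtinger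
  derivatives continues the Mellin transforms of a Schwartz function, with simple poles at the
  points `-(|k| + 2i)` and rapid decay (`mellinExt_simple_pole`, `rapidDecay_mellinExt`); the factor
  `[z]^(-m) |z|^(-λ) (log |z|)^j` translates them and differentiates them `j` times
  (`mellinData_sisMap`).
* The other direction is `exists_mem_sisSpace_mellinData`. A version of Borel's lemma provides
  Schwartz functions with arbitrary residues at the possible poles
  (`exists_schwartz_mellinExt_residue`). Points `(λ, k)` with the same set of entries
  `(2 μ_l, m_l)` above them have the greatest lower bound of these entries as a common upper bound
  (`exists_sisLE_glb`), so that finitely many Borel functions remove all principal parts. What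
  remains is entire and of rapid decay, and its Mellin inversion integral, summed over the angular
  frequencies, is a Schwartz function that vanishes to infinite order at the origin
  (`EntireDecay.toSchwartz`, `EntireDecay.hasMellin_toSchwartz`).

The gamma factor grows at most polynomially on vertical strips (`polyGrowth_gammaFactor`), and its
zeros and poles turn the bound on the pole orders for `(-μ, -m)` at `(2 - s, -k)` into the one for
`(μ, m)` at `(s, k)` (`sisData_gammaFactor_mul`). This gives existence. Uniqueness follows from
Mellin inversion and the uniqueness of Fourier coefficients (`MellinData.eq_zero`), and the
inversion formula from uniqueness and `G_{-m}(s) G_m(1 - s) = (-1)^m`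
(`gammaFactorOne_neg_mul_gammaFactorOne`). For `n = 0` both spaces are zero.
-/

namespace SimpleSingularity

open Complex Filter Topology MeasureTheory Set

/-! ### Fourier coefficients of Schwartz functions on circles -/

/-- Twice the integral of `f(x e^{iθ}) e^{ikθ}` over the circle of radius `x`; this is
`4π` times the Fourier coefficient of order `-k`. -/
noncomputable def polarCoeff (k : ℤ) (f : ℂ → ℂ) (x : ℝ) : ℂ :=
  2 * ∫ θ in (0 : ℝ)..(2 * Real.pi), f (x * exp (I * θ)) * exp (I * k * θ)

theorem norm_exp_I_mul_int_mul (k : ℤ) (θ : ℝ) : ‖exp (I * k * θ)‖ = 1 := by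
  rw [show I * (k : ℂ) * θ = ((k * θ : ℝ) : ℂ) * I by push_cast; ring, norm_exp_ofReal_mul_I]

theorem norm_ofReal_mul_exp (x : ℝ) (θ : ℝ) : ‖(x : ℂ) * exp (I * θ)‖ = |x| := by
  rw [norm_mul, mul_comm I, norm_exp_ofReal_mul_I, mul_one, norm_real, Real.norm_eq_abs]

theorem continuous_polarCoeff (k : ℤ) {f : ℂ → ℂ} (hf : Continuous f) :
    Continuous (polarCoeff k f) := by
  refine continuous_const.mul ?_
  apply intervalIntegral.continuous_parametric_intervalIntegral_of_continuous'
  fun_prop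

theorem norm_polarCoeff_le (k : ℤ) {f : ℂ → ℂ} {x B : ℝ}
    (h : ∀ z : ℂ, ‖z‖ = |x| → ‖f z‖ ≤ B) : ‖polarCoeff k f x‖ ≤ 4 * Real.pi * B := by
  have h1 : ‖∫ θ in (0 : ℝ)..(2 * Real.pi), f (x * exp (I * θ)) * exp (I * k * θ)‖
      ≤ B * |2 * Real.pi - 0| := by
    apply intervalIntegral.norm_integral_le_of_norm_le_const
    intro θ _
    rw [norm_mul, norm_exp_I_mul_int_mul, mul_one]
    exact h _ (norm_ofReal_mul_exp x θ)
  rw [sub_zero, abs_of_pos Real.two_pi_pos] at h1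
  rw [polarCoeff, norm_mul, Complex.norm_ofNat]
  linarith

theorem exists_norm_polarCoeff_le (φ : 𝓢(ℂ, ℂ)) (N : ℕ) :
    ∃ C, 0 ≤ C ∧ ∀ (k : ℤ) (x : ℝ), |x| ^ N * ‖polarCoeff k φ x‖ ≤ C := by
  obtain ⟨C, hC⟩ := φ.decay N 0
  refine ⟨4 * Real.pi * C, ?_, fun k x => ?_⟩
  · have := (mul_nonneg (by positivity) (norm_nonneg _)).trans (hC.2 0)
    positivity
  · rcases eq_or_ne (|x| ^ N) 0 with h0 | h0
    · have := (mul_nonneg (by positivity) (norm_nonneg _)).trans (hC.2 0)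
      rw [h0, zero_mul]; positivity
    have hpos : 0 < |x| ^ N := lt_of_le_of_ne (by positivity) h0.symm
    have := norm_polarCoeff_le k (f := φ) (x := x) (B := C / |x| ^ N) (fun z hz => by
      rw [le_div_iff₀ hpos, ← hz, mul_comm]
      simpa using hC.2 z)
    calc _ ≤ |x| ^ N * (4 * Real.pi * (C / |x| ^ N)) := by gcongr
      _ = _ := by field_simp

theorem polarCoeff_isBigO_atTop (k : ℤ) (φ : 𝓢(ℂ, ℂ)) (a : ℝ) :
    polarCoeff k φ =O[atTop] fun x : ℝ => x ^ (-a) := by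
  obtain ⟨C, hC0, hC⟩ := exists_norm_polarCoeff_le φ ⌈a⌉₊
  refine Asymptotics.IsBigO.of_bound C ?_
  filter_upwards [eventually_ge_atTop 1] with x hx
  have hx0 : 0 < x := by linarith
  have h := hC k x
  rw [abs_of_pos hx0] at h
  have h2 : x ^ a ≤ x ^ ⌈a⌉₊ := by
    rw [← Real.rpow_natCast]
    exact Real.rpow_le_rpow_of_exponent_le hx (Nat.le_ceil a)
  rw [Real.norm_of_nonneg (by positivity), Real.rpow_neg hx0.le, ← div_eq_mul_inv,
    le_div_iff₀ (by positivity), mul_comm]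
  exact (mul_le_mul_of_nonneg_right h2 (norm_nonneg _)).trans h

theorem polarCoeff_isBigO_zero (k : ℤ) (φ : 𝓢(ℂ, ℂ)) :
    polarCoeff k φ =O[𝓝[>] 0] fun x : ℝ => x ^ (-(0 : ℝ)) := by
  obtain ⟨C, hC0, hC⟩ := exists_norm_polarCoeff_le φ 0
  refine Asymptotics.IsBigO.of_bound C (Eventually.of_forall fun x => ?_)
  simpa using hC k x

theorem locallyIntegrableOn_polarCoeff (k : ℤ) (φ : 𝓢(ℂ, ℂ)) :
    LocallyIntegrableOn (polarCoeff k φ) (Ioi 0) :=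
  (continuous_polarCoeff k φ.continuous).locallyIntegrable.locallyIntegrableOn _

theorem mellinConvergent_polarCoeff (k : ℤ) (φ : 𝓢(ℂ, ℂ)) {s : ℂ} (hs : 0 < s.re) :
    MellinConvergent (polarCoeff k φ) s :=
  mellinConvergent_of_isBigO_rpow (locallyIntegrableOn_polarCoeff k φ)
    (polarCoeff_isBigO_atTop k φ (s.re + 1)) (by linarith) (polarCoeff_isBigO_zero k φ) hs

theorem differentiableAt_mellin_polarCoeff (k : ℤ) (φ : 𝓢(ℂ, ℂ)) {s : ℂ} (hs : 0 < s.re) :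
    DifferentiableAt ℂ (mellin (polarCoeff k φ)) s :=
  mellin_differentiableAt_of_isBigO_rpow (locallyIntegrableOn_polarCoeff k φ)
    (polarCoeff_isBigO_atTop k φ (s.re + 1)) (by linarith) (polarCoeff_isBigO_zero k φ) hs

/-- The Mellin transforms of all Fourier coefficients of a Schwartz function are bounded, uniformly
in the order, on vertical strips in the right half-plane. -/
theorem exists_norm_mellin_polarCoeff_le (φ : 𝓢(ℂ, ℂ)) {a b : ℝ} (ha : 0 < a) :
    ∃ C, ∀ (k : ℤ) (s : ℂ), a ≤ s.re → s.re ≤ b → ‖mellin (polarCoeff k φ) s‖ ≤ C := by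
  obtain ⟨C₀, hC₀, h₀⟩ := exists_norm_polarCoeff_le φ 0
  obtain ⟨C₁, hC₁, h₁⟩ := exists_norm_polarCoeff_le φ (⌈b⌉₊ + 1)
  let B : ℝ → ℝ := fun x => if x ≤ 1 then C₀ * x ^ (a - 1) else C₁ * x ^ (-2 : ℝ)
  have hB : IntegrableOn B (Ioi 0) := by
    rw [← Ioc_union_Ioi_eq_Ioi zero_le_one]
    refine IntegrableOn.union ?_ ?_
    · have : IntegrableOn (fun x : ℝ => C₀ * x ^ (a - 1)) (Ioc 0 1) := by
        apply Integrable.const_mul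
        have := intervalIntegral.intervalIntegrable_rpow' (a := 0) (b := 1)
          (show -1 < a - 1 by linarith)
        rwa [intervalIntegrable_iff_integrableOn_Ioc_of_le zero_le_one] at this
      refine this.congr_fun (fun x hx => ?_) measurableSet_Ioc
      simp [B, hx.2]
    · have : IntegrableOn (fun x : ℝ => C₁ * x ^ (-2 : ℝ)) (Ioi 1) :=
        Integrable.const_mul (integrableOn_Ioi_rpow_of_lt (by norm_num) one_pos) _
      refine this.congr_fun (fun x hx => ?_) measurableSet_Ioi
      simp [B, not_le.2 (mem_Ioi.1 hx)]
  refine ⟨∫ x in Ioi 0, B x, fun k s hsa hsb => ?_⟩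
  refine norm_integral_le_of_norm_le hB ?_
  refine (ae_restrict_iff' measurableSet_Ioi).2 (Eventually.of_forall fun x hx => ?_)
  have hx0 : 0 < x := hx
  rw [norm_smul, norm_cpow_eq_rpow_re_of_pos hx0, sub_re, one_re]
  by_cases hx1 : x ≤ 1
  · simp only [B, hx1, if_true]
    rw [mul_comm]
    exact mul_le_mul (by simpa using h₀ k x)
      (Real.rpow_le_rpow_of_exponent_ge hx0 hx1 (by linarith)) (by positivity) hC₀
  · simp only [B, hx1, if_false]
    push Not at hx1
    have h := h₁ k x
    rw [abs_of_pos hx0] at h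
    have e : x ^ (s.re - 1) ≤ x ^ (⌈b⌉₊ + 1) * x ^ (-2 : ℝ) := by
      rw [← Real.rpow_natCast, ← Real.rpow_add hx0]
      refine Real.rpow_le_rpow_of_exponent_le hx1.le ?_
      have := Nat.le_ceil b
      push_cast
      linarith
    calc _ ≤ x ^ (⌈b⌉₊ + 1) * x ^ (-2 : ℝ) * ‖polarCoeff k φ x‖ := by gcongr
      _ = (x ^ (⌈b⌉₊ + 1) * ‖polarCoeff k φ x‖) * x ^ (-2 : ℝ) := by ring
      _ ≤ _ := by gcongr

/-! ### Wirtinger derivatives and the recursion for Mellin transforms -/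

open LineDeriv

/-- The Wirtinger derivative `∂φ/∂z` of a Schwartz function. -/
noncomputable def wirtinger (φ : 𝓢(ℂ, ℂ)) : 𝓢(ℂ, ℂ) :=
  (1 / 2 : ℂ) • (∂_{(1 : ℂ)} φ - I • ∂_{I} φ)

/-- The Wirtinger derivative `∂φ/∂z̄` of a Schwartz function. -/
noncomputable def wirtingerBar (φ : 𝓢(ℂ, ℂ)) : 𝓢(ℂ, ℂ) :=
  (1 / 2 : ℂ) • (∂_{(1 : ℂ)} φ + I • ∂_{I} φ)

theorem fderiv_eq_wirtinger (φ : 𝓢(ℂ, ℂ)) (z v : ℂ) :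
    fderiv ℝ φ z v = wirtinger φ z * v + wirtingerBar φ z * (starRingEnd ℂ) v := by
  have hv : v = v.re • (1 : ℂ) + v.im • I := by simp
  have hL : fderiv ℝ φ z v = v.re * fderiv ℝ φ z 1 + v.im * fderiv ℝ φ z I := by
    conv_lhs => rw [hv, map_add, map_smul, map_smul]
    simp
  have hc : (starRingEnd ℂ) v = v.re - v.im * I := by
    apply Complex.ext <;> simp
  have hv' : v = v.re + v.im * I := (re_add_im v).symm
  rw [hL, hc]
  conv_rhs => enter [1, 2]; rw [hv']
  simp only [wirtinger, wirtingerBar, smul_apply, sub_apply, add_apply,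
    SchwartzMap.lineDerivOp_apply_eq_fderiv, smul_eq_mul]
  linear_combination ((v.im : ℂ) * fderiv ℝ φ z I) * I_sq

theorem hasDerivAt_exp_I_mul (c : ℂ) (θ : ℝ) :
    HasDerivAt (fun θ : ℝ => exp (I * c * θ)) (I * c * exp (I * c * θ)) θ := by
  have h : HasDerivAt (fun θ : ℝ => I * c * (θ : ℂ)) (I * c) θ := by
    simpa using (Complex.ofRealCLM.hasDerivAt (x := θ)).const_mul (I * c)
  simpa [mul_comm] using h.cexp

/-- Integration by parts in the angle. -/
theorem polarCoeff_angular (k : ℤ) (φ : 𝓢(ℂ, ℂ)) (x : ℝ) :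
    x * (polarCoeff (k + 1) (wirtinger φ) x - polarCoeff (k - 1) (wirtingerBar φ) x)
      = -k * polarCoeff k φ x := by
  have hd : ∀ θ : ℝ, HasDerivAt (fun θ : ℝ => φ (x * exp (I * θ)) * exp (I * k * θ))
      (I * (x * (wirtinger φ (x * exp (I * θ)) * exp (I * (k + 1 : ℤ) * θ)
        - wirtingerBar φ (x * exp (I * θ)) * exp (I * (k - 1 : ℤ) * θ))
        + k * (φ (x * exp (I * θ)) * exp (I * k * θ)))) θ := by
    intro θ
    have h1 : HasDerivAt (fun θ : ℝ => (x : ℂ) * exp (I * θ)) (x * (I * exp (I * θ))) θ := by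
      simpa using (hasDerivAt_exp_I_mul 1 θ).const_mul (x : ℂ)
    have h2 := (φ.hasFDerivAt (x * exp (I * θ))).comp_hasDerivAt θ h1
    rw [fderiv_eq_wirtinger] at h2
    have h3 := h2.mul (hasDerivAt_exp_I_mul k θ)
    refine h3.congr_deriv ?_
    have e1 : (starRingEnd ℂ) (x * (I * exp (I * θ))) = -(x * (I * exp (-(I * θ)))) := by
      rw [map_mul, map_mul, ← exp_conj, map_mul, conj_I, conj_ofReal, conj_ofReal]
      simp
    have e2 : exp (I * (k + 1 : ℤ) * θ) = exp (I * k * θ) * exp (I * θ) := by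
      rw [← exp_add]; push_cast; ring_nf
    have e3 : exp (I * (k - 1 : ℤ) * θ) = exp (I * k * θ) * exp (-(I * θ)) := by
      rw [← exp_add]; push_cast; ring_nf
    simp only [Function.comp_def]
    rw [e1, e2, e3]
    ring
  have hi := intervalIntegral.integral_eq_sub_of_hasDerivAt (a := 0) (b := 2 * Real.pi)
    (fun θ _ => hd θ) (by
      apply Continuous.intervalIntegrable
      have := (wirtinger φ).continuous
      have := (wirtingerBar φ).continuous
      have := φ.continuous
      fun_prop)
  have per : φ (x * exp (I * (2 * Real.pi : ℝ))) * exp (I * k * (2 * Real.pi : ℝ))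
      - φ (x * exp (I * (0 : ℝ))) * exp (I * k * (0 : ℝ)) = 0 := by
    have a1 : exp (I * (2 * Real.pi : ℝ)) = 1 := by
      rw [show I * ((2 * Real.pi : ℝ) : ℂ) = 2 * Real.pi * I by push_cast; ring, exp_two_pi_mul_I]
    have a2 : exp (I * k * (2 * Real.pi : ℝ)) = 1 := by
      rw [show I * k * ((2 * Real.pi : ℝ) : ℂ) = k * (2 * Real.pi * I) by push_cast; ring,
        exp_int_mul_two_pi_mul_I]
    rw [a1, a2]; simp
  rw [per, intervalIntegral.integral_const_mul, intervalIntegral.integral_add,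
    intervalIntegral.integral_const_mul, intervalIntegral.integral_sub,
    intervalIntegral.integral_const_mul] at hi
  · have hi' := (mul_eq_zero.1 hi).resolve_left I_ne_zero
    simp only [polarCoeff]
    linear_combination 2 * hi'
  all_goals
    apply Continuous.intervalIntegrable
    have := (wirtinger φ).continuous
    have := (wirtingerBar φ).continuous
    have := φ.continuous
    fun_prop

theorem hasDerivAt_polarCoeff (k : ℤ) (φ : 𝓢(ℂ, ℂ)) (x : ℝ) :
    HasDerivAt (polarCoeff k φ)
      (polarCoeff (k + 1) (wirtinger φ) x + polarCoeff (k - 1) (wirtingerBar φ) x) x := by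
  have cw := (wirtinger φ).continuous
  have cb := (wirtingerBar φ).continuous
  have cφ := φ.continuous
  obtain ⟨C₁, hC₁⟩ := (wirtinger φ).decay 0 0
  obtain ⟨C₂, hC₂⟩ := (wirtingerBar φ).decay 0 0
  have key := intervalIntegral.hasDerivAt_integral_of_dominated_loc_of_deriv_le (μ := volume)
    (a := 0) (b := 2 * Real.pi) (x₀ := x) (s := univ) (bound := fun _ => C₁ + C₂)
    (F := fun (x : ℝ) (θ : ℝ) => φ (x * exp (I * θ)) * exp (I * k * θ))
    (F' := fun (x : ℝ) (θ : ℝ) => wirtinger φ (x * exp (I * θ)) * exp (I * (k + 1 : ℤ) * θ)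
        + wirtingerBar φ (x * exp (I * θ)) * exp (I * (k - 1 : ℤ) * θ))
    univ_mem (Eventually.of_forall fun y => by
      apply Continuous.aestronglyMeasurable; fun_prop)
    (by apply Continuous.intervalIntegrable; fun_prop)
    (by apply Continuous.aestronglyMeasurable; fun_prop)
    (Eventually.of_forall fun θ _ y _ => by
      refine (norm_add_le _ _).trans ?_
      rw [norm_mul, norm_mul, norm_exp_I_mul_int_mul, norm_exp_I_mul_int_mul, mul_one, mul_one]
      refine add_le_add ?_ ?_
      · simpa using hC₁.2 (y * exp (I * θ))
      · simpa using hC₂.2 (y * exp (I * θ)))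
    (by simp)
    (Eventually.of_forall fun θ _ y _ => by
      have h1 : HasDerivAt (fun y : ℝ => (y : ℂ) * exp (I * θ)) (exp (I * θ)) y := by
        simpa using (Complex.ofRealCLM.hasDerivAt (x := y)).mul_const (exp (I * θ))
      have h2 := (φ.hasFDerivAt (y * exp (I * θ))).comp_hasDerivAt y h1
      rw [fderiv_eq_wirtinger] at h2
      refine (h2.mul_const (exp (I * k * θ))).congr_deriv ?_
      have e1 : (starRingEnd ℂ) (exp (I * θ)) = exp (-(I * θ)) := by
        rw [← exp_conj, map_mul, conj_I, conj_ofReal]; ring_nf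
      have e2 : exp (I * (k + 1 : ℤ) * θ) = exp (I * k * θ) * exp (I * θ) := by
        rw [← exp_add]; push_cast; ring_nf
      have e3 : exp (I * (k - 1 : ℤ) * θ) = exp (I * k * θ) * exp (-(I * θ)) := by
        rw [← exp_add]; push_cast; ring_nf
      rw [e1, e2, e3]
      ring)
  have h := key.2.const_mul 2
  refine h.congr_deriv ?_
  rw [intervalIntegral.integral_add]
  · simp only [polarCoeff]; ring
  all_goals apply Continuous.intervalIntegrable; fun_prop

theorem mellin_deriv_polarCoeff (k : ℤ) (φ : 𝓢(ℂ, ℂ)) {s : ℂ} (hs : 0 < s.re) :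
    mellin (polarCoeff (k + 1) (wirtinger φ)) (s + 1)
      + mellin (polarCoeff (k - 1) (wirtingerBar φ)) (s + 1) = -s * mellin (polarCoeff k φ) s := by
  have hs1 : 0 < (s + 1).re := by simp; linarith
  have c1 := mellinConvergent_polarCoeff (k + 1) (wirtinger φ) hs1
  have c2 := mellinConvergent_polarCoeff (k - 1) (wirtingerBar φ) hs1
  have c0 := mellinConvergent_polarCoeff k φ hs
  have hs0 : s ≠ 0 := fun h => by simp [h] at hs
  rw [← (hasMellin_add c1 c2).2]
  simp only [mellin, add_sub_cancel_right, smul_eq_mul]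
  have := integral_Ioi_mul_deriv_eq_deriv_mul (a := 0) (a' := 0) (b' := 0)
    (u := fun x : ℝ => (x : ℂ) ^ s) (u' := fun x : ℝ => s * (x : ℂ) ^ (s - 1))
    (v := polarCoeff k φ)
    (v' := fun x => polarCoeff (k + 1) (wirtinger φ) x + polarCoeff (k - 1) (wirtingerBar φ) x)
    (fun x hx => by
      simpa using ((hasDerivAt_id (x : ℂ)).cpow_const (c := s)
        (Or.inl (by simpa using hx))).comp_ofReal)
    (fun x _ => hasDerivAt_polarCoeff k φ x)
    (by simpa [MellinConvergent, Pi.mul_def] using (hasMellin_add c1 c2).1)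
    (by
      have := Integrable.const_mul c0 s
      simpa [IntegrableOn, Pi.mul_def, mul_assoc] using this)
    ?_ ?_
  · rw [this, ← integral_const_mul]
    simp [mul_assoc, ← integral_neg]
  · obtain ⟨C, hC0, hC⟩ := exists_norm_polarCoeff_le φ 0
    refine squeeze_zero_norm' (a := fun x : ℝ => C * x ^ s.re) ?_ ?_
    · filter_upwards [self_mem_nhdsWithin] with x hx
      have hx0 : 0 < x := hx
      rw [Pi.mul_apply, norm_mul, norm_cpow_eq_rpow_re_of_pos hx, mul_comm]
      gcongr
      simpa using hC k x
    · have : Tendsto (fun x : ℝ => C * x ^ s.re) (𝓝 0) (𝓝 (C * 0 ^ s.re)) :=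
        ((Real.continuousAt_rpow_const 0 s.re (Or.inr hs.le)).tendsto).const_mul C
      rw [Real.zero_rpow hs.ne', mul_zero] at this
      exact this.mono_left nhdsWithin_le_nhds
  · have h1 : (fun x : ℝ => (x : ℂ) ^ s) =O[atTop] fun x : ℝ => x ^ s.re := by
      refine Asymptotics.IsBigO.of_bound 1 ?_
      filter_upwards [eventually_gt_atTop 0] with x hx
      rw [norm_cpow_eq_rpow_re_of_pos hx, one_mul]
      exact le_abs_self _
    refine (h1.mul (polarCoeff_isBigO_atTop k φ (s.re + 1))).trans_tendsto ?_
    refine (tendsto_rpow_neg_atTop one_pos).congr' ?_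
    filter_upwards [eventually_gt_atTop 0] with x hx
    rw [← Real.rpow_add hx]; congr 1; ring

theorem mellin_angular_polarCoeff (k : ℤ) (φ : 𝓢(ℂ, ℂ)) {s : ℂ} (hs : 0 < s.re) :
    mellin (polarCoeff (k + 1) (wirtinger φ)) (s + 1)
      - mellin (polarCoeff (k - 1) (wirtingerBar φ)) (s + 1) = -k * mellin (polarCoeff k φ) s := by
  have hs1 : 0 < (s + 1).re := by simp; linarith
  have c1 := mellinConvergent_polarCoeff (k + 1) (wirtinger φ) hs1
  have c2 := mellinConvergent_polarCoeff (k - 1) (wirtingerBar φ) hs1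
  rw [← (hasMellin_sub c1 c2).2]
  simp only [mellin, add_sub_cancel_right, smul_eq_mul]
  rw [← integral_const_mul]
  refine setIntegral_congr_fun measurableSet_Ioi fun x hx => ?_
  have hx0 : (x : ℂ) ≠ 0 := ofReal_ne_zero.2 (ne_of_gt hx)
  have := polarCoeff_angular k φ x
  rw [mul_left_comm, ← this, ← mul_assoc, cpow_sub _ _ hx0, cpow_one, div_mul_cancel₀ _ hx0]

/-- The Wirtinger derivative raises `k` and `s` by one. This is half the sum of the integrations by
parts in the radius and in the angle; the antiholomorphic derivative is half their difference. -/
theorem mellin_wirtinger (k : ℤ) (φ : 𝓢(ℂ, ℂ)) {s : ℂ} (hs : 0 < s.re) :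
    mellin (polarCoeff (k + 1) (wirtinger φ)) (s + 1)
      = -(s + k) / 2 * mellin (polarCoeff k φ) s := by
  linear_combination (mellin_deriv_polarCoeff k φ hs) / 2 + (mellin_angular_polarCoeff k φ hs) / 2

theorem mellin_wirtingerBar (k : ℤ) (φ : 𝓢(ℂ, ℂ)) {s : ℂ} (hs : 0 < s.re) :
    mellin (polarCoeff (k - 1) (wirtingerBar φ)) (s + 1)
      = -(s - k) / 2 * mellin (polarCoeff k φ) s := by
  linear_combination (mellin_deriv_polarCoeff k φ hs) / 2 - (mellin_angular_polarCoeff k φ hs) / 2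

/-! ### Rapid decay in vertical strips -/

/-- A sequence `H k` of functions on `ℂ` decays rapidly if on every vertical strip, and for every
`N`, the product of `H k s` with `(1 + |k| + |Im s|)^N` is bounded, uniformly in `k` and `s`, once
`|Im s|` or `|k|` is large. The bounded part of the strip is left out for finitely many `k`, to make
room for poles. -/
def RapidDecay (H : ℤ → ℂ → ℂ) : Prop :=
  ∀ (a b : ℝ) (N : ℕ), ∃ K C : ℝ, ∀ (k : ℤ) (s : ℂ), a ≤ s.re → s.re ≤ b →
    (K ≤ |s.im| ∨ K ≤ |(k : ℝ)|) → ‖H k s‖ * (1 + |(k : ℝ)| + |s.im|) ^ N ≤ C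

/-- Growth of order at most polynomial on vertical strips, in the region used for `RapidDecay`. -/
def PolyGrowth (G : ℤ → ℂ → ℂ) : Prop :=
  ∀ a b : ℝ, ∃ (D : ℕ) (K C : ℝ), ∀ (k : ℤ) (s : ℂ), a ≤ s.re → s.re ≤ b →
    (K ≤ |s.im| ∨ K ≤ |(k : ℝ)|) → ‖G k s‖ ≤ C * (1 + |(k : ℝ)| + |s.im|) ^ D

theorem RapidDecay.zero : RapidDecay 0 := fun _ _ _ => ⟨0, 0, fun _ _ _ _ _ => by simp⟩

theorem RapidDecay.add {H H' : ℤ → ℂ → ℂ} (h : RapidDecay H) (h' : RapidDecay H') :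
    RapidDecay (fun k s => H k s + H' k s) := by
  intro a b N
  obtain ⟨K, C, hC⟩ := h a b N
  obtain ⟨K', C', hC'⟩ := h' a b N
  refine ⟨max K K', C + C', fun k s ha hb hK => ?_⟩
  have h1 := hC k s ha hb (hK.imp (le_trans (le_max_left _ _)) (le_trans (le_max_left _ _)))
  have h2 := hC' k s ha hb (hK.imp (le_trans (le_max_right _ _)) (le_trans (le_max_right _ _)))
  calc _ ≤ (‖H k s‖ + ‖H' k s‖) * (1 + |(k : ℝ)| + |s.im|) ^ N := by
        gcongr; exact norm_add_le _ _
    _ ≤ _ := by linarith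

theorem RapidDecay.mul {G H : ℤ → ℂ → ℂ} (hG : PolyGrowth G) (hH : RapidDecay H) :
    RapidDecay (fun k s => G k s * H k s) := by
  intro a b N
  obtain ⟨D, K, C, hC⟩ := hG a b
  obtain ⟨K', C', hC'⟩ := hH a b (D + N)
  refine ⟨max K K', |C| * C', fun k s ha hb hK => ?_⟩
  have h1 := hC k s ha hb (hK.imp (le_trans (le_max_left _ _)) (le_trans (le_max_left _ _)))
  have h2 := hC' k s ha hb (hK.imp (le_trans (le_max_right _ _)) (le_trans (le_max_right _ _)))
  rw [pow_add] at h2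
  rw [norm_mul]
  calc _ ≤ (|C| * (1 + |(k : ℝ)| + |s.im|) ^ D) * ‖H k s‖ * (1 + |(k : ℝ)| + |s.im|) ^ N := by
        gcongr
        exact h1.trans (by gcongr; exact le_abs_self C)
    _ = |C| * (‖H k s‖ * ((1 + |(k : ℝ)| + |s.im|) ^ D * (1 + |(k : ℝ)| + |s.im|) ^ N)) := by ring
    _ ≤ _ := by gcongr

theorem PolyGrowth.const (c : ℂ) : PolyGrowth fun _ _ => c :=
  fun _ _ => ⟨0, 0, ‖c‖, fun _ _ _ _ _ => by simp⟩

theorem PolyGrowth.mul {G G' : ℤ → ℂ → ℂ} (h : PolyGrowth G) (h' : PolyGrowth G') :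
    PolyGrowth (fun k s => G k s * G' k s) := by
  intro a b
  obtain ⟨D, K, C, hC⟩ := h a b
  obtain ⟨D', K', C', hC'⟩ := h' a b
  refine ⟨D + D', max K K', |C| * |C'|, fun k s ha hb hK => ?_⟩
  have h1 := hC k s ha hb (hK.imp (le_trans (le_max_left _ _)) (le_trans (le_max_left _ _)))
  have h2 := hC' k s ha hb (hK.imp (le_trans (le_max_right _ _)) (le_trans (le_max_right _ _)))
  have e1 : ‖G k s‖ ≤ |C| * (1 + |(k : ℝ)| + |s.im|) ^ D :=
    h1.trans (by gcongr; exact le_abs_self C)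
  have e2 : ‖G' k s‖ ≤ |C'| * (1 + |(k : ℝ)| + |s.im|) ^ D' :=
    h2.trans (by gcongr; exact le_abs_self C')
  rw [norm_mul, pow_add]
  calc _ ≤ _ := mul_le_mul e1 e2 (norm_nonneg _) (by positivity)
    _ = _ := by ring

theorem PolyGrowth.prod {ι : Type*} (S : Finset ι) {G : ι → ℤ → ℂ → ℂ}
    (h : ∀ i ∈ S, PolyGrowth (G i)) : PolyGrowth (fun k s => ∏ i ∈ S, G i k s) := by
  classical
  induction S using Finset.induction_on with
  | empty => simpa using PolyGrowth.const 1
  | insert i S hi ih =>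
    simp only [Finset.prod_insert hi]
    exact (h i (Finset.mem_insert_self i S)).mul
      (ih fun j hj => h j (Finset.mem_insert_of_mem hj))

theorem RapidDecay.const_mul {H : ℤ → ℂ → ℂ} (c : ℂ) (h : RapidDecay H) :
    RapidDecay (fun k s => c * H k s) := RapidDecay.mul (PolyGrowth.const c) h

/-- Peetre's inequality for the weight that measures decay in `k` and `Im s`. -/
theorem weight_shift_le (x t y u : ℝ) :
    1 + |x| + |t| ≤ (1 + |y| + |u|) * (1 + |x - y| + |t - u|) := by
  have h1 : |x| ≤ |x - y| + |y| := by simpa using abs_add_le (x - y) y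
  have h2 : |t| ≤ |t - u| + |u| := by simpa using abs_add_le (t - u) u
  have := abs_nonneg (x - y)
  have := abs_nonneg (t - u)
  have := abs_nonneg y
  have := abs_nonneg u
  nlinarith [mul_nonneg (add_nonneg (abs_nonneg y) (abs_nonneg u))
    (add_nonneg (abs_nonneg (x - y)) (abs_nonneg (t - u)))]

theorem RapidDecay.shift {H : ℤ → ℂ → ℂ} (h : RapidDecay H) (κ : ℤ) (c : ℂ) :
    RapidDecay (fun k s => H (k - κ) (s - c)) := by
  intro a b N
  obtain ⟨K, C, hC⟩ := h (a - c.re) (b - c.re) N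
  refine ⟨K + |c.im| + |(κ : ℝ)|, (1 + |(κ : ℝ)| + |c.im|) ^ N * C, fun k s ha hb hK => ?_⟩
  have h1 := hC (k - κ) (s - c) (by simp; linarith) (by simp; linarith) (by
    push_cast
    rw [sub_im]
    have := abs_sub_abs_le_abs_sub s.im c.im
    have := abs_sub_abs_le_abs_sub (k : ℝ) κ
    have := abs_nonneg c.im
    have := abs_nonneg (κ : ℝ)
    rcases hK with hK | hK
    · left; linarith
    · right; linarith)
  push_cast at h1
  rw [sub_im] at h1
  have hw := weight_shift_le k s.im κ c.im
  calc _ ≤ ‖H (k - κ) (s - c)‖ * ((1 + |(κ : ℝ)| + |c.im|)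
          * (1 + |(k : ℝ) - κ| + |s.im - c.im|)) ^ N := by gcongr
    _ = (1 + |(κ : ℝ)| + |c.im|) ^ N
          * (‖H (k - κ) (s - c)‖ * (1 + |(k : ℝ) - κ| + |s.im - c.im|) ^ N) := by
        rw [mul_pow]; ring
    _ ≤ _ := by gcongr

/-- Each `H k` is holomorphic off the half-line `(-∞, -|k|]`. -/
def HolomorphicOffHalfLine (H : ℤ → ℂ → ℂ) : Prop :=
  ∀ (k : ℤ) (s : ℂ), (s.im ≠ 0 ∨ 0 < |(k : ℝ)| + s.re) → DifferentiableAt ℂ (H k) s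

theorem isOpen_off_halfLine (k : ℤ) : IsOpen {s : ℂ | s.im ≠ 0 ∨ 0 < |(k : ℝ)| + s.re} :=
  (isOpen_ne_fun continuous_im continuous_const).union
    (isOpen_lt continuous_const (continuous_const.add continuous_re))

theorem HolomorphicOffHalfLine.deriv {H : ℤ → ℂ → ℂ} (h : HolomorphicOffHalfLine H) :
    HolomorphicOffHalfLine (fun k => deriv (H k)) := by
  intro k s hs
  have : DifferentiableOn ℂ (H k) {s : ℂ | s.im ≠ 0 ∨ 0 < |(k : ℝ)| + s.re} :=
    fun w hw => (h k w hw).differentiableWithinAt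
  exact (this.deriv (isOpen_off_halfLine k)).differentiableAt ((isOpen_off_halfLine k).mem_nhds hs)

/-- Rapid decay is inherited by derivatives, by Cauchy's estimate on discs of radius one. -/
theorem RapidDecay.deriv {H : ℤ → ℂ → ℂ} (hH : RapidDecay H) (hd : HolomorphicOffHalfLine H) :
    RapidDecay (fun k => deriv (H k)) := by
  intro a b N
  obtain ⟨K, C, hC⟩ := hH (a - 1) (b + 1) N
  refine ⟨|K| + |a| + 3, 2 ^ N * C, fun k s ha hb hK => ?_⟩
  have hball : ∀ w ∈ Metric.closedBall s 1, (a - 1 ≤ w.re ∧ w.re ≤ b + 1) ∧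
      (K ≤ |w.im| ∨ K ≤ |(k : ℝ)|) ∧ (w.im ≠ 0 ∨ 0 < |(k : ℝ)| + w.re) ∧
      |s.im| ≤ |w.im| + 1 := by
    intro w hw
    have hw' : ‖w - s‖ ≤ 1 := by simpa [dist_eq_norm] using hw
    have hre := (abs_le.1 ((abs_re_le_norm (w - s)).trans hw'))
    have him := ((abs_im_le_norm (w - s)).trans hw')
    rw [sub_re] at hre
    rw [sub_im] at him
    have h4 : |s.im| ≤ |w.im| + 1 := by
      have := abs_sub_abs_le_abs_sub s.im w.im
      rw [abs_sub_comm] at this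
      linarith
    have := le_abs_self K
    have := neg_abs_le a
    have := abs_nonneg a
    have := abs_nonneg K
    refine ⟨⟨by linarith, by linarith⟩, ?_, ?_, h4⟩
    · rcases hK with hK | hK
      · left; linarith
      · right; linarith
    · rcases hK with hK | hK
      · left
        rw [← abs_pos]
        linarith
      · right; linarith
  have hX : 0 < 1 + |(k : ℝ)| + |s.im| := by positivity
  have hdc : DiffContOnCl ℂ (H k) (Metric.ball s 1) := by
    apply DifferentiableOn.diffContOnCl
    intro w hw
    rw [closure_ball _ one_ne_zero] at hw
    exact (hd k w (hball w hw).2.2.1).differentiableWithinAt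
  have key := Complex.norm_deriv_le_of_forall_mem_sphere_norm_le one_pos hdc
    (C := 2 ^ N * C / (1 + |(k : ℝ)| + |s.im|) ^ N) (fun w hw => by
      obtain ⟨h1, h2, -, h4⟩ := hball w (Metric.sphere_subset_closedBall hw)
      have h5 := hC k w h1.1 h1.2 h2
      rw [le_div_iff₀ (by positivity)]
      calc _ ≤ ‖H k w‖ * (2 * (1 + |(k : ℝ)| + |w.im|)) ^ N := by
            gcongr
            have := abs_nonneg (k : ℝ)
            have := abs_nonneg w.im
            linarith
        _ = 2 ^ N * (‖H k w‖ * (1 + |(k : ℝ)| + |w.im|) ^ N) := by rw [mul_pow]; ring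
        _ ≤ _ := by gcongr)
  rw [div_one, le_div_iff₀ (by positivity)] at key
  exact key

/-! ### Meromorphic continuation of Mellin transforms of Schwartz functions -/

/-- `k + N` or `k - N`, whichever has absolute value `|k| + N`. -/
def signedShift (k : ℤ) (N : ℕ) : ℤ := if 0 ≤ k then k + N else k - N

/-- The `N`-th Wirtinger derivative that is paired with `signedShift k N`. -/
noncomputable def signedWirtinger (k : ℤ) (N : ℕ) (φ : 𝓢(ℂ, ℂ)) : 𝓢(ℂ, ℂ) :=
  if 0 ≤ k then wirtinger^[N] φ else wirtingerBar^[N] φ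

/-- One more integration by parts. The sign of `k` selects the Wirtinger derivative, so that the
factor that appears has its zero at `-|k| - 2N`. -/
theorem mellin_signedWirtinger_succ (k : ℤ) (φ : 𝓢(ℂ, ℂ)) (N : ℕ) {s : ℂ} (hs : 0 < s.re + N) :
    mellin (polarCoeff (signedShift k (N + 1)) (signedWirtinger k (N + 1) φ)) (s + (N + 1 : ℕ))
      = -(s + k.natAbs + 2 * N) / 2
        * mellin (polarCoeff (signedShift k N) (signedWirtinger k N φ)) (s + N) := by
  have hs' : 0 < (s + N).re := by simpa using hs
  have e : s + ((N + 1 : ℕ) : ℂ) = (s + N) + 1 := by push_cast; ring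
  rw [e]
  unfold signedShift signedWirtinger
  split_ifs with hk
  · have := mellin_wirtinger (k + N) (wirtinger^[N] φ) hs'
    rw [← Function.iterate_succ_apply' wirtinger] at this
    have e2 : (k + (N + 1 : ℕ) : ℤ) = k + N + 1 := by push_cast; ring
    have e3 : (k.natAbs : ℂ) = k := by
      have : ((k.natAbs : ℤ) : ℂ) = k := by rw [Int.natAbs_of_nonneg hk]
      simpa using this
    rw [e2, this, e3]; push_cast; ring
  · have := mellin_wirtingerBar (k - N) (wirtingerBar^[N] φ) hs'
    rw [← Function.iterate_succ_apply' wirtingerBar] at this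
    have e2 : (k - (N + 1 : ℕ) : ℤ) = k - N - 1 := by push_cast; ring
    have e3 : (k.natAbs : ℂ) = -k := by
      have : ((k.natAbs : ℤ) : ℂ) = ((-k : ℤ) : ℂ) := by
        congr 1; omega
      simpa using this
    rw [e2, this, e3]; push_cast; ring

/-- The continuation of the Mellin transform of the Fourier coefficient of `φ` to the half-plane
`-N < Re s`, by `N` integrations by parts. -/
noncomputable def mellinExtAux (N : ℕ) (k : ℤ) (φ : 𝓢(ℂ, ℂ)) (s : ℂ) : ℂ :=
  (-2) ^ N / (∏ i ∈ Finset.range N, (s + k.natAbs + 2 * i))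
    * mellin (polarCoeff (signedShift k N) (signedWirtinger k N φ)) (s + N)

/-- The meromorphic continuation to `ℂ` of the Mellin transform of `polarCoeff k φ`. At each point
`s` the number of integrations by parts is chosen large enough for the integral to converge; the
value does not depend on it (`mellinExt_eq`). -/
noncomputable def mellinExt (k : ℤ) (φ : 𝓢(ℂ, ℂ)) (s : ℂ) : ℂ :=
  mellinExtAux (⌈-s.re⌉₊ + 1) k φ s

/-- On the half-plane where both are given by convergent integrals, `N` and `N + 1` integrations by
parts agree: the additional denominator has no zero there. -/
theorem mellinExtAux_succ (N : ℕ) (k : ℤ) (φ : 𝓢(ℂ, ℂ)) {s : ℂ} (hs : 0 < s.re + N) :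
    mellinExtAux (N + 1) k φ s = mellinExtAux N k φ s := by
  have hne : s + k.natAbs + 2 * N ≠ 0 := by
    intro h
    have h' := congrArg re h
    have e : (s + k.natAbs + 2 * N : ℂ).re = s.re + k.natAbs + 2 * N := by simp
    rw [e, zero_re] at h'
    have : (0 : ℝ) ≤ k.natAbs := Nat.cast_nonneg _
    have : (0 : ℝ) ≤ N := Nat.cast_nonneg _
    linarith
  rw [mellinExtAux, mellinExtAux, mellin_signedWirtinger_succ k φ N hs, Finset.prod_range_succ,
    pow_succ]
  field_simp

theorem mellinExtAux_eq_of_le {M N : ℕ} (hMN : M ≤ N) (k : ℤ) (φ : 𝓢(ℂ, ℂ)) {s : ℂ}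
    (hs : 0 < s.re + M) : mellinExtAux N k φ s = mellinExtAux M k φ s := by
  induction N, hMN using Nat.le_induction with
  | base => rfl
  | succ N hN ih =>
    rw [mellinExtAux_succ N k φ, ih]
    have : (M : ℝ) ≤ N := Nat.cast_le.2 hN
    linarith

theorem mellinExt_eq {N : ℕ} (k : ℤ) (φ : 𝓢(ℂ, ℂ)) {s : ℂ} (hs : 0 < s.re + N) :
    mellinExt k φ s = mellinExtAux N k φ s := by
  have h : 0 < s.re + ((⌈-s.re⌉₊ + 1 : ℕ) : ℝ) := by
    have := Nat.le_ceil (-s.re)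
    push_cast
    linarith
  rcases le_total N (⌈-s.re⌉₊ + 1) with h1 | h1
  · exact mellinExtAux_eq_of_le h1 k φ hs
  · exact (mellinExtAux_eq_of_le h1 k φ h).symm

theorem mellinExt_eq_mellin (k : ℤ) (φ : 𝓢(ℂ, ℂ)) {s : ℂ} (hs : 0 < s.re) :
    mellinExt k φ s = mellin (polarCoeff k φ) s := by
  rw [mellinExt_eq (N := 0) k φ (by simpa using hs)]
  simp [mellinExtAux, signedShift, signedWirtinger]

theorem mellinExt_eventuallyEq (k : ℤ) (φ : 𝓢(ℂ, ℂ)) {N : ℕ} {s : ℂ} (hs : 0 < s.re + N) :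
    mellinExt k φ =ᶠ[𝓝 s] mellinExtAux N k φ := by
  have : IsOpen {w : ℂ | 0 < w.re + N} := isOpen_lt continuous_const (by fun_prop)
  filter_upwards [this.mem_nhds hs] with w hw
  exact mellinExt_eq k φ hw

theorem exists_re_add_nat_pos (s : ℂ) : ∃ N : ℕ, 0 < s.re + N := by
  obtain ⟨N, hN⟩ := exists_nat_gt (-s.re)
  exact ⟨N, by linarith⟩

theorem differentiableAt_mellin_shift (k : ℤ) (φ : 𝓢(ℂ, ℂ)) {N : ℕ} {s : ℂ} (hs : 0 < s.re + N) :
    DifferentiableAt ℂ (fun s => mellin (polarCoeff k φ) (s + N)) s :=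
  DifferentiableAt.comp s (g := mellin (polarCoeff k φ)) (f := fun s : ℂ => s + N)
    (differentiableAt_mellin_polarCoeff k φ (by simpa using hs)) (by fun_prop)

theorem meromorphic_mellinExt (k : ℤ) (φ : 𝓢(ℂ, ℂ)) : Meromorphic (mellinExt k φ) := by
  intro s
  obtain ⟨N, hN⟩ := exists_re_add_nat_pos s
  have hU : IsOpen {w : ℂ | 0 < w.re + N} := isOpen_lt continuous_const (by fun_prop)
  have han : AnalyticAt ℂ (fun s => mellin (polarCoeff (signedShift k N)
      (signedWirtinger k N φ)) (s + N)) s := by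
    refine DifferentiableOn.analyticAt (s := {w : ℂ | 0 < w.re + N}) (fun w hw => ?_)
      (hU.mem_nhds hN)
    exact (differentiableAt_mellin_shift _ _ hw).differentiableWithinAt
  have hp : AnalyticAt ℂ (fun s : ℂ => ∏ i ∈ Finset.range N, (s + k.natAbs + 2 * i)) s := by
    fun_prop
  have : MeromorphicAt (mellinExtAux N k φ) s :=
    ((MeromorphicAt.const ((-2) ^ N) s).div hp.meromorphicAt).mul han.meromorphicAt
  exact this.congr ((mellinExt_eventuallyEq k φ hN).symm.filter_mono nhdsWithin_le_nhds)

theorem holomorphicOffHalfLine_mellinExt (φ : 𝓢(ℂ, ℂ)) :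
    HolomorphicOffHalfLine fun k => mellinExt k φ := by
  intro k s hs
  obtain ⟨N, hN⟩ := exists_re_add_nat_pos s
  refine DifferentiableAt.congr_of_eventuallyEq ?_ (mellinExt_eventuallyEq k φ hN)
  refine DifferentiableAt.mul (DifferentiableAt.div (by fun_prop) (by fun_prop) ?_)
    (differentiableAt_mellin_shift _ _ hN)
  rw [Finset.prod_ne_zero_iff]
  intro i _ h
  have h1 := congrArg re h
  have h2 := congrArg im h
  have e1 : (s + k.natAbs + 2 * i : ℂ).re = s.re + k.natAbs + 2 * i := by simp
  have e2 : (s + k.natAbs + 2 * i : ℂ).im = s.im := by simp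
  rw [e1, zero_re] at h1
  rw [e2, zero_im] at h2
  rw [Nat.cast_natAbs, Int.cast_abs] at h1
  have : (0 : ℝ) ≤ i := Nat.cast_nonneg _
  rcases hs with hs | hs
  · exact hs h2
  · linarith

/-- Each integration by parts gains one power of `|k| + |Im s|`, from the denominators in
`mellinExtAux`. -/
theorem rapidDecay_mellinExt (φ : 𝓢(ℂ, ℂ)) : RapidDecay fun k => mellinExt k φ := by
  intro a b N
  set M : ℕ := max N (⌈-a⌉₊ + 1) with hM
  have haM : 0 < a + M := by
    have h1 := Nat.le_ceil (-a)
    have h2 : ((⌈-a⌉₊ + 1 : ℕ) : ℝ) ≤ M := Nat.cast_le.2 (le_max_right _ _)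
    push_cast at h2
    linarith
  obtain ⟨C₁, hC₁⟩ := exists_norm_mellin_polarCoeff_le (wirtinger^[M] φ) (b := b + M) haM
  obtain ⟨C₂, hC₂⟩ := exists_norm_mellin_polarCoeff_le (wirtingerBar^[M] φ) (b := b + M) haM
  refine ⟨2 * (|a| + |b|) + 1, 8 ^ M * max C₁ C₂, fun k s ha hb hK => ?_⟩
  set X : ℝ := 1 + |(k : ℝ)| + |s.im| with hX
  have hX1 : 1 ≤ X := by have := abs_nonneg (k : ℝ); have := abs_nonneg s.im; linarith
  have hsN : 0 < s.re + M := by linarith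
  have hmell : ‖mellin (polarCoeff (signedShift k M) (signedWirtinger k M φ)) (s + M)‖
      ≤ max C₁ C₂ := by
    unfold signedWirtinger
    split_ifs
    · exact (hC₁ _ _ (by simpa using ha) (by simpa using hb)).trans (le_max_left _ _)
    · exact (hC₂ _ _ (by simpa using ha) (by simpa using hb)).trans (le_max_right _ _)
  have hfac : ∀ i ∈ Finset.range M, X / 4 ≤ ‖s + k.natAbs + 2 * i‖ := by
    intro i _
    have h1 := abs_re_le_norm (s + k.natAbs + 2 * i)
    have h2 := abs_im_le_norm (s + k.natAbs + 2 * i)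
    have e1 : (s + k.natAbs + 2 * i : ℂ).re = s.re + |(k : ℝ)| + 2 * i := by
      simp [Nat.cast_natAbs]
    have e2 : (s + k.natAbs + 2 * i : ℂ).im = s.im := by simp
    rw [e1] at h1
    rw [e2] at h2
    have h3 := le_abs_self (s.re + |(k : ℝ)| + 2 * i)
    have h4 : (0 : ℝ) ≤ i := Nat.cast_nonneg _
    have := neg_abs_le a
    have := abs_nonneg b
    have := abs_nonneg a
    have := abs_nonneg (k : ℝ)
    have := abs_nonneg s.im
    rcases hK with hK | hK <;> linarith
  have hprod : (X / 4) ^ M ≤ ‖∏ i ∈ Finset.range M, (s + k.natAbs + 2 * i)‖ := by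
    rw [norm_prod]
    calc (X / 4) ^ M = ∏ _i ∈ Finset.range M, X / 4 := by rw [Finset.prod_const, Finset.card_range]
      _ ≤ _ := Finset.prod_le_prod (fun _ _ => by positivity) hfac
  have hmax : 0 ≤ max C₁ C₂ := (norm_nonneg _).trans hmell
  change ‖mellinExt k φ s‖ * X ^ N ≤ _
  rw [mellinExt_eq k φ hsN, mellinExtAux, norm_mul, norm_div, norm_pow, norm_neg,
    Complex.norm_ofNat]
  calc _ ≤ 2 ^ M / (X / 4) ^ M * max C₁ C₂ * X ^ M := by
        gcongr
        exact le_max_left _ _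
    _ = 8 ^ M * max C₁ C₂ := by
        have : X ≠ 0 := by positivity
        rw [div_pow, show (8 : ℝ) = 2 * 4 by norm_num, mul_pow]
        field_simp

/-! ### Logarithms and derivatives of Mellin transforms -/

theorem log_pow_polarCoeff_isBigO (j : ℕ) (k : ℤ) (φ : 𝓢(ℂ, ℂ)) :
    (∀ a : ℝ, (fun x : ℝ => (Real.log x : ℂ) ^ j * polarCoeff k φ x)
      =O[atTop] fun x : ℝ => x ^ (-a)) ∧
    (∀ b : ℝ, 0 < b → (fun x : ℝ => (Real.log x : ℂ) ^ j * polarCoeff k φ x)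
      =O[𝓝[>] 0] fun x : ℝ => x ^ (-b)) := by
  induction j with
  | zero =>
    refine ⟨fun a => by simpa using polarCoeff_isBigO_atTop k φ a, fun b hb => ?_⟩
    simp only [pow_zero, one_mul]
    refine (polarCoeff_isBigO_zero k φ).trans ?_
    refine Asymptotics.IsBigO.of_bound 1 ?_
    filter_upwards [Ioo_mem_nhdsGT one_pos] with x hx
    have : 1 ≤ x ^ (-b) := Real.one_le_rpow_of_pos_of_le_one_of_nonpos hx.1 hx.2.le (by linarith)
    simpa using this.trans (le_abs_self _)
  | succ j ih =>
    have e : (fun x : ℝ => (Real.log x : ℂ) ^ (j + 1) * polarCoeff k φ x)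
        = fun x : ℝ => Real.log x • ((Real.log x : ℂ) ^ j * polarCoeff k φ x) := by
      funext x
      rw [real_smul, pow_succ]; ring
    rw [e]
    exact ⟨fun a => isBigO_rpow_top_log_smul (show a < a + 1 by linarith) (ih.1 (a + 1)),
      fun b hb => isBigO_rpow_zero_log_smul (show b / 2 < b by linarith)
        (ih.2 (b / 2) (by linarith))⟩

theorem locallyIntegrableOn_log_pow_polarCoeff (j : ℕ) (k : ℤ) (φ : 𝓢(ℂ, ℂ)) :
    LocallyIntegrableOn (fun x : ℝ => (Real.log x : ℂ) ^ j * polarCoeff k φ x) (Ioi 0) := by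
  refine ContinuousOn.locallyIntegrableOn ?_ measurableSet_Ioi
  refine ContinuousOn.mul (ContinuousOn.pow ?_ _)
    (continuous_polarCoeff k φ.continuous).continuousOn
  exact continuous_ofReal.comp_continuousOn
    (Real.continuousOn_log.mono fun x hx => (ne_of_gt hx : x ≠ 0))

/-- Powers of the logarithm correspond to derivatives of the Mellin transform. -/
theorem hasMellin_log_pow_polarCoeff (j : ℕ) (k : ℤ) (φ : 𝓢(ℂ, ℂ)) {s : ℂ} (hs : 0 < s.re) :
    HasMellin (fun x : ℝ => (Real.log x : ℂ) ^ j * polarCoeff k φ x) s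
      (iteratedDeriv j (mellinExt k φ) s) := by
  induction j generalizing s with
  | zero =>
    simp only [pow_zero, one_mul, iteratedDeriv_zero]
    exact ⟨mellinConvergent_polarCoeff k φ hs, (mellinExt_eq_mellin k φ hs).symm⟩
  | succ j ih =>
    obtain ⟨h1, h2⟩ := log_pow_polarCoeff_isBigO j k φ
    obtain ⟨hc, hd⟩ := mellin_hasDerivAt_of_isBigO_rpow
      (locallyIntegrableOn_log_pow_polarCoeff j k φ) (h1 (s.re + 1)) (by linarith : s.re < s.re + 1)
      (h2 (s.re / 2) (by linarith)) (by linarith)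
    have e : (fun x : ℝ => (Real.log x : ℂ) ^ (j + 1) * polarCoeff k φ x)
        = fun x : ℝ => Real.log x • ((Real.log x : ℂ) ^ j * polarCoeff k φ x) := by
      funext x
      rw [real_smul, pow_succ]; ring
    rw [e]
    refine ⟨hc, ?_⟩
    rw [iteratedDeriv_succ, ← hd.deriv]
    apply EventuallyEq.deriv_eq
    have : IsOpen {w : ℂ | 0 < w.re} := isOpen_lt continuous_const continuous_re
    filter_upwards [this.mem_nhds hs] with w hw
    exact (ih hw).2

theorem holomorphicOffHalfLine_iteratedDeriv_mellinExt (j : ℕ) (φ : 𝓢(ℂ, ℂ)) :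
    HolomorphicOffHalfLine fun k => iteratedDeriv j (mellinExt k φ) := by
  induction j with
  | zero => simpa using holomorphicOffHalfLine_mellinExt φ
  | succ j ih => simpa only [iteratedDeriv_succ] using ih.deriv

theorem rapidDecay_iteratedDeriv_mellinExt (j : ℕ) (φ : 𝓢(ℂ, ℂ)) :
    RapidDecay fun k => iteratedDeriv j (mellinExt k φ) := by
  induction j with
  | zero => simpa using rapidDecay_mellinExt φ
  | succ j ih =>
    simpa only [iteratedDeriv_succ] using
      ih.deriv (holomorphicOffHalfLine_iteratedDeriv_mellinExt j φ)

/-! ### Inverse Mellin transforms of entire data -/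

/-- A sequence of entire functions that decays rapidly on whole vertical strips. -/
structure EntireDecay (R : ℤ → ℂ → ℂ) : Prop where
  entire : ∀ k, Differentiable ℂ (R k)
  bound : ∀ (a b : ℝ) (N : ℕ), ∃ C : ℝ, ∀ (k : ℤ) (s : ℂ), a ≤ s.re → s.re ≤ b →
    ‖R k s‖ * (1 + |(k : ℝ)| + |s.im|) ^ N ≤ C

/-- Entire data may be multiplied by polynomials in `k` and `s`. -/
theorem EntireDecay.affine_mul {R : ℤ → ℂ → ℂ} (hR : EntireDecay R) (A B D : ℂ) :
    EntireDecay (fun k s => (A * s + B * k + D) * R k s) := by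
  refine ⟨fun k => ((by fun_prop : Differentiable ℂ fun s : ℂ => A * s + B * k + D)).mul
    (hR.entire k), fun a b N => ?_⟩
  obtain ⟨C, hC⟩ := hR.bound a b (N + 1)
  set L : ℝ := ‖A‖ * (|a| + |b|) + ‖A‖ + ‖B‖ + ‖D‖
  refine ⟨L * C, fun k s ha hb => ?_⟩
  have h := hC k s ha hb
  set X : ℝ := 1 + |(k : ℝ)| + |s.im| with hX
  have hk := abs_nonneg (k : ℝ)
  have ht := abs_nonneg s.im
  have hs : ‖s‖ ≤ (|a| + |b| + 1) * X := by
    refine (norm_le_abs_re_add_abs_im s).trans ?_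
    have h1 : |s.re| ≤ |a| + |b| := by
      rw [abs_le]
      have := neg_abs_le a
      have := le_abs_self b
      have := abs_nonneg a
      have := abs_nonneg b
      constructor <;> linarith
    have := abs_nonneg a
    have := abs_nonneg b
    nlinarith [mul_nonneg (add_nonneg (abs_nonneg a) (abs_nonneg b)) (add_nonneg hk ht)]
  have hA : ‖A * s + B * k + D‖ ≤ L * X := by
    have hk' : ‖(k : ℂ)‖ = |(k : ℝ)| := by simp
    calc _ ≤ ‖A * s‖ + ‖B * k‖ + ‖D‖ := norm_add₃_le
      _ ≤ ‖A‖ * ((|a| + |b| + 1) * X) + ‖B‖ * X + ‖D‖ * X := by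
        rw [norm_mul, norm_mul, hk']
        gcongr
        · linarith
        · exact le_mul_of_one_le_right (norm_nonneg _) (by linarith)
      _ = _ := by ring
  have hL : 0 ≤ L := by positivity
  rw [norm_mul]
  calc _ ≤ L * X * ‖R k s‖ * X ^ N := by gcongr
    _ = L * (‖R k s‖ * X ^ (N + 1)) := by ring
    _ ≤ _ := by gcongr

/-- The character `[z]^(-k) |z|^(-s)` of `ℂˣ`, written as `z^(-k) (z z̄)^((k-s)/2)`. In this form
its Wirtinger derivatives can be read off. -/
noncomputable def polarChar (k : ℤ) (s z : ℂ) : ℂ :=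
  z ^ (-k) * (z * (starRingEnd ℂ) z) ^ (((k : ℂ) - s) / 2)

theorem mul_conj_cpow_half {z : ℂ} (hz : z ≠ 0) (c : ℂ) :
    (z * (starRingEnd ℂ) z) ^ (c / 2) = (‖z‖ : ℂ) ^ c := by
  have h0 : 0 < ‖z‖ := norm_pos_iff.2 hz
  have h1 : (‖z‖ : ℂ) ≠ 0 := ofReal_ne_zero.2 h0.ne'
  rw [mul_conj', cpow_def_of_ne_zero (pow_ne_zero 2 h1), cpow_def_of_ne_zero h1, ← ofReal_pow,
    ← ofReal_log (by positivity), ← ofReal_log h0.le, Real.log_pow]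
  congr 1
  push_cast
  ring

theorem norm_polarChar (k : ℤ) (s : ℂ) {z : ℂ} (hz : z ≠ 0) :
    ‖polarChar k s z‖ = ‖z‖ ^ (-s.re) := by
  have h0 : 0 < ‖z‖ := norm_pos_iff.2 hz
  rw [polarChar, mul_conj_cpow_half hz, norm_mul, norm_zpow, norm_cpow_eq_rpow_re_of_pos h0,
    ← Real.rpow_intCast, ← Real.rpow_add h0]
  congr 1
  simp only [Int.cast_neg, sub_re, intCast_re]
  ring

theorem polarChar_polar (k : ℤ) (s : ℂ) {x : ℝ} (hx : 0 < x) (θ : ℝ) :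
    polarChar k s (x * exp (I * θ)) = (x : ℂ) ^ (-s) * exp (-(I * k * θ)) := by
  have hx0 : (x : ℂ) ≠ 0 := ofReal_ne_zero.2 hx.ne'
  have hz : (x : ℂ) * exp (I * θ) ≠ 0 := mul_ne_zero hx0 (exp_ne_zero _)
  rw [polarChar, mul_conj_cpow_half hz, norm_ofReal_mul_exp, abs_of_pos hx, mul_zpow,
    ← exp_int_mul, cpow_sub _ _ hx0, cpow_neg, cpow_intCast, zpow_neg]
  have : (x : ℂ) ^ k ≠ 0 := zpow_ne_zero _ hx0
  rw [show ((-k : ℤ) : ℂ) * (I * θ) = -(I * k * θ) by push_cast; ring]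
  field_simp

theorem continuous_polarChar (k : ℤ) {z : ℂ} (hz : z ≠ 0) :
    Continuous fun s => polarChar k s z := by
  refine continuous_const.mul (Continuous.const_cpow (by fun_prop) (Or.inl ?_))
  exact mul_ne_zero hz ((map_ne_zero _).2 hz)

theorem differentiable_polarChar (k : ℤ) {z : ℂ} (hz : z ≠ 0) :
    Differentiable ℂ fun s => polarChar k s z := by
  intro s
  refine (differentiableAt_const _).mul (DifferentiableAt.const_cpow (by fun_prop) (Or.inl ?_))
  exact mul_ne_zero hz ((map_ne_zero _).2 hz)

/-- The real-linear map `v ↦ a v`, as a function of `a`. -/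
noncomputable def mulL : ℂ →L[ℝ] ℂ →L[ℝ] ℂ := ContinuousLinearMap.mul ℝ ℂ

/-- The real-linear map `v ↦ a v̄`, as a function of `a`. -/
noncomputable def mulConjL : ℂ →L[ℝ] ℂ →L[ℝ] ℂ :=
  ((ContinuousLinearMap.compL ℝ ℂ ℂ ℂ).flip (conjCLE : ℂ →L[ℝ] ℂ)).comp mulL

theorem mulL_apply (a v : ℂ) : mulL a v = a * v := rfl

theorem mulConjL_apply (a v : ℂ) : mulConjL a v = a * (starRingEnd ℂ) v := rfl

/-- The Wirtinger derivatives of the character for `(k, s)` are multiples of the characters for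
`(k ± 1, s + 1)`. -/
theorem hasFDerivAt_polarChar (k : ℤ) (s : ℂ) {z : ℂ} (hz : z ≠ 0) :
    HasFDerivAt (polarChar k s) (mulL (-(s + k) / 2 * polarChar (k + 1) (s + 1) z)
      + mulConjL (-(s - k) / 2 * polarChar (k - 1) (s + 1) z)) z := by
  have hz' : (starRingEnd ℂ) z ≠ 0 := (map_ne_zero _).2 hz
  have hzz : z * (starRingEnd ℂ) z ≠ 0 := mul_ne_zero hz hz'
  have h1 : HasFDerivAt (fun z : ℂ => z ^ (-k)) _ z :=
    ((hasDerivAt_zpow (-k) z (Or.inl hz)).hasFDerivAt).restrictScalars ℝ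
  have hc : HasFDerivAt (fun z : ℂ => (starRingEnd ℂ) z) (conjCLE : ℂ →L[ℝ] ℂ) z :=
    (conjCLE : ℂ →L[ℝ] ℂ).hasFDerivAt
  have h2 : HasFDerivAt (fun z : ℂ => z * (starRingEnd ℂ) z) _ z := (hasFDerivAt_id z).mul hc
  have hslit : z * (starRingEnd ℂ) z ∈ slitPlane := by
    rw [mul_conj', ← ofReal_pow]
    exact ofReal_mem_slitPlane.2 (by have := norm_pos_iff.2 hz; positivity)
  have h3 : HasDerivAt (fun w : ℂ => w ^ (((k : ℂ) - s) / 2)) _ (z * (starRingEnd ℂ) z) :=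
    (hasDerivAt_id _).cpow_const hslit
  have h4 := (h3.hasFDerivAt.restrictScalars ℝ).comp z h2
  refine (h1.mul h4).congr_fderiv ?_
  ext v
  simp only [polarChar, Function.comp_def, id, add_apply, smul_apply, smul_eq_mul,
    ContinuousLinearMap.comp_apply, ContinuousLinearMap.coe_restrictScalars', mulL_apply,
    mulConjL_apply, ContinuousLinearMap.toSpanSingleton_apply, ContinuousLinearMap.id_apply,
    ContinuousLinearEquiv.coe_coe, conjCLE_apply]
  have e1 : (((k + 1 : ℤ) : ℂ) - (s + 1)) / 2 = (k - s) / 2 := by push_cast; ring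
  have e2 : (((k - 1 : ℤ) : ℂ) - (s + 1)) / 2 = (k - s) / 2 - 1 := by push_cast; ring
  have e3 : z ^ (-(k + 1)) = z ^ (-k) * z⁻¹ := by rw [neg_add, zpow_add₀ hz, zpow_neg_one]
  have e4 : z ^ (-(k - 1)) = z ^ (-k) * z := by
    rw [neg_sub, sub_eq_neg_add, zpow_add₀ hz, zpow_one]
  rw [e1, e2, e3, e4, cpow_sub _ _ hzz, cpow_one, zpow_sub₀ hz, zpow_one]
  push_cast
  field_simp
  ring

/-- The measure on `ℤ × ℝ` over which characters of `ℂˣ` are integrated. -/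
noncomputable abbrev dualMeasure : Measure (ℤ × ℝ) := (Measure.count : Measure ℤ).prod volume

theorem integrable_weight :
    Integrable (fun p : ℤ × ℝ => ((1 + |(p.1 : ℝ)| + |p.2|) ^ 4)⁻¹) dualMeasure := by
  have h1 : Integrable (fun k : ℤ => ((1 + |(k : ℝ)|) ^ 2)⁻¹) Measure.count := by
    rw [integrable_count_iff]
    have h : Summable fun n : ℕ => ((1 + (n : ℝ)) ^ 2)⁻¹ := by
      have := (summable_nat_add_iff 1).2 (Real.summable_nat_pow_inv.2 one_lt_two)
      refine this.congr fun n => ?_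
      push_cast
      rw [add_comm]
    exact Summable.of_nat_of_neg (by simpa using h) (by simpa using h)
  have h2 : Integrable (fun t : ℝ => ((1 + |t|) ^ 2)⁻¹) := by
    have := integrable_one_add_norm (E := ℝ) (μ := volume) (r := 2) (by simp)
    refine this.congr (Eventually.of_forall fun t => ?_)
    have h : (0 : ℝ) ≤ 1 + |t| := by positivity
    simp only [Real.norm_eq_abs]
    rw [Real.rpow_neg h, Real.rpow_two]
  refine (h1.mul_prod h2).mono' (Continuous.aestronglyMeasurable ?_) (Eventually.of_forall ?_)
  · refine continuous_prod_of_discrete_left.2 fun k => ?_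
    refine Continuous.inv₀ (by fun_prop) fun t => ?_
    positivity
  · rintro ⟨k, t⟩
    simp only
    rw [Real.norm_of_nonneg (by positivity), ← mul_inv, ← mul_pow]
    have h3 : (1 + |(k : ℝ)|) * (1 + |t|) ≤ (1 + |(k : ℝ)| + |t|) ^ 2 := by
      nlinarith [abs_nonneg (k : ℝ), abs_nonneg t]
    gcongr
    calc ((1 + |(k : ℝ)|) * (1 + |t|)) ^ 2 ≤ ((1 + |(k : ℝ)| + |t|) ^ 2) ^ 2 := by gcongr
      _ = _ := by ring

/-- The integrand of the inverse Mellin transform on the line `Re s = σ`, with the character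
shifted by `(κ, c)`. -/
noncomputable def flatIntegrand (κ : ℤ) (c : ℝ) (R : ℤ → ℂ → ℂ) (σ : ℝ) (z : ℂ) (p : ℤ × ℝ) : ℂ :=
  R p.1 (σ + p.2 * I) * polarChar (p.1 + κ) (σ + p.2 * I + c) z

theorem EntireDecay.continuous_integrand {R : ℤ → ℂ → ℂ} (hR : EntireDecay R) (κ : ℤ) (c σ : ℝ)
    {z : ℂ} (hz : z ≠ 0) : Continuous (flatIntegrand κ c R σ z) := by
  refine continuous_prod_of_discrete_left.2 fun k => ?_
  have h1 := (hR.entire k).continuous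
  have h2 := continuous_polarChar (k + κ) hz
  exact (h1.comp (by fun_prop : Continuous fun t : ℝ => (σ + t * I : ℂ))).mul
    (h2.comp (by fun_prop : Continuous fun t : ℝ => (σ + t * I + c : ℂ)))

theorem EntireDecay.exists_norm_integrand_le {R : ℤ → ℂ → ℂ} (hR : EntireDecay R) (κ : ℤ)
    (c σ : ℝ) : ∃ C, ∀ (z : ℂ), z ≠ 0 → ∀ p : ℤ × ℝ, ‖flatIntegrand κ c R σ z p‖
      ≤ C * ((1 + |(p.1 : ℝ)| + |p.2|) ^ 4)⁻¹ * ‖z‖ ^ (-(σ + c)) := by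
  obtain ⟨C, hC⟩ := hR.bound σ σ 4
  refine ⟨C, fun z hz p => ?_⟩
  have h := hC p.1 (σ + p.2 * I) (by simp) (by simp)
  rw [flatIntegrand, norm_mul, norm_polarChar _ _ hz]
  have e : (σ + p.2 * I + c : ℂ).re = σ + c := by simp
  rw [e]
  gcongr
  rw [← div_eq_mul_inv, le_div_iff₀ (by positivity)]
  simpa using h

theorem EntireDecay.integrable_integrand {R : ℤ → ℂ → ℂ} (hR : EntireDecay R) (κ : ℤ) (c σ : ℝ)
    {z : ℂ} (hz : z ≠ 0) : Integrable (flatIntegrand κ c R σ z) dualMeasure := by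
  obtain ⟨C, hC⟩ := hR.exists_norm_integrand_le κ c σ
  exact ((integrable_weight.const_mul C).mul_const _).mono'
    (hR.continuous_integrand κ c σ hz).aestronglyMeasurable (Eventually.of_forall (hC z hz))

theorem hasDerivAt_vertical (σ t : ℝ) : HasDerivAt (fun t : ℝ => (σ + t * I : ℂ)) I t := by
  simpa using ((Complex.ofRealCLM.hasDerivAt (x := t)).mul_const I).const_add (σ : ℂ)

theorem hasDerivAt_horizontal (σ t : ℝ) : HasDerivAt (fun σ : ℝ => (σ + t * I : ℂ)) 1 σ := by
  simpa using (Complex.ofRealCLM.hasDerivAt (x := σ)).add_const (t * I : ℂ)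

/-- The integral over a vertical line of an entire function that decays on vertical strips does not
depend on the line: its derivative in the abscissa is the integral of a total derivative. -/
theorem integral_vertical_eq {f : ℂ → ℂ} (hf : Differentiable ℂ f)
    (hb : ∀ a b : ℝ, ∃ C, ∀ s : ℂ, a ≤ s.re → s.re ≤ b → ‖f s‖ * (1 + |s.im|) ^ 2 ≤ C)
    (σ σ' : ℝ) : ∫ t : ℝ, f (σ + t * I) = ∫ t : ℝ, f (σ' + t * I) := by
  have hw : Integrable (fun t : ℝ => ((1 + |t|) ^ 2)⁻¹) := by
    have := integrable_one_add_norm (E := ℝ) (μ := volume) (r := 2) (by simp)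
    refine this.congr (Eventually.of_forall fun t => ?_)
    have h : (0 : ℝ) ≤ 1 + |t| := by positivity
    simp only [Real.norm_eq_abs]
    rw [Real.rpow_neg h, Real.rpow_two]
  have hf' : Continuous (deriv f) := hf.deriv.continuous
  have key : ∀ σ : ℝ, HasDerivAt (fun σ : ℝ => ∫ t : ℝ, f (σ + t * I)) 0 σ := by
    intro σ
    obtain ⟨C, hC⟩ := hb (σ - 2) (σ + 2)
    have hC' : ∀ s : ℂ, σ - 2 ≤ s.re → s.re ≤ σ + 2 → ‖f s‖ ≤ C * ((1 + |s.im|) ^ 2)⁻¹ := by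
      intro s h1 h2
      rw [← div_eq_mul_inv, le_div_iff₀ (by positivity)]
      exact hC s h1 h2
    have hC0 : 0 ≤ C := (by positivity : (0 : ℝ) ≤ ‖f σ‖ * (1 + |(σ : ℂ).im|) ^ 2).trans
      (hC σ (by simp) (by simp))
    have hd : ∀ s : ℂ, σ - 1 ≤ s.re → s.re ≤ σ + 1 →
        ‖deriv f s‖ ≤ 4 * C * ((1 + |s.im|) ^ 2)⁻¹ := by
      intro s h1 h2
      have := Complex.norm_deriv_le_of_forall_mem_sphere_norm_le one_pos
        (hf.diffContOnCl (s := Metric.ball s 1)) (C := 4 * C * ((1 + |s.im|) ^ 2)⁻¹)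
        (fun w hw => by
          have hw' : ‖w - s‖ ≤ 1 := by
            have := mem_sphere_iff_norm.1 hw
            linarith
          have hre := abs_le.1 ((abs_re_le_norm (w - s)).trans hw')
          have him := (abs_im_le_norm (w - s)).trans hw'
          rw [sub_re] at hre
          rw [sub_im] at him
          have h4 : 1 + |s.im| ≤ 2 * (1 + |w.im|) := by
            have := abs_sub_abs_le_abs_sub s.im w.im
            rw [abs_sub_comm] at this
            have := abs_nonneg w.im
            linarith
          refine (hC' w (by linarith) (by linarith)).trans ?_
          rw [← div_eq_mul_inv, ← div_eq_mul_inv, div_le_div_iff₀ (by positivity) (by positivity)]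
          calc C * (1 + |s.im|) ^ 2 ≤ C * (2 * (1 + |w.im|)) ^ 2 := by gcongr
            _ = _ := by ring)
      simpa using this
    have h := hasDerivAt_integral_of_dominated_loc_of_deriv_le (μ := volume) (x₀ := σ)
      (s := Metric.closedBall σ 1) (F := fun (σ : ℝ) (t : ℝ) => f (σ + t * I))
      (F' := fun (σ : ℝ) (t : ℝ) => deriv f (σ + t * I))
      (bound := fun t => 4 * C * ((1 + |t|) ^ 2)⁻¹) (Metric.closedBall_mem_nhds σ one_pos)
      (Eventually.of_forall fun y => Continuous.aestronglyMeasurable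
        (hf.continuous.comp (by fun_prop)))
      ((hw.const_mul C).mono' (Continuous.aestronglyMeasurable (hf.continuous.comp (by fun_prop)))
        (Eventually.of_forall fun t => by
          simpa using hC' (σ + t * I) (by simp) (by simp)))
      (Continuous.aestronglyMeasurable (hf'.comp (by fun_prop)))
      (Eventually.of_forall fun t y hy => by
        rw [Metric.mem_closedBall, Real.dist_eq, abs_le] at hy
        simpa using hd (y + t * I) (by simp; linarith) (by simp; linarith))
      (hw.const_mul _)
      (Eventually.of_forall fun t y _ => by
        exact ((hf (y + t * I)).hasDerivAt.comp y (hasDerivAt_horizontal y t)).congr_deriv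
          (by simp))
    refine h.2.congr_deriv ?_
    have hlim : ∀ l : Filter ℝ, Tendsto (fun t : ℝ => |t|) l atTop →
        Tendsto (fun t : ℝ => f (σ + t * I)) l (𝓝 0) := by
      intro l hl
      refine squeeze_zero_norm (a := fun t : ℝ => C * ((1 + |t|) ^ 2)⁻¹) (fun t => by
        simpa using hC' (σ + t * I) (by simp) (by simp)) ?_
      have h1 : Tendsto (fun t : ℝ => (1 + |t|) ^ 2) l atTop :=
        (tendsto_pow_atTop two_ne_zero).comp (tendsto_const_nhds.add_atTop hl)
      simpa using h1.inv_tendsto_atTop.const_mul C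
    have := integral_of_hasDerivAt_of_tendsto (f := fun t : ℝ => f (σ + t * I))
      (f' := fun t : ℝ => deriv f (σ + t * I) * I) (m := 0) (n := 0)
      (fun t => (hf (σ + t * I)).hasDerivAt.comp t (hasDerivAt_vertical σ t))
      (h.1.mul_const I) (hlim _ tendsto_abs_atBot_atTop) (hlim _ tendsto_abs_atTop_atTop)
    rw [integral_mul_const, sub_zero] at this
    exact (mul_eq_zero.1 this).resolve_right I_ne_zero
  exact is_const_of_deriv_eq_zero (fun σ => (key σ).differentiableAt) (fun σ => (key σ).deriv) σ σ'

/-- The inverse Mellin transform does not depend on the line of integration. -/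
theorem EntireDecay.integral_integrand_eq {R : ℤ → ℂ → ℂ} (hR : EntireDecay R) (κ : ℤ) (c : ℝ)
    (σ σ' : ℝ) {z : ℂ} (hz : z ≠ 0) :
    ∫ p, flatIntegrand κ c R σ z p ∂dualMeasure = ∫ p, flatIntegrand κ c R σ' z p ∂dualMeasure := by
  rw [integral_prod _ (hR.integrable_integrand κ c σ hz),
    integral_prod _ (hR.integrable_integrand κ c σ' hz)]
  congr 1
  funext k
  refine integral_vertical_eq (f := fun s => R k s * polarChar (k + κ) (s + c) z) ?_ ?_ σ σ'
  · refine (hR.entire k).mul ?_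
    exact (differentiable_polarChar (k + κ) hz).comp
      (by fun_prop : Differentiable ℂ fun s : ℂ => s + c)
  · intro a b
    obtain ⟨C, hC⟩ := hR.bound a b 2
    have hz0 : 0 < ‖z‖ := norm_pos_iff.2 hz
    obtain ⟨M, hM⟩ := (isCompact_Icc (a := a) (b := b)).bddAbove_image
      (f := fun x : ℝ => ‖z‖ ^ (-(x + c)))
      (Continuous.continuousOn (by
        refine Continuous.rpow continuous_const (by fun_prop) fun x => Or.inl hz0.ne'))
    refine ⟨C * M, fun s h1 h2 => ?_⟩
    have h3 := hC k s h1 h2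
    have h4 := hM (mem_image_of_mem _ (show s.re ∈ Icc a b from ⟨h1, h2⟩))
    have e : (s + c : ℂ).re = s.re + c := by simp
    rw [norm_mul, norm_polarChar _ _ hz, e]
    have hC0 : 0 ≤ C := (by positivity : (0 : ℝ) ≤ ‖R k s‖ * (1 + |(k : ℝ)| + |s.im|) ^ 2).trans h3
    calc _ = (‖R k s‖ * (1 + |s.im|) ^ 2) * ‖z‖ ^ (-(s.re + c)) := by ring
      _ ≤ (‖R k s‖ * (1 + |(k : ℝ)| + |s.im|) ^ 2) * ‖z‖ ^ (-(s.re + c)) := by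
        gcongr
        have := abs_nonneg (k : ℝ)
        linarith
      _ ≤ C * M := mul_le_mul h3 h4 (by positivity) hC0

/-- The inverse Mellin transform of entire data, with the characters shifted by `(κ, c)`, extended
by zero to the origin. -/
noncomputable def flatFun (κ : ℤ) (c : ℝ) (R : ℤ → ℂ → ℂ) (z : ℂ) : ℂ :=
  if z = 0 then 0 else ∫ p, flatIntegrand κ c R 0 z p ∂dualMeasure

theorem flatFun_zero (κ : ℤ) (c : ℝ) (R : ℤ → ℂ → ℂ) : flatFun κ c R 0 = 0 := if_pos rfl

/-- The data of the holomorphic Wirtinger derivative of `flatFun κ c R`. -/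
noncomputable def dzData (κ : ℤ) (c : ℝ) (R : ℤ → ℂ → ℂ) (k : ℤ) (s : ℂ) : ℂ :=
  (-(1 / 2) * s + -(1 / 2) * k + -(c + κ) / 2) * R k s

/-- The data of the antiholomorphic Wirtinger derivative of `flatFun κ c R`. -/
noncomputable def dzbarData (κ : ℤ) (c : ℝ) (R : ℤ → ℂ → ℂ) (k : ℤ) (s : ℂ) : ℂ :=
  (-(1 / 2) * s + 1 / 2 * k + -(c - κ) / 2) * R k s

namespace EntireDecay

variable {R : ℤ → ℂ → ℂ}

theorem dzData (hR : EntireDecay R) (κ : ℤ) (c : ℝ) : EntireDecay (dzData κ c R) :=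
  hR.affine_mul _ _ _

theorem dzbarData (hR : EntireDecay R) (κ : ℤ) (c : ℝ) : EntireDecay (dzbarData κ c R) :=
  hR.affine_mul _ _ _

theorem flatFun_eq (hR : EntireDecay R) (κ : ℤ) (c σ : ℝ) {z : ℂ} (hz : z ≠ 0) :
    flatFun κ c R z = ∫ p, flatIntegrand κ c R σ z p ∂dualMeasure := by
  rw [flatFun, if_neg hz, hR.integral_integrand_eq κ c 0 σ hz]

/-- The inverse Mellin transform of entire data is bounded by any power of `|z|`: integrate over the
vertical line whose abscissa gives that power. -/
theorem exists_norm_flatFun_le (hR : EntireDecay R) (κ : ℤ) (c : ℝ) (r : ℝ) :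
    ∃ C, 0 ≤ C ∧ ∀ z : ℂ, z ≠ 0 → ‖flatFun κ c R z‖ ≤ C * ‖z‖ ^ r := by
  obtain ⟨C, hC⟩ := hR.exists_norm_integrand_le κ c (-r - c)
  have hbound : ∀ z : ℂ, z ≠ 0 → ‖flatFun κ c R z‖
      ≤ (∫ p : ℤ × ℝ, C * ((1 + |(p.1 : ℝ)| + |p.2|) ^ 4)⁻¹ ∂dualMeasure) * ‖z‖ ^ r := by
    intro z hz
    rw [hR.flatFun_eq κ c (-r - c) hz, ← integral_mul_const]
    refine norm_integral_le_of_norm_le ((integrable_weight.const_mul C).mul_const _)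
      (Eventually.of_forall fun p => ?_)
    have := hC z hz p
    rwa [show -(-r - c + c) = r by ring] at this
  refine ⟨_, ?_, hbound⟩
  simpa using (norm_nonneg _).trans (hbound 1 one_ne_zero)

/-- Differentiation under the integral sign: the derivatives of inverse Mellin transforms are again
inverse Mellin transforms, for other data and shifted characters. -/
theorem hasFDerivAt_flatFun_of_ne_zero (hR : EntireDecay R) (κ : ℤ) (c : ℝ) {z : ℂ} (hz : z ≠ 0) :
    HasFDerivAt (flatFun κ c R)
      (mulL (flatFun (κ + 1) (c + 1) (SimpleSingularity.dzData κ c R) z)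
        + mulConjL (flatFun (κ - 1) (c + 1) (SimpleSingularity.dzbarData κ c R) z)) z := by
  have hR₁ := hR.dzData κ c
  have hR₂ := hR.dzbarData κ c
  -- on this line the characters that occur in the derivative have absolute value one
  set σ : ℝ := -(c + 1) with hσ
  obtain ⟨C₁, hC₁⟩ := hR₁.exists_norm_integrand_le (κ + 1) (c + 1) σ
  obtain ⟨C₂, hC₂⟩ := hR₂.exists_norm_integrand_le (κ - 1) (c + 1) σ
  have hne : ∀ᶠ w : ℂ in 𝓝 z, w ≠ 0 := isOpen_ne.mem_nhds hz
  have i1 := hR₁.integrable_integrand (κ + 1) (c + 1) σ hz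
  have i2 := hR₂.integrable_integrand (κ - 1) (c + 1) σ hz
  have key := hasFDerivAt_integral_of_dominated_of_fderiv_le (𝕜 := ℝ) (μ := dualMeasure) (x₀ := z)
    (s := {w : ℂ | w ≠ 0}) (F := flatIntegrand κ c R σ)
    (F' := fun w p =>
      mulL (flatIntegrand (κ + 1) (c + 1) (SimpleSingularity.dzData κ c R) σ w p)
      + mulConjL (flatIntegrand (κ - 1) (c + 1) (SimpleSingularity.dzbarData κ c R) σ w p))
    (bound := fun p => ‖mulL‖ * (C₁ * ((1 + |(p.1 : ℝ)| + |p.2|) ^ 4)⁻¹)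
      + ‖mulConjL‖ * (C₂ * ((1 + |(p.1 : ℝ)| + |p.2|) ^ 4)⁻¹)) hne
    (hne.mono fun w hw => (hR.continuous_integrand κ c σ hw).aestronglyMeasurable)
    (hR.integrable_integrand κ c σ hz)
    ((mulL.continuous.comp (hR₁.continuous_integrand (κ + 1) (c + 1) σ hz)).add
      (mulConjL.continuous.comp
        (hR₂.continuous_integrand (κ - 1) (c + 1) σ hz))).aestronglyMeasurable
    (Eventually.of_forall fun p w hw => by
      have b1 := hC₁ w hw p
      have b2 := hC₂ w hw p
      rw [show -(σ + (c + 1)) = 0 by rw [hσ]; ring, Real.rpow_zero, mul_one] at b1 b2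
      refine (norm_add_le _ _).trans (add_le_add ?_ ?_)
      · exact (mulL.le_opNorm _).trans (by gcongr)
      · exact (mulConjL.le_opNorm _).trans (by gcongr))
    (((integrable_weight.const_mul C₁).const_mul _).add
      ((integrable_weight.const_mul C₂).const_mul _))
    (Eventually.of_forall fun p w hw => by
      have h := (hasFDerivAt_polarChar (p.1 + κ) (σ + p.2 * I + c) hw).const_mul
        (R p.1 (σ + p.2 * I))
      refine h.congr_fderiv ?_
      ext v
      simp only [flatIntegrand, SimpleSingularity.dzData, SimpleSingularity.dzbarData, smul_apply,
        add_apply, mulL_apply, mulConjL_apply, smul_eq_mul]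
      have e1 : p.1 + (κ + 1) = p.1 + κ + 1 := by ring
      have e2 : p.1 + (κ - 1) = p.1 + κ - 1 := by ring
      have e3 : (σ + p.2 * I + ((c + 1 : ℝ) : ℂ) : ℂ) = σ + p.2 * I + c + 1 := by push_cast; ring
      rw [e1, e2, e3]
      push_cast
      ring)
  have heq : flatFun κ c R =ᶠ[𝓝 z] fun w => ∫ p, flatIntegrand κ c R σ w p ∂dualMeasure :=
    hne.mono fun w hw => hR.flatFun_eq κ c σ hw
  refine (key.congr_of_eventuallyEq heq).congr_fderiv ?_
  rw [integral_add (mulL.integrable_comp i1) (mulConjL.integrable_comp i2),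
    ContinuousLinearMap.integral_comp_comm _ i1, ContinuousLinearMap.integral_comp_comm _ i2,
    hR₁.flatFun_eq _ _ σ hz, hR₂.flatFun_eq _ _ σ hz]

/-- The formula for the derivative holds at the origin too, where both sides vanish because the
functions are `O(|z|²)`. Smoothness and decay then follow by induction. -/
theorem hasFDerivAt_flatFun (hR : EntireDecay R) (κ : ℤ) (c : ℝ) (z : ℂ) :
    HasFDerivAt (flatFun κ c R)
      (mulL (flatFun (κ + 1) (c + 1) (SimpleSingularity.dzData κ c R) z)
        + mulConjL (flatFun (κ - 1) (c + 1) (SimpleSingularity.dzbarData κ c R) z)) z := by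
  rcases eq_or_ne z 0 with rfl | hz
  · rw [flatFun_zero, flatFun_zero, map_zero, map_zero, add_zero]
    obtain ⟨C, hC0, hC⟩ := hR.exists_norm_flatFun_le κ c 2
    refine Asymptotics.IsBigO.hasFDerivAt (n := 2) ?_ one_lt_two
    refine Asymptotics.IsBigO.of_bound C (Eventually.of_forall fun w => ?_)
    rcases eq_or_ne w 0 with rfl | hw
    · simp [flatFun_zero]
    · simpa using hC w hw
  · exact hR.hasFDerivAt_flatFun_of_ne_zero κ c hz

theorem fderiv_flatFun (hR : EntireDecay R) (κ : ℤ) (c : ℝ) :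
    fderiv ℝ (flatFun κ c R) = fun z =>
      mulL (flatFun (κ + 1) (c + 1) (SimpleSingularity.dzData κ c R) z)
        + mulConjL (flatFun (κ - 1) (c + 1) (SimpleSingularity.dzbarData κ c R) z) :=
  funext fun z => (hR.hasFDerivAt_flatFun κ c z).fderiv

theorem contDiff_flatFun (n : ℕ) (hR : EntireDecay R) (κ : ℤ) (c : ℝ) :
    ContDiff ℝ n (flatFun κ c R) := by
  induction n generalizing R κ c with
  | zero =>
    exact contDiff_zero.2 (continuous_iff_continuousAt.2 fun z =>
      (hR.hasFDerivAt_flatFun κ c z).continuousAt)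
  | succ n ih =>
    push_cast
    refine contDiff_succ_iff_hasFDerivAt.2 ⟨_, ?_, hR.hasFDerivAt_flatFun κ c⟩
    exact (mulL.contDiff.comp (ih (hR.dzData κ c) _ _)).add
      (mulConjL.contDiff.comp (ih (hR.dzbarData κ c) _ _))

theorem flatFun_decay (M n : ℕ) (hR : EntireDecay R) (κ : ℤ) (c : ℝ) :
    ∃ C, ∀ z : ℂ, ‖z‖ ^ M * ‖iteratedFDeriv ℝ n (flatFun κ c R) z‖ ≤ C := by
  induction n generalizing R κ c with
  | zero =>
    obtain ⟨C, hC0, hC⟩ := hR.exists_norm_flatFun_le κ c (-M)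
    refine ⟨C, fun z => ?_⟩
    rw [norm_iteratedFDeriv_zero]
    rcases eq_or_ne z 0 with rfl | hz
    · simpa [flatFun_zero] using hC0
    · have h := hC z hz
      have hz0 : 0 < ‖z‖ := norm_pos_iff.2 hz
      rw [Real.rpow_neg hz0.le, Real.rpow_natCast, ← div_eq_mul_inv,
        le_div_iff₀ (by positivity)] at h
      linarith
  | succ n ih =>
    obtain ⟨C₁, hC₁⟩ := ih (hR.dzData κ c) (κ + 1) (c + 1)
    obtain ⟨C₂, hC₂⟩ := ih (hR.dzbarData κ c) (κ - 1) (c + 1)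
    refine ⟨‖mulL‖ * C₁ + ‖mulConjL‖ * C₂, fun z => ?_⟩
    have c1 := (hR.dzData κ c).contDiff_flatFun n (κ + 1) (c + 1)
    have c2 := (hR.dzbarData κ c).contDiff_flatFun n (κ - 1) (c + 1)
    have d1 : ContDiffAt ℝ n (fun z => mulL (flatFun (κ + 1) (c + 1)
        (SimpleSingularity.dzData κ c R) z)) z := (mulL.contDiff.comp c1).contDiffAt
    have d2 : ContDiffAt ℝ n (fun z => mulConjL (flatFun (κ - 1) (c + 1)
        (SimpleSingularity.dzbarData κ c R) z)) z := (mulConjL.contDiff.comp c2).contDiffAt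
    rw [← norm_iteratedFDeriv_fderiv, hR.fderiv_flatFun κ c]
    have e := iteratedFDeriv_add_apply d1 d2
    have n1 := mulL.norm_iteratedFDeriv_comp_left (f := flatFun (κ + 1) (c + 1)
        (SimpleSingularity.dzData κ c R)) (x := z) (n := n) c1.contDiffAt le_rfl
    have n2 := mulConjL.norm_iteratedFDeriv_comp_left (f := flatFun (κ - 1) (c + 1)
        (SimpleSingularity.dzbarData κ c R)) (x := z) (n := n) c2.contDiffAt le_rfl
    calc _ ≤ ‖z‖ ^ M * (‖mulL‖ * ‖iteratedFDeriv ℝ n (flatFun (κ + 1) (c + 1)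
            (SimpleSingularity.dzData κ c R)) z‖ + ‖mulConjL‖ * ‖iteratedFDeriv ℝ n
            (flatFun (κ - 1) (c + 1) (SimpleSingularity.dzbarData κ c R)) z‖) := by
          gcongr
          refine (le_of_eq (congrArg norm e)).trans ((norm_add_le _ _).trans (add_le_add n1 n2))
      _ = ‖mulL‖ * (‖z‖ ^ M * ‖iteratedFDeriv ℝ n (flatFun (κ + 1) (c + 1)
            (SimpleSingularity.dzData κ c R)) z‖) + ‖mulConjL‖ * (‖z‖ ^ M * ‖iteratedFDeriv ℝ n
            (flatFun (κ - 1) (c + 1) (SimpleSingularity.dzbarData κ c R)) z‖) := by ring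
      _ ≤ _ := by gcongr <;> [exact hC₁ z; exact hC₂ z]

/-- The inverse Mellin transform of entire data, as a Schwartz function that is flat at zero. -/
noncomputable def toSchwartz (hR : EntireDecay R) : 𝓢(ℂ, ℂ) where
  toFun := flatFun 0 0 R
  smooth' := contDiff_infty.2 fun n => hR.contDiff_flatFun n 0 0
  decay' := fun M n => hR.flatFun_decay M n 0 0

theorem integral_exp_int (n : ℤ) :
    ∫ θ in (0 : ℝ)..(2 * Real.pi), exp (I * n * θ)
      = (if n = 0 then 2 * Real.pi else 0 : ℂ) := by
  split_ifs with hn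
  · simp [hn]
  · have hne : I * (n : ℂ) ≠ 0 := mul_ne_zero I_ne_zero (Int.cast_ne_zero.2 hn)
    rw [integral_exp_mul_complex hne]
    have : exp (I * n * (2 * Real.pi : ℝ)) = 1 := by
      rw [show I * n * ((2 * Real.pi : ℝ) : ℂ) = n * (2 * Real.pi * I) by push_cast; ring,
        exp_int_mul_two_pi_mul_I]
    rw [this]
    simp

/-- The orthogonality of the characters `e^(ikθ)` leaves the term of index `k` only. The constant is
`4π`, from the normalisation of `polarCoeff`, times the `2π` by which `mellinInv` is divided. -/
theorem polarCoeff_flatFun (hR : EntireDecay R) (k : ℤ) (σ : ℝ) {x : ℝ} (hx : 0 < x) :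
    polarCoeff k (flatFun 0 0 R) x = 8 * Real.pi ^ 2 * mellinInv σ (R k) x := by
  have hx0 : (x : ℂ) ≠ 0 := ofReal_ne_zero.2 hx.ne'
  obtain ⟨C, hC⟩ := hR.exists_norm_integrand_le 0 0 σ
  set G : ℤ × ℝ → ℂ := fun p => R p.1 (σ + p.2 * I) * (x : ℂ) ^ (-(σ + p.2 * I)) with hG
  have hval : ∀ (θ : ℝ) (p : ℤ × ℝ), flatIntegrand 0 0 R σ (x * exp (I * θ)) p * exp (I * k * θ)
      = G p * exp (I * (k - p.1 : ℤ) * θ) := by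
    intro θ p
    rw [flatIntegrand, polarChar_polar _ _ hx, hG]
    have : exp (I * (k - p.1 : ℤ) * θ) = exp (-(I * p.1 * θ)) * exp (I * k * θ) := by
      rw [← exp_add]; push_cast; ring_nf
    rw [this]
    simp only [ofReal_zero, add_zero]
    ring
  have hGb : ∀ p, ‖G p‖ ≤ C * ((1 + |(p.1 : ℝ)| + |p.2|) ^ 4)⁻¹ * |x| ^ (-(σ + 0)) := by
    intro p
    have h1 := hC (x * exp (I * (0 : ℝ))) (mul_ne_zero hx0 (exp_ne_zero _)) p
    have h2 := hval 0 p
    rw [norm_ofReal_mul_exp] at h1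
    simp only [ofReal_zero, mul_zero, exp_zero, mul_one] at h1 h2
    rwa [h2] at h1
  have hGc : Continuous G := by
    refine continuous_prod_of_discrete_left.2 fun j => ?_
    refine ((hR.entire j).continuous.comp (by fun_prop)).mul ?_
    exact Continuous.const_cpow (by fun_prop) (Or.inl hx0)
  have hGi : Integrable G dualMeasure :=
    ((integrable_weight.const_mul C).mul_const _).mono' hGc.aestronglyMeasurable
      (Eventually.of_forall hGb)
  have step1 : polarCoeff k (flatFun 0 0 R) x = 2 * ∫ θ in (0 : ℝ)..(2 * Real.pi),
      ∫ p, G p * exp (I * (k - p.1 : ℤ) * θ) ∂dualMeasure := by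
    rw [polarCoeff]
    congr 2
    funext θ
    rw [hR.flatFun_eq 0 0 σ (mul_ne_zero hx0 (exp_ne_zero _)), ← integral_mul_const]
    simp only [hval]
  have hi : Integrable (Function.uncurry fun (θ : ℝ) (p : ℤ × ℝ) =>
      G p * exp (I * (k - p.1 : ℤ) * θ))
      ((volume.restrict (Ioc 0 (2 * Real.pi))).prod dualMeasure) := by
    have h1 : Integrable (fun q : ℝ × ℤ × ℝ => (1 : ℝ) * ‖G q.2‖)
        ((volume.restrict (Ioc 0 (2 * Real.pi))).prod dualMeasure) :=
      Integrable.mul_prod (f := fun _ : ℝ => (1 : ℝ)) (g := fun p => ‖G p‖)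
        (integrable_const 1) hGi.norm
    refine h1.mono' (Continuous.aestronglyMeasurable ?_) (Eventually.of_forall ?_)
    · refine (hGc.comp continuous_snd).mul ?_
      have : Continuous fun j : ℤ => (j : ℂ) := continuous_of_discreteTopology
      have h2 : Continuous fun q : ℝ × ℤ × ℝ => ((k - q.2.1 : ℤ) : ℂ) :=
        (continuous_of_discreteTopology (f := fun j : ℤ => ((k - j : ℤ) : ℂ))).comp
          (continuous_fst.comp continuous_snd)
      exact continuous_exp.comp ((continuous_const.mul h2).mul
        (continuous_ofReal.comp continuous_fst))
    · rintro ⟨θ, p⟩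
      simp only [Function.uncurry]
      rw [norm_mul, norm_exp_I_mul_int_mul, mul_one, one_mul]
  have step2 : ∫ θ in (0 : ℝ)..(2 * Real.pi),
      ∫ p, G p * exp (I * (k - p.1 : ℤ) * θ) ∂dualMeasure
      = ∫ p, G p * (if p.1 = k then 2 * Real.pi else 0 : ℂ) ∂dualMeasure := by
    rw [intervalIntegral.integral_of_le Real.two_pi_pos.le, integral_integral_swap hi]
    congr 1
    funext p
    rw [← intervalIntegral.integral_of_le Real.two_pi_pos.le, intervalIntegral.integral_const_mul,
      integral_exp_int]
    congr 1
    simp only [sub_eq_zero, eq_comm]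
  have hi2 : Integrable (fun p : ℤ × ℝ => G p * (if p.1 = k then 2 * Real.pi else 0 : ℂ))
      dualMeasure := by
    refine (hGi.norm.mul_const (2 * Real.pi)).mono' (Continuous.aestronglyMeasurable
      (hGc.mul ((continuous_of_discreteTopology
        (f := fun j : ℤ => (if j = k then 2 * Real.pi else 0 : ℂ))).comp continuous_fst)))
      (Eventually.of_forall fun p => ?_)
    rw [norm_mul]
    gcongr
    have := Real.pi_pos
    split_ifs
    · simp [abs_of_pos Real.pi_pos]
    · simp [this.le]
  have step3 : ∫ p, G p * (if p.1 = k then 2 * Real.pi else 0 : ℂ) ∂dualMeasure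
      = 2 * Real.pi * ∫ t : ℝ, G (k, t) := by
    have hcount := hi2.integral_prod_left
    rw [integral_prod _ hi2, integral_countable hcount, tsum_eq_single k]
    · simp only [if_true, integral_mul_const]
      simp [mul_comm]
    · intro j hj
      simp [hj]
  rw [step1, step2, step3, mellinInv]
  have e : ∫ t : ℝ, G (k, t)
      = ∫ y : ℝ, (x : ℂ) ^ (-(σ + y * I) : ℂ) • R k (σ + y * I) := by
    congr 1
    funext t
    simp only [hG, smul_eq_mul, mul_comm]
  rw [e, real_smul]
  generalize (∫ y : ℝ, (x : ℂ) ^ (-(σ + y * I) : ℂ) • R k (σ + y * I)) = J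
  have hpi : (Real.pi : ℂ) ≠ 0 := ofReal_ne_zero.2 Real.pi_ne_zero
  push_cast
  field_simp
  ring

open FourierTransform in
/-- Mellin inversion: the Mellin transforms of `hR.toSchwartz` are the given data, up to a constant.
In logarithmic coordinates this is Fourier inversion on the line `Re w = Re s`. -/
theorem hasMellin_toSchwartz (hR : EntireDecay R) (k : ℤ) {s : ℂ} (hs : 0 < s.re) :
    HasMellin (polarCoeff k hR.toSchwartz) s (8 * Real.pi ^ 2 * R k s) := by
  have hconv := mellinConvergent_polarCoeff k hR.toSchwartz hs
  refine ⟨hconv, ?_⟩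
  set σ : ℝ := s.re with hσ
  have hpi : (8 * Real.pi ^ 2 : ℂ) ≠ 0 := by
    have : (Real.pi : ℂ) ≠ 0 := ofReal_ne_zero.2 Real.pi_ne_zero
    simp [this]
  set f : ℝ → ℂ := mellinInv σ (R k) with hf
  have hpc : ∀ x : ℝ, 0 < x → polarCoeff k hR.toSchwartz x = 8 * Real.pi ^ 2 * f x :=
    fun x hx => hR.polarCoeff_flatFun k σ hx
  set h : ℝ → ℂ := fun y => R k (σ + 2 * Real.pi * y * I) with hh
  have hcont : Continuous h := (hR.entire k).continuous.comp (by fun_prop)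
  have hint : Integrable h := by
    have hg : Integrable fun t : ℝ => R k (σ + t * I) := by
      obtain ⟨C, hC⟩ := hR.bound σ σ 2
      have hw : Integrable (fun t : ℝ => C * (1 + ‖t‖) ^ (-2 : ℝ)) :=
        (integrable_one_add_norm (E := ℝ) (μ := volume) (r := 2) (by simp)).const_mul C
      refine hw.mono' (Continuous.aestronglyMeasurable ((hR.entire k).continuous.comp
        (by fun_prop))) (Eventually.of_forall fun t => ?_)
      have h1 := hC k (σ + t * I) (by simp) (by simp)
      have h0 : (0 : ℝ) ≤ 1 + ‖t‖ := by positivity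
      rw [Real.rpow_neg h0, Real.rpow_two, ← div_eq_mul_inv, le_div_iff₀ (by positivity)]
      refine le_trans ?_ h1
      gcongr
      · simp
      · simp
    have := hg.comp_mul_left' (R := 2 * Real.pi) (by positivity)
    refine this.congr (Eventually.of_forall fun y => ?_)
    simp [hh]
  have hinv : ∀ u : ℝ, Real.exp (-σ * u) • f (Real.exp (-u)) = 𝓕⁻ h u := by
    intro u
    rw [hf, mellinInv_eq_fourierInv σ (R k) (Real.exp_pos _), Real.log_exp, neg_neg, ← hh,
      real_smul, smul_eq_mul, ← mul_assoc]
    have : ((Real.exp (-σ * u) : ℝ) : ℂ) * ((Real.exp (-u) : ℝ) : ℂ) ^ (-σ : ℂ) = 1 := by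
      rw [← ofReal_neg, ← ofReal_cpow (Real.exp_pos _).le, ← Real.exp_mul, ← ofReal_mul,
        ← Real.exp_add, show -σ * u + -u * -σ = 0 by ring, Real.exp_zero, ofReal_one]
    rw [this, one_mul]
  have hint' : Integrable (𝓕⁻ h) := by
    have hc := mellinConvergent_polarCoeff k hR.toSchwartz (s := (σ : ℂ)) (by simpa using hs)
    have him : Real.exp ∘ Neg.neg '' univ = Ioi 0 := by
      rw [image_comp, image_univ_of_surjective neg_surjective, image_univ, Real.range_exp]
    have hinj : univ.InjOn (Real.exp ∘ Neg.neg) :=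
      Real.exp_injective.injOn.comp neg_injective.injOn (univ.mapsTo_univ _)
    have hder : ∀ x ∈ univ, HasDerivWithinAt (Real.exp ∘ Neg.neg) (-Real.exp (-x)) univ x :=
      fun x _ => mul_neg_one (Real.exp (-x)) ▸
        ((Real.hasDerivAt_exp (-x)).comp x (hasDerivAt_neg x)).hasDerivWithinAt
    rw [MellinConvergent, ← him,
      integrableOn_image_iff_integrableOn_abs_deriv_smul MeasurableSet.univ hder hinj,
      integrableOn_univ] at hc
    refine (hc.const_mul (8 * Real.pi ^ 2 : ℂ)⁻¹).congr (Eventually.of_forall fun u => ?_)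
    simp only [Function.comp_apply]
    rw [← hinv, hpc _ (Real.exp_pos _), abs_neg, abs_of_pos (Real.exp_pos _), real_smul, real_smul,
      smul_eq_mul]
    have : ((Real.exp (-u) : ℝ) : ℂ) * ((Real.exp (-u) : ℝ) : ℂ) ^ ((σ : ℂ) - 1)
        = ((Real.exp (-σ * u) : ℝ) : ℂ) := by
      rw [← ofReal_one, ← ofReal_sub, ← ofReal_cpow (Real.exp_pos _).le, ← Real.exp_mul,
        ← ofReal_mul, ← Real.exp_add]
      congr 2
      ring
    rw [← this]
    field_simp
  have hint'' : Integrable (𝓕 h) := by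
    have : 𝓕 h = fun u => 𝓕⁻ h (-u) := by
      funext u
      rw [Real.fourierInv_eq_fourier_neg, neg_neg]
    rw [this]
    exact hint'.comp_neg
  have hmf : mellin f s = R k s := by
    rw [mellin_eq_fourier, ← hσ]
    simp only [hinv]
    rw [show (fun u => 𝓕⁻ h u) = 𝓕⁻ h from rfl, hcont.fourier_fourierInv_eq hint hint'', hh]
    push_cast
    rw [mul_div_cancel₀ _ (by simp), hσ, re_add_im]
  rw [← hmf, ← smul_eq_mul, ← mellin_const_smul]
  refine setIntegral_congr_fun measurableSet_Ioi fun x hx => ?_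
  simp only [hpc x hx, smul_eq_mul]

end EntireDecay

/-! ### Poles, zeros and growth of the gamma factors -/

theorem Gamma_add_nat_eq_prod (z : ℂ) (N : ℕ) (h : ∀ i < N, z + i ≠ 0) :
    Gamma (z + N) = (∏ i ∈ Finset.range N, (z + i)) * Gamma z := by
  induction N with
  | zero => simp
  | succ N ih =>
    rw [Finset.prod_range_succ, show z + ((N + 1 : ℕ) : ℂ) = z + N + 1 by push_cast; ring,
      Gamma_add_one _ (h N (Nat.lt_succ_self N)), ih fun i hi => h i (Nat.lt_succ_of_lt hi)]
    ring

theorem norm_betaIntegral_le_one {u v : ℂ} (hu : 1 ≤ u.re) (hv : 1 ≤ v.re) :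
    ‖betaIntegral u v‖ ≤ 1 := by
  have h : ∀ x ∈ uIoc (0 : ℝ) 1, ‖(x : ℂ) ^ (u - 1) * (1 - (x : ℂ)) ^ (v - 1)‖ ≤ 1 := by
    intro x hx
    rw [uIoc_of_le zero_le_one] at hx
    have h1 : ‖(x : ℂ) ^ (u - 1)‖ ≤ 1 := by
      rw [norm_cpow_eq_rpow_re_of_pos hx.1]
      exact Real.rpow_le_one hx.1.le hx.2 (by simpa using hu)
    have h2 : ‖(1 - (x : ℂ)) ^ (v - 1)‖ ≤ 1 := by
      rcases eq_or_lt_of_le hx.2 with rfl | hlt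
      · rw [ofReal_one, sub_self]
        rcases eq_or_ne (v - 1) 0 with h0 | h0
        · rw [h0, cpow_zero, norm_one]
        · rw [zero_cpow h0, norm_zero]; exact zero_le_one
      · rw [← ofReal_one, ← ofReal_sub, norm_cpow_eq_rpow_re_of_pos (by linarith)]
        exact Real.rpow_le_one (by linarith) (by linarith [hx.1]) (by simpa using hv)
    rw [norm_mul]
    exact mul_le_one₀ h1 (norm_nonneg _) h2
  simpa [betaIntegral] using intervalIntegral.norm_integral_le_of_norm_le_const h

/-- Polynomial growth of a quotient of gamma functions: after both arguments are moved to the right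
it becomes a beta integral divided by `Γ(c)`, where `c` is real and bounded. -/
theorem exists_norm_Gamma_div_le (a b : ℝ) : ∃ (D : ℕ) (C : ℝ), 0 ≤ C ∧
    ∀ (κ : ℝ) (s : ℂ), 0 ≤ κ → a ≤ s.re → s.re ≤ b → (1 ≤ |s.im| ∨ (1 - a ≤ κ ∧ b ≤ κ)) →
      ‖Gamma (s + κ) / Gamma (1 - s + κ)‖ ≤ C * (1 + κ + |s.im|) ^ D := by
  set M : ℕ := ⌈1 - a⌉₊ with hM
  set T : ℕ := ⌈2 * b⌉₊ with hT
  have hMa : 1 - a ≤ M := Nat.le_ceil _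
  have hTb : 2 * b ≤ T := Nat.le_ceil _
  obtain ⟨L, hL⟩ := (isCompact_Icc (a := (1 : ℝ)) (b := 1 - 2 * a + T)).exists_bound_of_continuousOn
    (f := fun c : ℝ => (Gamma c)⁻¹)
    ((differentiable_one_div_Gamma.continuous.comp continuous_ofReal).continuousOn)
  set A : ℝ := 1 + |a| + |b| + (T + M) with hA
  have hA0 : 0 ≤ A := by positivity
  refine ⟨T + M, A ^ (T + M) * |L|, by positivity, fun κ s hκ ha hb hreg => ?_⟩
  set X : ℝ := 1 + κ + |s.im| with hX
  have hX1 : 1 ≤ X := by have := abs_nonneg s.im; linarith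
  set z : ℂ := s + κ with hz
  set w : ℂ := 1 - s + κ with hw
  have hzre : z.re = s.re + κ := by simp [hz]
  have hzim : z.im = s.im := by simp [hz]
  have hwre : w.re = 1 - s.re + κ := by simp [hw]
  have hwim : w.im = -s.im := by simp [hw]
  have hz1 : ∀ i : ℕ, 1 ≤ ‖z + i‖ := by
    intro i
    have hi : (0 : ℝ) ≤ i := Nat.cast_nonneg i
    rcases hreg with h | h
    · refine h.trans ?_
      have := abs_im_le_norm (z + i)
      simpa [hzim] using this
    · have := (le_abs_self _).trans (abs_re_le_norm (z + i))
      rw [add_re, natCast_re, hzre] at this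
      linarith [h.1]
  have hw1 : ∀ i : ℕ, 1 ≤ ‖w + i‖ := by
    intro i
    have hi : (0 : ℝ) ≤ i := Nat.cast_nonneg i
    rcases hreg with h | h
    · refine h.trans ?_
      have := abs_im_le_norm (w + i)
      simpa [hwim] using this
    · have := (le_abs_self _).trans (abs_re_le_norm (w + i))
      rw [add_re, natCast_re, hwre] at this
      linarith [h.2]
  have hne : ∀ {u : ℂ}, (∀ i : ℕ, 1 ≤ ‖u + i‖) → ∀ i : ℕ, u + i ≠ 0 := fun h i h0 => by
    have := h i
    rw [h0, norm_zero] at this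
    linarith
  have e1 := Gamma_add_nat_eq_prod z M fun i _ => hne hz1 i
  have e2 := Gamma_add_nat_eq_prod w (T + M) fun i _ => hne hw1 i
  set P := ∏ i ∈ Finset.range M, (z + i) with hP
  set Q := ∏ i ∈ Finset.range (T + M), (w + i) with hQ
  have hP1 : 1 ≤ ‖P‖ := by
    rw [hP, norm_prod]
    calc (1 : ℝ) = ∏ _i ∈ Finset.range M, (1 : ℝ) := by simp
      _ ≤ _ := Finset.prod_le_prod (fun _ _ => zero_le_one) fun i _ => hz1 i
  have hQ1 : ‖Q‖ ≤ (A * X) ^ (T + M) := by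
    rw [hQ, norm_prod]
    calc ∏ i ∈ Finset.range (T + M), ‖w + (i : ℂ)‖ ≤ ∏ _i ∈ Finset.range (T + M), A * X := by
          refine Finset.prod_le_prod (fun _ _ => norm_nonneg _) fun i hi => ?_
          have hi' : (i : ℝ) ≤ T + M := by exact_mod_cast (Finset.mem_range.1 hi).le
          have hi0 : (0 : ℝ) ≤ i := Nat.cast_nonneg i
          refine (norm_le_abs_re_add_abs_im _).trans ?_
          rw [add_re, add_im, natCast_re, natCast_im, hwre, hwim, add_zero, abs_neg]
          have h1 : |1 - s.re + κ + i| ≤ A + κ := by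
            have := neg_abs_le a
            have := le_abs_self b
            have := abs_nonneg a
            have := abs_nonneg b
            rw [abs_le]; constructor <;> linarith
          have h2 : 1 ≤ A := by
            have := abs_nonneg a
            have := abs_nonneg b
            linarith
          have := abs_nonneg s.im
          nlinarith
      _ = _ := by rw [Finset.prod_const, Finset.card_range]
  set c : ℝ := 1 - 2 * s.re + T with hc
  have hc1 : 1 ≤ c := by linarith
  have hZ1 : 1 ≤ (z + M).re := by rw [add_re, natCast_re, hzre]; linarith
  have hconj : (starRingEnd ℂ) (w + (T + M : ℕ)) = (z + M) + c := by
    apply Complex.ext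
    · simp [hwre, hzre, hc]; ring
    · simp [hwim, hzim]
  have hGc := Gamma_mul_Gamma_eq_betaIntegral (s := z + M) (t := c) (by linarith)
    (by rw [ofReal_re]; linarith)
  have hΓw : ‖Gamma (w + (T + M : ℕ))‖ = ‖Gamma ((z + M) + c)‖ := by
    rw [← hconj, Gamma_conj, RCLike.norm_conj]
  have hΓ0 : Gamma ((z + M) + c) ≠ 0 := Gamma_ne_zero_of_re_pos (by
    rw [add_re, ofReal_re]; linarith)
  have hΓc0 : Gamma (c : ℂ) ≠ 0 := Gamma_ne_zero_of_re_pos (by rw [ofReal_re]; linarith)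
  have hratio : ‖Gamma (z + M)‖ ≤ |L| * ‖Gamma ((z + M) + c)‖ := by
    have h1 : Gamma (z + M) = Gamma ((z + M) + c) * betaIntegral (z + M) c * (Gamma (c : ℂ))⁻¹ := by
      rw [← hGc]; field_simp
    rw [h1, norm_mul, norm_mul]
    have h2 := norm_betaIntegral_le_one hZ1 (v := c) (by rw [ofReal_re]; exact hc1)
    have h3 : ‖(Gamma (c : ℂ))⁻¹‖ ≤ |L| := (hL c ⟨hc1, by linarith⟩).trans (le_abs_self L)
    calc _ ≤ ‖Gamma ((z + M) + c)‖ * 1 * |L| := by gcongr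
      _ = _ := by ring
  have hP0 : P ≠ 0 := fun h => by rw [h, norm_zero] at hP1; linarith
  have hw0 : Gamma w ≠ 0 := by
    intro h0
    rw [h0, mul_zero] at e2
    rw [e2, norm_zero] at hΓw
    exact hΓ0 (norm_eq_zero.1 hΓw.symm)
  have hz' : ‖Gamma z‖ ≤ ‖Gamma (z + M)‖ := by
    rw [e1, norm_mul]
    exact le_mul_of_one_le_left (norm_nonneg _) hP1
  rw [norm_div, div_le_iff₀ (norm_pos_iff.2 hw0)]
  calc ‖Gamma z‖ ≤ |L| * ‖Gamma (w + (T + M : ℕ))‖ := by rw [hΓw]; exact hz'.trans hratio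
    _ ≤ |L| * ((A * X) ^ (T + M) * ‖Gamma w‖) := by rw [e2, norm_mul]; gcongr
    _ = _ := by rw [mul_pow]; ring

/-- The gamma factor grows at most polynomially in `k` and `Im s`, jointly. -/
theorem polyGrowth_gammaFactorOne (m : ℤ) (μ : ℂ) :
    PolyGrowth fun k s => gammaFactorOne (m - k) (s / 2 - μ) := by
  intro a b
  set a' : ℝ := a / 2 - μ.re with ha'
  set b' : ℝ := b / 2 - μ.re with hb'
  obtain ⟨D, C, hC0, hC⟩ := exists_norm_Gamma_div_le a' b'
  obtain ⟨L, hL⟩ := (isCompact_Icc (a := a') (b := b')).exists_bound_of_continuousOn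
    (f := fun x : ℝ => (2 * Real.pi) ^ (1 - 2 * x))
    (Continuous.continuousOn (Continuous.rpow continuous_const (by fun_prop)
      fun x => Or.inl (by positivity)))
  set E : ℝ := 1 + |(m : ℝ)| + |μ.im| with hE
  refine ⟨D, 2 * |1 - a'| + 2 * |b'| + |(m : ℝ)| + 2 * |μ.im| + 2, |L| * C * E ^ D,
    fun k s ha hb hK => ?_⟩
  set u : ℂ := s / 2 - μ with hu
  have hure : u.re = s.re / 2 - μ.re := by simp [hu]
  have huim : u.im = s.im / 2 - μ.im := by simp [hu]
  set κ : ℝ := ((m - k).natAbs : ℝ) / 2 with hκ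
  have hκ' : κ = |(m : ℝ) - k| / 2 := by rw [hκ, Nat.cast_natAbs]; push_cast; rfl
  have hu1 : a' ≤ u.re := by rw [hure]; linarith
  have hu2 : u.re ≤ b' := by rw [hure]; linarith
  have n1 := abs_nonneg (1 - a')
  have n2 := abs_nonneg b'
  have n3 := abs_nonneg (m : ℝ)
  have n4 := abs_nonneg μ.im
  have n5 := abs_nonneg (k : ℝ)
  have n6 := abs_nonneg s.im
  have hmain := hC κ u (by positivity) hu1 hu2 (by
    rcases hK with h | h
    · left
      rw [huim]
      have := abs_sub_abs_le_abs_sub (s.im / 2) μ.im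
      rw [abs_div, abs_two] at this
      linarith
    · right
      have h3 := abs_sub_abs_le_abs_sub (k : ℝ) m
      rw [abs_sub_comm] at h3
      have h1 := le_abs_self (1 - a')
      have h2 := le_abs_self b'
      rw [hκ']
      constructor <;> linarith)
  have hpow : ‖(2 * (Real.pi : ℂ)) ^ (1 - 2 * u)‖ ≤ |L| := by
    rw [show (2 * (Real.pi : ℂ)) = ((2 * Real.pi : ℝ) : ℂ) by push_cast; rfl,
      norm_cpow_eq_rpow_re_of_pos Real.two_pi_pos]
    have := hL u.re ⟨hu1, hu2⟩
    rw [Real.norm_of_nonneg (by positivity)] at this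
    have e : (1 - 2 * u).re = 1 - 2 * u.re := by simp
    rw [e]
    exact this.trans (le_abs_self L)
  have hw : 1 + κ + |u.im| ≤ E * (1 + |(k : ℝ)| + |s.im|) := by
    rw [hκ', huim]
    have h1 := abs_sub (m : ℝ) k
    have h2 := abs_sub (s.im / 2) μ.im
    rw [abs_div, abs_two] at h2
    nlinarith [mul_nonneg n3 n5, mul_nonneg n3 n6, mul_nonneg n4 n5, mul_nonneg n4 n6]
  have hcast : ((m - k).natAbs : ℂ) / 2 = (κ : ℂ) := by rw [hκ]; push_cast; rfl
  have hfac : gammaFactorOne (m - k) u = I ^ (m - k).natAbs * (2 * (Real.pi : ℂ)) ^ (1 - 2 * u)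
      * (Gamma (u + κ) / Gamma (1 - u + κ)) := by
    rw [gammaFactorOne, hcast, mul_div_assoc]
  change ‖gammaFactorOne (m - k) u‖ ≤ _
  rw [hfac, norm_mul, norm_mul, norm_pow, norm_I, one_pow, one_mul]
  calc _ ≤ |L| * (C * (1 + κ + |u.im|) ^ D) := by gcongr
    _ ≤ |L| * (C * (E * (1 + |(k : ℝ)| + |s.im|)) ^ D) := by gcongr
    _ = _ := by rw [mul_pow]; ring

theorem polyGrowth_gammaFactor {n : ℕ} (μ : Fin n → ℂ) (m : Fin n → ℤ) :
    PolyGrowth fun k s => gammaFactor μ (fun l => m l + -k) (s / 2) := by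
  simp only [gammaFactor, ← sub_eq_add_neg]
  exact PolyGrowth.prod _ fun l _ => polyGrowth_gammaFactorOne (m l) (μ l)

theorem analyticAt_Gamma {w : ℂ} (h : ∀ a : ℕ, w ≠ -a) : AnalyticAt ℂ Gamma w := by
  have h1 : AnalyticAt ℂ (fun w => (Gamma w)⁻¹) w :=
    differentiable_one_div_Gamma.analyticAt w
  have h2 : (Gamma w)⁻¹ ≠ 0 := inv_ne_zero (Gamma_ne_zero h)
  have e : (fun w => (Gamma w)⁻¹)⁻¹ = Gamma := by
    funext w
    simp
  exact e ▸ h1.inv h2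

theorem meromorphicOrderAt_Gamma_nonneg {w : ℂ} (h : ∀ a : ℕ, w ≠ -a) :
    0 ≤ meromorphicOrderAt Gamma w := (analyticAt_Gamma h).meromorphicOrderAt_nonneg

theorem meromorphicOrderAt_Gamma_ge (w : ℂ) :
    ((-1 : ℤ) : WithTop ℤ) ≤ meromorphicOrderAt Gamma w := by
  by_cases h : ∀ a : ℕ, w ≠ -a
  · exact le_trans (by exact_mod_cast (by norm_num : (-1 : ℤ) ≤ 0))
      (meromorphicOrderAt_Gamma_nonneg h)
  · push Not at h
    obtain ⟨a, rfl⟩ := h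
    induction a with
    | zero =>
      have e : Gamma =ᶠ[𝓝[≠] (0 : ℂ)] fun w => w⁻¹ * Gamma (w + 1) := by
        filter_upwards [self_mem_nhdsWithin] with w hw
        have hw' : w ≠ 0 := hw
        rw [Gamma_add_one w hw']
        field_simp
      have h1 : AnalyticAt ℂ (fun w : ℂ => Gamma (w + 1)) 0 := by
        have h2 : AnalyticAt ℂ Gamma (0 + 1) := analyticAt_Gamma fun a ha => by
          have := congrArg re ha
          simp at this
          have h3 : (0 : ℝ) ≤ a := Nat.cast_nonneg a
          linarith
        exact AnalyticAt.fun_comp (g := Gamma) (f := fun w : ℂ => w + 1) h2 (by fun_prop)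
      have h3 : meromorphicOrderAt (fun w : ℂ => w⁻¹) 0 = ((-1 : ℤ) : WithTop ℤ) := by
        have := meromorphicOrderAt_inv (f := (id : ℂ → ℂ)) (x := 0)
        rw [meromorphicOrderAt_id] at this
        exact this
      simp only [Nat.cast_zero, neg_zero]
      rw [meromorphicOrderAt_congr e]
      have := meromorphicOrderAt_mul (f := fun w : ℂ => w⁻¹) (x := 0)
        ((MeromorphicAt.id 0).inv) h1.meromorphicAt
      rw [show (fun w : ℂ => w⁻¹ * Gamma (w + 1)) = (fun w : ℂ => w⁻¹) * fun w => Gamma (w + 1)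
        from rfl, this, h3]
      exact le_add_of_nonneg_right h1.meromorphicOrderAt_nonneg
    | succ a ih =>
      have hne : (-((a + 1 : ℕ) : ℂ)) ≠ 0 := neg_ne_zero.2 (Nat.cast_ne_zero.2 (Nat.succ_ne_zero a))
      have e : Gamma =ᶠ[𝓝[≠] (-((a + 1 : ℕ) : ℂ))] fun w => w⁻¹ * Gamma (w + 1) := by
        refine Filter.Eventually.filter_mono nhdsWithin_le_nhds ?_
        filter_upwards [isOpen_ne.mem_nhds hne] with w hw
        have hw' : w ≠ 0 := hw
        rw [Gamma_add_one w hw']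
        field_simp
      rw [meromorphicOrderAt_congr e]
      have h1 := meromorphicOrderAt_mul_of_ne_zero (g := fun w : ℂ => w⁻¹)
        (f := fun w => Gamma (w + 1)) (x := -((a + 1 : ℕ) : ℂ)) (analyticAt_inv hne)
        (inv_ne_zero hne)
      rw [show (fun w : ℂ => w⁻¹ * Gamma (w + 1)) = (fun w : ℂ => w⁻¹) * fun w => Gamma (w + 1)
        from rfl, h1]
      have h2 := meromorphicOrderAt_comp_add_const_eq_meromorphicOrderAt (f := Gamma) (c := (1 : ℂ))
        (x := -((a + 1 : ℕ) : ℂ))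
      rw [show -((a + 1 : ℕ) : ℂ) + 1 = -(a : ℂ) by push_cast; ring] at h2
      exact ih.trans h2.symm.le

theorem meromorphicOrderAt_one_div_Gamma_nonneg (w : ℂ) :
    0 ≤ meromorphicOrderAt (fun w => (Gamma w)⁻¹) w :=
  (differentiable_one_div_Gamma.analyticAt w).meromorphicOrderAt_nonneg

theorem meromorphicOrderAt_one_div_Gamma_ge (a : ℕ) :
    ((1 : ℤ) : WithTop ℤ) ≤ meromorphicOrderAt (fun w => (Gamma w)⁻¹) (-(a : ℂ)) := by
  have h := differentiable_one_div_Gamma.analyticAt (-(a : ℂ))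
  have h1 : 0 < meromorphicOrderAt (fun w => (Gamma w)⁻¹) (-(a : ℂ)) := by
    rw [← tendsto_zero_iff_meromorphicOrderAt_pos h.meromorphicAt]
    have h2 := h.continuousAt.tendsto
    simp only [Gamma_neg_nat_eq_zero, inv_zero] at h2
    exact h2.mono_left nhdsWithin_le_nhds
  rcases hx : meromorphicOrderAt (fun w => (Gamma w)⁻¹) (-(a : ℂ)) with _ | x
  · exact le_top
  · rw [hx] at h1
    have h2 : (0 : ℤ) < x := WithTop.coe_lt_coe.1 h1
    exact WithTop.coe_le_coe.2 h2

open Classical in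
/-- The order of `G_m` at a point is at least minus one where the numerator has a pole, and
at least one more where the denominator has a pole. -/
theorem meromorphicOrderAt_gammaFactorOne_ge (m : ℤ) (s : ℂ) :
    MeromorphicAt (gammaFactorOne m) s ∧
    (((if ∃ a : ℕ, s + (m.natAbs : ℂ) / 2 = -a then -1 else 0)
      + (if ∃ a : ℕ, 1 - s + (m.natAbs : ℂ) / 2 = -a then 1 else 0) : ℤ) : WithTop ℤ)
      ≤ meromorphicOrderAt (gammaFactorOne m) s := by
  set c : ℂ := (m.natAbs : ℂ) / 2 with hc
  set f₁ : ℂ → ℂ := fun s => I ^ m.natAbs * (2 * (Real.pi : ℂ)) ^ (1 - 2 * s) with hf₁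
  set f₂ : ℂ → ℂ := fun s => Gamma (s + c) with hf₂
  set f₃ : ℂ → ℂ := fun s => (Gamma (1 - s + c))⁻¹ with hf₃
  have hfac : gammaFactorOne m = f₁ * (f₂ * f₃) := by
    funext s
    simp only [gammaFactorOne, Pi.mul_apply, hf₁, hf₂, hf₃, hc]
    ring
  have hpi : (2 * (Real.pi : ℂ)) ≠ 0 :=
    mul_ne_zero two_ne_zero (ofReal_ne_zero.2 Real.pi_ne_zero)
  have d1 : Differentiable ℂ f₁ := fun s =>
    (differentiableAt_const _).mul (DifferentiableAt.const_cpow (by fun_prop) (Or.inl hpi))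
  have a1 : AnalyticAt ℂ f₁ s := d1.analyticAt s
  have n1 : f₁ s ≠ 0 := mul_ne_zero (pow_ne_zero _ I_ne_zero) (by
    rw [cpow_def_of_ne_zero hpi]; exact exp_ne_zero _)
  have m2 : MeromorphicAt f₂ s :=
    (Meromorphic.Gamma (s + c)).comp_analyticAt (f := Gamma) (g := fun s => s + c) (by fun_prop)
  have d3 : Differentiable ℂ f₃ :=
    differentiable_one_div_Gamma.comp (by fun_prop : Differentiable ℂ fun s : ℂ => 1 - s + c)
  have a3 : AnalyticAt ℂ f₃ s := d3.analyticAt s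
  have o2 : meromorphicOrderAt f₂ s = meromorphicOrderAt Gamma (s + c) :=
    meromorphicOrderAt_comp_add_const_eq_meromorphicOrderAt
  have o3 : meromorphicOrderAt f₃ s = meromorphicOrderAt (fun w => (Gamma w)⁻¹) (1 - s + c) := by
    refine meromorphicOrderAt_comp_of_deriv_ne_zero (f := fun w => (Gamma w)⁻¹)
      (g := fun s : ℂ => 1 - s + c) (by fun_prop) ?_
    have : HasDerivAt (fun s : ℂ => 1 - s + c) (-1) s := by
      simpa using ((hasDerivAt_id s).const_sub 1).add_const c
    rw [this.deriv]
    norm_num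
  rw [hfac]
  refine ⟨a1.meromorphicAt.mul (m2.mul a3.meromorphicAt), ?_⟩
  rw [meromorphicOrderAt_mul_of_ne_zero a1 n1, meromorphicOrderAt_mul m2 a3.meromorphicAt, o2, o3]
  push_cast
  refine add_le_add ?_ ?_
  · split_ifs with h
    · exact meromorphicOrderAt_Gamma_ge _
    · push Not at h
      exact meromorphicOrderAt_Gamma_nonneg h
  · split_ifs with h
    · obtain ⟨a, ha⟩ := h
      rw [ha]
      exact meromorphicOrderAt_one_div_Gamma_ge a
    · exact meromorphicOrderAt_one_div_Gamma_nonneg _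

open scoped ContDiff

/-! ### Schwartz functions with a prescribed Taylor expansion at the origin -/

theorem exists_norm_homogeneous_le {p : ℂ → ℂ} {M : ℕ} (hp : Continuous p)
    (hom : ∀ t : ℝ, 0 < t → ∀ z, p (t • z) = (t : ℂ) ^ M * p z) :
    ∃ B, 0 ≤ B ∧ ∀ z, z ≠ 0 → ‖p z‖ ≤ B * ‖z‖ ^ M := by
  obtain ⟨B, hB⟩ := (isCompact_sphere (0 : ℂ) 1).exists_bound_of_continuousOn hp.continuousOn
  refine ⟨max B 0, le_max_right _ _, fun z hz => ?_⟩
  have hz' : 0 < ‖z‖ := norm_pos_iff.2 hz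
  have h1 := hom ‖z‖ hz' ((‖z‖⁻¹ : ℝ) • z)
  rw [smul_smul, mul_inv_cancel₀ hz'.ne', one_smul] at h1
  have h2 : ‖p ((‖z‖⁻¹ : ℝ) • z)‖ ≤ B := hB _ (by
    rw [mem_sphere_zero_iff_norm, norm_smul, norm_inv, norm_norm, inv_mul_cancel₀ hz'.ne'])
  rw [h1, norm_mul, norm_pow, Complex.norm_real, norm_norm, mul_comm]
  gcongr
  exact h2.trans (le_max_left _ _)

/-- Cutting off a homogeneous function of degree `M` at a small scale makes all of its derivatives
of order less than `M` small. -/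
theorem exists_scale_bump_mul_small (η : ContDiffBump (0 : ℂ)) {p : ℂ → ℂ} {M : ℕ}
    (hp : ContDiff ℝ ∞ p)
    (hom : ∀ t : ℝ, 0 < t → ∀ z, p (t • z) = (t : ℂ) ^ M * p z) {ε : ℝ} (hε : 0 < ε) :
    ∃ t : ℝ, 1 ≤ t ∧ (∀ i < M, ∀ z, ‖iteratedFDeriv ℝ i (fun z => (η (t • z) : ℂ) * p z) z‖ ≤ ε) ∧
      (0 < M → ∀ z, z ≠ 0 → ‖(η (t • z) : ℂ) * p z‖ ≤ ε * ‖z‖ ^ (M - 1)) := by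
  set E : ℂ → ℂ := fun z => (η z : ℂ) * p z with hE
  have hη : ContDiff ℝ ∞ fun z : ℂ => (η z : ℂ) :=
    Complex.ofRealCLM.contDiff.comp η.contDiff
  have hEs : ContDiff ℝ ∞ E := hη.mul hp
  have hEc : HasCompactSupport E := by
    have h1 : HasCompactSupport fun z : ℂ => (η z : ℂ) :=
      η.hasCompactSupport.comp_left (g := fun x : ℝ => (x : ℂ)) (by simp)
    exact h1.mul_right
  have hb : ∀ i : ℕ, ∃ B, 0 ≤ B ∧ ∀ z, ‖iteratedFDeriv ℝ i E z‖ ≤ B := fun i => by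
    obtain ⟨B, -, hB⟩ := (hEc.toSchwartzMap hEs).decay 0 i
    have hB' : ∀ z, ‖iteratedFDeriv ℝ i E z‖ ≤ B := fun z => by
      have := hB z
      rwa [pow_zero, one_mul] at this
    exact ⟨B, (norm_nonneg _).trans (hB' 0), hB'⟩
  choose B hB0 hB using hb
  obtain ⟨Bp, hBp0, hBp⟩ := exists_norm_homogeneous_le hp.continuous hom
  set S := ∑ i ∈ Finset.range M, B i with hS
  have hS0 : 0 ≤ S := Finset.sum_nonneg fun i _ => hB0 i
  set R := η.rOut with hR
  have hR0 : 0 < R := η.rOut_pos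
  set t : ℝ := 1 + (S + R * Bp) / ε with ht
  have ht1 : 1 ≤ t := by
    have : 0 ≤ (S + R * Bp) / ε := by positivity
    linarith
  have ht0 : 0 < t := by linarith
  have hSt : S ≤ ε * t := by
    rw [ht, mul_add, mul_div_cancel₀ _ hε.ne']
    nlinarith
  have hRt : R * Bp ≤ ε * t := by
    rw [ht, mul_add, mul_div_cancel₀ _ hε.ne']
    nlinarith
  refine ⟨t, ht1, fun i hi z => ?_, fun hM z hz => ?_⟩
  · have e : (fun z => (η (t • z) : ℂ) * p z) = fun z => ((t ^ M)⁻¹ : ℝ) • E (t • z) := by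
      funext z
      have ht' : (t : ℂ) ≠ 0 := by exact_mod_cast ht0.ne'
      have h1 := hom t ht0 z
      rw [real_smul] at h1
      simp only [hE, real_smul, h1]
      push_cast
      field_simp
    have hEt : ContDiff ℝ i fun z => E (t • z) :=
      (hEs.of_le (by exact_mod_cast le_top)).comp (contDiff_const_smul t)
    rw [e, iteratedFDeriv_const_smul_apply' hEt.contDiffAt,
      iteratedFDeriv_comp_const_smul t (hEs.of_le (by exact_mod_cast le_top)), norm_smul, norm_smul,
      norm_inv, norm_pow, norm_pow, Real.norm_of_nonneg ht0.le]
    have h1 : ‖iteratedFDeriv ℝ i E (t • z)‖ ≤ ε * t :=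
      ((hB i _).trans (Finset.single_le_sum (fun i _ => hB0 i) (Finset.mem_range.2 hi))).trans hSt
    have h2 : t ^ i * t ≤ t ^ M := by
      rw [← pow_succ]
      exact pow_le_pow_right₀ ht1 hi
    rw [inv_mul_le_iff₀ (by positivity)]
    calc _ ≤ t ^ i * (ε * t) := by gcongr
      _ = t ^ i * t * ε := by ring
      _ ≤ _ := by gcongr
  · rcases le_or_gt R (t * ‖z‖) with h | h
    · have : η (t • z) = 0 := η.zero_of_le_dist (by
        rw [dist_zero_right, norm_smul, Real.norm_of_nonneg ht0.le]; exact h)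
      rw [this, ofReal_zero, zero_mul, norm_zero]
      positivity
    · have h1 : ‖(η (t • z) : ℂ)‖ ≤ 1 := by
        rw [norm_real, Real.norm_of_nonneg η.nonneg]
        exact η.le_one
      have h2 : Bp * ‖z‖ ≤ ε := by
        by_contra h3
        push Not at h3
        have h4 : ε * t < Bp * ‖z‖ * t := by gcongr
        have h5 : Bp * (t * ‖z‖) ≤ Bp * R := by gcongr
        nlinarith
      calc _ ≤ 1 * (Bp * ‖z‖ ^ M) := by
            rw [norm_mul]
            gcongr
            exact hBp z hz
        _ = Bp * ‖z‖ * ‖z‖ ^ (M - 1) := by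
            conv_lhs => rw [← Nat.sub_add_cancel hM, pow_succ]
            ring
        _ ≤ _ := by gcongr

/-- Borel's lemma: there is a Schwartz function whose Taylor polynomials at the origin have
prescribed homogeneous parts. -/
theorem exists_schwartz_taylor (p : ℕ → ℂ → ℂ) (hp : ∀ M, ContDiff ℝ ∞ (p M))
    (hom : ∀ M, ∀ t : ℝ, 0 < t → ∀ z, p M (t • z) = (t : ℂ) ^ M * p M z) :
    ∃ φ : 𝓢(ℂ, ℂ), ∀ N : ℕ, ∃ δ C : ℝ, 0 < δ ∧ ∀ z, z ≠ 0 → ‖z‖ ≤ δ →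
      ‖φ z - ∑ M ∈ Finset.range (N + 1), p M z‖ ≤ C * ‖z‖ ^ N := by
  let η : ContDiffBump (0 : ℂ) := ⟨1, 2, one_pos, one_lt_two⟩
  choose t ht1 htd htb using fun M => exists_scale_bump_mul_small η (hp M) (hom M)
    (ε := (1 / 2) ^ M) (by positivity)
  have ht0 : ∀ M, 0 < t M := fun M => one_pos.trans_le (ht1 M)
  set f : ℕ → ℂ → ℂ := fun M z => (η (t M • z) : ℂ) * p M z with hf
  have hgeo : Summable fun M : ℕ => (1 / 2 : ℝ) ^ M := summable_geometric_two
  have hfs : ∀ M, ContDiff ℝ ∞ (f M) := fun M => by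
    have h1 : ContDiff ℝ ∞ fun z : ℂ => (η (t M • z) : ℂ) :=
      Complex.ofRealCLM.contDiff.comp (η.contDiff.comp (contDiff_const_smul (t M)))
    exact h1.mul (hp M)
  have hF : ContDiff ℝ ∞ fun z => ∑' M, f M z := by
    refine contDiff_tsum_of_eventually (v := fun _ M => (1 / 2 : ℝ) ^ M) hfs (fun _ _ => hgeo)
      fun k _ => ?_
    rw [Nat.cofinite_eq_atTop]
    filter_upwards [eventually_gt_atTop k] with M hM z using htd M k hM z
  have hη0 : ∀ M (z : ℂ), 2 ≤ ‖z‖ → f M z = 0 := fun M z hz => by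
    have : η (t M • z) = 0 := η.zero_of_le_dist (by
      rw [dist_zero_right, norm_smul, Real.norm_of_nonneg (ht0 M).le]
      change (2 : ℝ) ≤ _
      nlinarith [ht1 M])
    simp only [hf, this, ofReal_zero, zero_mul]
  have hFc : HasCompactSupport fun z => ∑' M, f M z := by
    refine HasCompactSupport.intro (isCompact_closedBall (0 : ℂ) 2) fun z hz => ?_
    rw [mem_closedBall_zero_iff, not_le] at hz
    simp [hη0 _ z hz.le]
  refine ⟨hFc.toSchwartzMap hF, fun N => ?_⟩
  set T := ∑ M ∈ Finset.range (N + 1), t M with hT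
  have hTt : ∀ M ∈ Finset.range (N + 1), t M ≤ T := fun M hM =>
    Finset.single_le_sum (fun i _ => (ht0 i).le) hM
  have hT1 : 1 ≤ T := (ht1 0).trans (hTt 0 (by simp))
  have hT0 : 0 < T := by linarith
  refine ⟨T⁻¹, 2, inv_pos.2 hT0, fun z hz hzδ => ?_⟩
  have hz1 : ‖z‖ ≤ 1 := hzδ.trans (inv_le_one_of_one_le₀ hT1)
  have hhead : ∀ M ∈ Finset.range (N + 1), p M z = f M z := fun M hM => by
    have : η (t M • z) = 1 := η.one_of_mem_closedBall (by
      rw [mem_closedBall_zero_iff, norm_smul, Real.norm_of_nonneg (ht0 M).le]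
      change _ ≤ (1 : ℝ)
      calc t M * ‖z‖ ≤ T * T⁻¹ := by gcongr; exact hTt M hM
        _ = 1 := mul_inv_cancel₀ hT0.ne')
    simp only [hf, this, ofReal_one, one_mul]
  have htail : ∀ M : ℕ, ‖f (M + (N + 1)) z‖ ≤ (1 / 2) ^ M * ‖z‖ ^ N := fun M => by
    refine (htb (M + (N + 1)) (by omega) z hz).trans ?_
    have h1 : (1 / 2 : ℝ) ^ (M + (N + 1)) ≤ (1 / 2) ^ M :=
      pow_le_pow_of_le_one (by norm_num) (by norm_num) (by omega)
    have h2 : ‖z‖ ^ (M + (N + 1) - 1) ≤ ‖z‖ ^ N :=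
      pow_le_pow_of_le_one (norm_nonneg _) hz1 (by omega)
    gcongr
  have hsum : Summable fun M => f M z :=
    (summable_nat_add_iff (N + 1)).1 (Summable.of_norm_bounded (hgeo.mul_right _) htail)
  change ‖∑' M, f M z - _‖ ≤ _
  rw [Finset.sum_congr rfl hhead, ← hsum.sum_add_tsum_nat_add (N + 1), add_sub_cancel_left]
  have h2 : HasSum (fun M : ℕ => (1 / 2 : ℝ) ^ M * ‖z‖ ^ N) (2 * ‖z‖ ^ N) :=
    hasSum_geometric_two.mul_right _
  exact tsum_of_norm_bounded h2 htail

/-! ### Schwartz functions with prescribed poles of the Mellin transforms -/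

/-- The identity theorem for meromorphic functions. -/
theorem eventuallyEq_nhdsNE_of_meromorphicOn {f g : ℂ → ℂ} {U : Set ℂ} (hU : IsPreconnected U)
    (hf : MeromorphicOn f U) (hg : MeromorphicOn g U) {x y : ℂ} (hx : x ∈ U) (hy : y ∈ U)
    (h : f =ᶠ[𝓝[≠] x] g) : f =ᶠ[𝓝[≠] y] g := by
  have hfg : MeromorphicOn (f - g) U := hf.sub hg
  by_contra hne
  have h1 : meromorphicOrderAt (f - g) y ≠ ⊤ := by
    rw [Ne, meromorphicOrderAt_eq_top_iff]
    intro h2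
    apply hne
    filter_upwards [h2] with z hz using sub_eq_zero.1 hz
  refine hfg.meromorphicOrderAt_ne_top_of_isPreconnected hU hy hx h1 ?_
  rw [meromorphicOrderAt_eq_top_iff]
  filter_upwards [h] with z hz using sub_eq_zero.2 hz

theorem polarCoeff_monomial (k : ℤ) (a b : ℕ) (c : ℂ) (x : ℝ) :
    polarCoeff k (fun z => c * (z ^ a * (starRingEnd ℂ z) ^ b)) x
      = if k = b - a then 4 * Real.pi * c * (x : ℂ) ^ (a + b) else 0 := by
  have e : ∀ θ : ℝ, c * (((x : ℂ) * exp (I * θ)) ^ a * (starRingEnd ℂ ((x : ℂ) * exp (I * θ))) ^ b)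
      * exp (I * k * θ) = c * (x : ℂ) ^ (a + b) * exp (I * ((k + a - b : ℤ) : ℂ) * θ) := fun θ => by
    rw [map_mul, conj_ofReal, ← exp_conj, map_mul, conj_I, conj_ofReal, mul_pow, mul_pow,
      ← exp_nat_mul, ← exp_nat_mul, pow_add]
    calc _ = c * ((x : ℂ) ^ a * (x : ℂ) ^ b) *
          (exp (a * (I * θ)) * exp (b * (-I * θ)) * exp (I * k * θ)) := by ring
      _ = _ := by
        rw [← exp_add, ← exp_add]
        congr 2
        push_cast
        ring
  unfold polarCoeff
  simp only [e]
  rw [intervalIntegral.integral_const_mul, EntireDecay.integral_exp_int]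
  have hk : (k + a - b : ℤ) = 0 ↔ k = b - a := by omega
  simp only [hk]
  split_ifs <;> ring

theorem polarCoeff_sum {ι : Type*} (S : Finset ι) (k : ℤ) {f : ι → ℂ → ℂ}
    (hf : ∀ i ∈ S, Continuous (f i)) (x : ℝ) :
    polarCoeff k (fun z => ∑ i ∈ S, f i z) x = ∑ i ∈ S, polarCoeff k (f i) x := by
  unfold polarCoeff
  simp only [Finset.sum_mul]
  rw [intervalIntegral.integral_finsetSum, Finset.mul_sum]
  intro i hi
  have := hf i hi
  exact Continuous.intervalIntegrable (by fun_prop) _ _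

theorem polarCoeff_sub (k : ℤ) {f g : ℂ → ℂ} (hf : Continuous f) (hg : Continuous g) (x : ℝ) :
    polarCoeff k (fun z => f z - g z) x = polarCoeff k f x - polarCoeff k g x := by
  unfold polarCoeff
  simp only [sub_mul]
  rw [intervalIntegral.integral_sub (Continuous.intervalIntegrable (by fun_prop) _ _)
    (Continuous.intervalIntegrable (by fun_prop) _ _), mul_sub]

theorem hasMellin_finset_sum {ι : Type*} (S : Finset ι) {f : ι → ℝ → ℂ} {H : ι → ℂ} {s : ℂ}
    (h : ∀ i ∈ S, HasMellin (f i) s (H i)) :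
    HasMellin (fun x => ∑ i ∈ S, f i x) s (∑ i ∈ S, H i) := by
  classical
  induction S using Finset.induction_on with
  | empty => simp [HasMellin, MellinConvergent, mellin]
  | insert a S ha ih =>
    simp only [Finset.sum_insert ha]
    have h1 := h a (Finset.mem_insert_self _ _)
    have h2 := ih fun i hi => h i (Finset.mem_insert_of_mem hi)
    have h3 := hasMellin_add h1.1 h2.1
    rwa [h1.2, h2.2] at h3

/-- Borel's lemma on the side of Mellin transforms. The polar coefficients of
`z ^ a * conj z ^ b` vanish unless `k = b - a`, when they are `4π x ^ (a + b)`; so a Taylor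
coefficient at these exponents yields a simple pole of the Mellin transform at `-(a + b)`. -/
theorem exists_schwartz_mellinExt_residue (d : ℤ → ℂ → ℂ)
    (hd : ∀ k s, d k s ≠ 0 → ∃ a b : ℕ, s = -(a + b : ℕ) ∧ k = b - a) :
    ∃ φ : 𝓢(ℂ, ℂ), ∀ k s₀, ∃ g : ℂ → ℂ, AnalyticAt ℂ g s₀ ∧
      mellinExt k φ =ᶠ[𝓝[≠] s₀] fun s => d k s₀ / (s - s₀) + g s := by
  set c : ℕ → ℕ → ℂ := fun a b => d (b - a) (-(a + b : ℕ)) / (4 * Real.pi) with hc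
  set p : ℕ → ℂ → ℂ := fun M z => ∑ ab ∈ Finset.HasAntidiagonal.antidiagonal M,
    c ab.1 ab.2 * (z ^ ab.1 * (starRingEnd ℂ z) ^ ab.2) with hp
  have hmono : ∀ a b : ℕ, ContDiff ℝ ∞ fun z : ℂ => c a b * (z ^ a * (starRingEnd ℂ z) ^ b) := by
    intro a b
    have h2 : ContDiff ℝ ∞ fun z : ℂ => starRingEnd ℂ z := conjCLE.contDiff
    exact contDiff_const.mul ((contDiff_id.pow a).mul (h2.pow b))
  have hps : ∀ M, ContDiff ℝ ∞ (p M) := fun M => ContDiff.sum fun ab _ => hmono _ _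
  have hom : ∀ M, ∀ t : ℝ, 0 < t → ∀ z, p M (t • z) = (t : ℂ) ^ M * p M z := by
    intro M t _ z
    simp only [hp]
    rw [Finset.mul_sum]
    refine Finset.sum_congr rfl fun ab hab => ?_
    rw [← Finset.HasAntidiagonal.mem_antidiagonal.1 hab, real_smul, map_mul, conj_ofReal,
      mul_pow, mul_pow, pow_add]
    ring
  obtain ⟨φ, hφ⟩ := exists_schwartz_taylor p hps hom
  have hpk : ∀ k M (x : ℝ), polarCoeff k (p M) x = d k (-(M : ℂ)) * (x : ℂ) ^ M := by
    intro k M x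
    simp only [hp]
    rw [polarCoeff_sum _ _ fun ab _ => (hmono _ _).continuous]
    simp only [polarCoeff_monomial]
    have hpi : (4 * Real.pi : ℂ) ≠ 0 := by simp [Real.pi_ne_zero]
    have e : ∀ ab ∈ Finset.HasAntidiagonal.antidiagonal M, (if k = (ab.2 : ℤ) - ab.1 then
        4 * Real.pi * c ab.1 ab.2 * (x : ℂ) ^ (ab.1 + ab.2) else 0)
        = if k = (ab.2 : ℤ) - ab.1 then d k (-(M : ℂ)) * (x : ℂ) ^ M else 0 := fun ab hab => by
      have h1 := Finset.HasAntidiagonal.mem_antidiagonal.1 hab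
      split_ifs with h2
      · simp only [hc]
        rw [h1, ← h2]
        field_simp
      · rfl
    rw [Finset.sum_congr rfl e]
    by_cases h0 : d k (-(M : ℂ)) = 0
    · simp [h0]
    · obtain ⟨a, b, h1, h2⟩ := hd _ _ h0
      have h3 : a + b = M := by
        have := neg_injective h1
        exact_mod_cast this.symm
      rw [Finset.sum_eq_single (a, b)]
      · simp [h2]
      · rintro ⟨a', b'⟩ h4 h5
        have h4' := Finset.HasAntidiagonal.mem_antidiagonal.1 h4
        simp only at h4' ⊢
        rw [if_neg]
        intro h6
        apply h5
        rw [Prod.mk.injEq]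
        omega
      · intro h4
        exact absurd (Finset.HasAntidiagonal.mem_antidiagonal.2 h3) h4
  refine ⟨φ, fun k s₀ => ?_⟩
  obtain ⟨N, hN⟩ := exists_re_add_nat_pos s₀
  obtain ⟨δ, C, hδ, hC⟩ := hφ N
  -- Subtracting the Taylor polynomial on `(0, 1]` leaves a function of order `x ^ N` at the origin.
  set q : ℝ → ℂ := fun x => ∑ M ∈ Finset.range (N + 1),
    d k (-(M : ℂ)) • indicator (Ioc 0 1) (fun t : ℝ => (t : ℂ) ^ (M : ℂ)) x with hq
  set h : ℝ → ℂ := fun x => polarCoeff k φ x - q x with hh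
  have hU : IsOpen {w : ℂ | 0 < w.re + N} := isOpen_lt continuous_const (by fun_prop)
  have hq_mellin : ∀ s : ℂ, 0 < s.re →
      HasMellin q s (∑ M ∈ Finset.range (N + 1), d k (-(M : ℂ)) / (s + M)) := by
    intro s hs
    have h1 := hasMellin_finset_sum (Finset.range (N + 1)) (s := s)
      (f := fun M x => d k (-(M : ℂ)) • indicator (Ioc 0 1) (fun t : ℝ => (t : ℂ) ^ (M : ℂ)) x)
      (H := fun M => d k (-(M : ℂ)) / (s + M)) fun M _ => by
        have h2 := hasMellin_cpow_Ioc (M : ℂ) (s := s) (by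
          rw [natCast_re]
          positivity)
        have h3 := hasMellin_const_smul h2.1 (d k (-(M : ℂ)))
        rw [h2.2, smul_eq_mul, mul_one_div] at h3
        exact h3
    exact h1
  have hloc : LocallyIntegrableOn h (Ioi 0) := by
    refine (locallyIntegrableOn_polarCoeff k φ).sub ?_
    refine LocallyIntegrable.locallyIntegrableOn (Integrable.locallyIntegrable ?_) _
    refine integrable_finsetSum _ fun M _ => Integrable.fun_smul _ ?_
    rw [integrable_indicator_iff measurableSet_Ioc]
    simp only [cpow_natCast]
    exact (Continuous.integrableOn_Icc (by fun_prop)).mono_set Ioc_subset_Icc_self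
  have htop : ∀ a : ℝ, h =O[atTop] fun x : ℝ => x ^ (-a) := fun a => by
    refine (polarCoeff_isBigO_atTop k φ a).congr' ?_ EventuallyEq.rfl
    filter_upwards [eventually_gt_atTop 1] with x hx
    have : q x = 0 := Finset.sum_eq_zero fun M _ => by
      rw [indicator_of_notMem (fun h' => absurd h'.2 (not_le.2 hx)), smul_zero]
    simp [hh, this]
  have hbot : h =O[𝓝[>] 0] fun x : ℝ => x ^ (-(-(N : ℝ))) := by
    refine Asymptotics.IsBigO.of_bound (4 * Real.pi * C) ?_
    filter_upwards [Ioo_mem_nhdsGT (lt_min one_pos hδ)] with x hx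
    have hx1 : x ≤ 1 := hx.2.le.trans (min_le_left _ _)
    have hxδ : x ≤ δ := hx.2.le.trans (min_le_right _ _)
    have e : h x = polarCoeff k (fun z => φ z - ∑ M ∈ Finset.range (N + 1), p M z) x := by
      rw [polarCoeff_sub k φ.continuous (continuous_finsetSum _ fun M _ => (hps M).continuous),
        polarCoeff_sum _ _ fun M _ => (hps M).continuous]
      simp only [hh, hq, hpk]
      congr 1
      refine Finset.sum_congr rfl fun M _ => ?_
      rw [indicator_of_mem (show x ∈ Ioc (0 : ℝ) 1 from ⟨hx.1, hx1⟩), cpow_natCast, smul_eq_mul]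
    rw [e, neg_neg, Real.rpow_natCast, norm_pow, Real.norm_of_nonneg hx.1.le, mul_assoc]
    refine norm_polarCoeff_le k fun z hz => ?_
    rw [abs_of_pos hx.1] at hz
    rw [← hz]
    exact hC z (norm_pos_iff.1 (hz ▸ hx.1)) (hz ▸ hxδ)
  have hdiff : ∀ w : ℂ, 0 < w.re + N → DifferentiableAt ℂ (mellin h) w := fun w hw =>
    mellin_differentiableAt_of_isBigO_rpow hloc (htop (w.re + 1)) (by linarith) hbot (by linarith)
  have han : ∀ w : ℂ, 0 < w.re + N → AnalyticAt ℂ (mellin h) w := fun w hw =>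
    DifferentiableOn.analyticAt (s := {w : ℂ | 0 < w.re + N})
      (fun v hv => (hdiff v hv).differentiableWithinAt) (hU.mem_nhds hw)
  have hmer : ∀ w : ℂ, MeromorphicAt
      (fun s => ∑ M ∈ Finset.range (N + 1), d k (-(M : ℂ)) / (s + M)) w := fun w =>
    MeromorphicAt.fun_sum fun M _ => by fun_prop
  have hEq : ∀ w : ℂ, 0 < w.re →
      mellinExt k φ w = mellin h w + ∑ M ∈ Finset.range (N + 1), d k (-(M : ℂ)) / (w + M) := by
    intro w hw
    rw [mellinExt_eq_mellin k φ hw]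
    have h1 := hasMellin_sub (mellinConvergent_polarCoeff k φ hw) (hq_mellin w hw).1
    rw [(hq_mellin w hw).2] at h1
    have h2 : mellin h w = _ := h1.2
    rw [h2, sub_add_cancel]
  have hEv : mellinExt k φ =ᶠ[𝓝[≠] s₀]
      fun w => mellin h w + ∑ M ∈ Finset.range (N + 1), d k (-(M : ℂ)) / (w + M) := by
    have hconv : IsPreconnected {w : ℂ | 0 < w.re + N} := by
      have : {w : ℂ | 0 < w.re + N} = {w : ℂ | -(N : ℝ) < w.re} := by
        ext w
        simp only [mem_ofPred_eq]
        constructor <;> intro <;> linarith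
      rw [this]
      exact (convex_halfSpace_re_gt _).isPreconnected
    refine eventuallyEq_nhdsNE_of_meromorphicOn hconv (fun w _ => meromorphic_mellinExt k φ w)
      (fun w hw => (han w hw).meromorphicAt.add (hmer w)) (x := 1) (y := s₀) ?_ hN ?_
    · simp only [mem_ofPred_eq, one_re]
      positivity
    · refine Filter.Eventually.filter_mono nhdsWithin_le_nhds ?_
      have : IsOpen {w : ℂ | 0 < w.re} := isOpen_lt continuous_const continuous_re
      filter_upwards [this.mem_nhds (show (0 : ℝ) < (1 : ℂ).re by simp)] with w hw using hEq w hw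
  -- Only the term with `-M = s₀` is singular at `s₀`.
  refine ⟨fun w => mellin h w + ∑ M ∈ Finset.range (N + 1),
    (if s₀ = -(M : ℂ) then 0 else d k (-(M : ℂ)) / (w + M)), ?_, ?_⟩
  · refine (han s₀ hN).add (Finset.analyticAt_fun_sum _ fun M _ => ?_)
    split_ifs with hM
    · exact analyticAt_const
    · refine AnalyticAt.div analyticAt_const (by fun_prop) fun h0 =>
        hM (eq_neg_of_add_eq_zero_left h0)
  · filter_upwards [hEv] with w hw
    rw [hw]
    have key : d k s₀ / (w - s₀) = ∑ M ∈ Finset.range (N + 1),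
        (if s₀ = -(M : ℂ) then d k (-(M : ℂ)) / (w + M) else 0) := by
      by_cases h0 : ∃ M : ℕ, s₀ = -(M : ℂ)
      · obtain ⟨M, rfl⟩ := h0
        have hMN : M < N := by
          have : (M : ℝ) < N := by simpa using hN
          exact_mod_cast this
        rw [Finset.sum_eq_single M]
        · simp
        · intro b _ hb
          rw [if_neg]
          intro h1
          exact hb (by exact_mod_cast (neg_injective h1).symm)
        · intro h1
          exact absurd (Finset.mem_range.2 (by omega)) h1
      · have hd0 : d k s₀ = 0 := by
          by_contra h1
          obtain ⟨a, b, h2, -⟩ := hd _ _ h1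
          exact h0 ⟨a + b, h2⟩
        rw [hd0, zero_div, Finset.sum_eq_zero]
        intro M _
        rw [if_neg fun h1 => h0 ⟨M, h1⟩]
    rw [key, add_left_comm, ← Finset.sum_add_distrib]
    congr 1
    refine Finset.sum_congr rfl fun M _ => ?_
    split_ifs <;> simp

/-! ### Mellin transforms of functions on the punctured plane -/

/-- The extension by zero to `ℂ` of a function on `ℂˣ`. -/
noncomputable def zeroExtend (υ : ℂˣ → ℂ) : ℂ → ℂ := Function.extend (Units.val : ℂˣ → ℂ) υ 0

theorem zeroExtend_coe (υ : ℂˣ → ℂ) (u : ℂˣ) : zeroExtend υ u = υ u :=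
  Units.val_injective.extend_apply υ 0 u

theorem zeroExtend_zero (υ : ℂˣ → ℂ) : zeroExtend υ 0 = 0 :=
  Function.extend_apply' _ _ _ fun ⟨u, hu⟩ => u.ne_zero hu

theorem zeroExtend_add (υ w : ℂˣ → ℂ) (z : ℂ) :
    zeroExtend (υ + w) z = zeroExtend υ z + zeroExtend w z := by
  by_cases hz : z = 0
  · simp [hz, zeroExtend_zero]
  · obtain ⟨u, rfl⟩ : ∃ u : ℂˣ, (u : ℂ) = z := ⟨Units.mk0 z hz, rfl⟩
    simp [zeroExtend_coe]

theorem zeroExtend_smul (c : ℂ) (υ : ℂˣ → ℂ) (z : ℂ) :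
    zeroExtend (c • υ) z = c * zeroExtend υ z := by
  by_cases hz : z = 0
  · simp [hz, zeroExtend_zero]
  · obtain ⟨u, rfl⟩ : ∃ u : ℂˣ, (u : ℂ) = z := ⟨Units.mk0 z hz, rfl⟩
    simp [zeroExtend_coe]

theorem continuousAt_zeroExtend {υ : ℂˣ → ℂ} (hυ : Continuous υ) {z : ℂ} (hz : z ≠ 0) :
    ContinuousAt (zeroExtend υ) z := by
  obtain ⟨u, rfl⟩ : ∃ u : ℂˣ, (u : ℂ) = z := ⟨Units.mk0 z hz, rfl⟩
  rw [← Units.isOpenEmbedding_val.continuousAt_iff]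
  have : zeroExtend υ ∘ Units.val = υ := funext fun u => zeroExtend_coe υ u
  rw [this]
  exact hυ.continuousAt

theorem continuous_zeroExtend_comp {X : Type*} [TopologicalSpace X] {υ : ℂˣ → ℂ}
    (hυ : Continuous υ) {f : X → ℂ} (hf : Continuous f) (h0 : ∀ x, f x ≠ 0) :
    Continuous fun x => zeroExtend υ (f x) :=
  continuous_iff_continuousAt.2 fun x =>
    ContinuousAt.comp (g := zeroExtend υ) (continuousAt_zeroExtend hυ (h0 x)) hf.continuousAt

theorem ofReal_mul_exp_ne_zero {x : ℝ} (hx : 0 < x) (w : ℂ) : (x : ℂ) * exp w ≠ 0 :=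
  mul_ne_zero (ofReal_ne_zero.2 hx.ne') (exp_ne_zero _)

theorem four_pi_mul_fourierCoeffC (υ : ℂˣ → ℂ) (k : ℤ) :
    (fun x : ℝ => 4 * (Real.pi : ℂ) * fourierCoeffC υ (-k) x) = polarCoeff k (zeroExtend υ) := by
  funext x
  have hpi : (Real.pi : ℂ) ≠ 0 := ofReal_ne_zero.2 Real.pi_ne_zero
  have e : ∀ θ : ℝ, -(I * ((-k : ℤ) : ℂ) * (θ : ℂ)) = I * k * θ := fun θ => by push_cast; ring
  simp only [fourierCoeffC, polarCoeff, e, zeroExtend]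
  rw [← mul_assoc]
  congr 1
  field_simp
  norm_num

theorem polarCoeff_zeroExtend_add {υ w : ℂˣ → ℂ} (hυ : Continuous υ) (hw : Continuous w) (k : ℤ)
    {x : ℝ} (hx : 0 < x) : polarCoeff k (zeroExtend (υ + w)) x
      = polarCoeff k (zeroExtend υ) x + polarCoeff k (zeroExtend w) x := by
  have hc : ∀ {υ : ℂˣ → ℂ}, Continuous υ →
      Continuous fun θ : ℝ => zeroExtend υ (x * exp (I * θ)) := fun h =>
    continuous_zeroExtend_comp h (by fun_prop) fun θ => ofReal_mul_exp_ne_zero hx _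
  have h1 := hc hυ
  have h2 := hc hw
  unfold polarCoeff
  simp only [zeroExtend_add, add_mul]
  rw [intervalIntegral.integral_add (Continuous.intervalIntegrable (by fun_prop) _ _)
    (Continuous.intervalIntegrable (by fun_prop) _ _), mul_add]

theorem polarCoeff_zeroExtend_smul (c : ℂ) (υ : ℂˣ → ℂ) (k : ℤ) (x : ℝ) :
    polarCoeff k (zeroExtend (c • υ)) x = c * polarCoeff k (zeroExtend υ) x := by
  unfold polarCoeff
  simp only [zeroExtend_smul, mul_assoc]
  rw [intervalIntegral.integral_const_mul]
  ring

theorem continuousAt_polarCoeff_zeroExtend {υ : ℂˣ → ℂ} (hυ : Continuous υ) (k : ℤ) {x : ℝ}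
    (hx : 0 < x) : ContinuousAt (polarCoeff k (zeroExtend υ)) x := by
  have h1 : Continuous fun u : ℝ => polarCoeff k (zeroExtend υ) (Real.exp u) := by
    refine continuous_const.mul ?_
    apply intervalIntegral.continuous_parametric_intervalIntegral_of_continuous'
    have : Continuous fun p : ℝ × ℝ =>
        zeroExtend υ ((Real.exp p.1 : ℝ) * exp (I * (p.2 : ℂ))) :=
      continuous_zeroExtend_comp hυ (by fun_prop) fun p => ofReal_mul_exp_ne_zero (Real.exp_pos _) _
    exact this.mul (by fun_prop)
  have h2 : ContinuousAt (fun y => polarCoeff k (zeroExtend υ) (Real.exp (Real.log y))) x :=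
    ContinuousAt.comp (f := Real.log) (g := fun u => polarCoeff k (zeroExtend υ) (Real.exp u))
      h1.continuousAt (Real.continuousAt_log hx.ne')
  refine h2.congr ?_
  filter_upwards [lt_mem_nhds hx] with y hy
  rw [Real.exp_log hy]

theorem hasMellin_congr_Ioi {f g : ℝ → ℂ} (h : ∀ x, 0 < x → f x = g x) {s H : ℂ}
    (hf : HasMellin f s H) : HasMellin g s H := by
  have e : EqOn (fun t : ℝ => (t : ℂ) ^ (s - 1) • f t) (fun t : ℝ => (t : ℂ) ^ (s - 1) • g t)
      (Ioi 0) := fun t ht => by simp only [h t ht]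
  refine ⟨hf.1.congr_fun e measurableSet_Ioi, ?_⟩
  rw [← hf.2]
  exact (setIntegral_congr_fun measurableSet_Ioi e).symm

theorem hasMellin_cpow_neg_mul {f : ℝ → ℂ} {s a H : ℂ} (h : HasMellin f (s - a) H) :
    HasMellin (fun x : ℝ => (x : ℂ) ^ (-a) * f x) s H := by
  rw [sub_eq_add_neg] at h
  exact ⟨(MellinConvergent.cpow_smul (f := f) (s := s) (a := -a)).2 h.1,
    (mellin_cpow_smul f s (-a)).trans h.2⟩

/-- The family `M k`, `k ∈ ℤ`, consists of meromorphic functions of rapid decay that are, on right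
half-planes, the Mellin transforms of the continuous function `υ` on `ℂˣ`. -/
structure MellinData (υ : ℂˣ → ℂ) (M : ℤ → ℂ → ℂ) : Prop where
  continuous : Continuous υ
  meromorphic : ∀ k, Meromorphic (M k)
  decay : RapidDecay M
  hasMellin : ∀ k, ∃ σ : ℝ, ∀ s : ℂ, σ < s.re →
    HasMellin (polarCoeff k (zeroExtend υ)) s (M k s) ∧ DifferentiableAt ℂ (M k) s

theorem MellinData.isMellinC {υ : ℂˣ → ℂ} {M : ℤ → ℂ → ℂ} (h : MellinData υ M) (k : ℤ) :
    IsMellinC k υ (M k) := by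
  obtain ⟨σ, hσ⟩ := h.hasMellin k
  refine ⟨h.meromorphic k, σ, fun s hs => ?_⟩
  rw [four_pi_mul_fourierCoeffC]
  exact (hσ s hs).1

theorem MellinData.add {υ w : ℂˣ → ℂ} {M L : ℤ → ℂ → ℂ} (h : MellinData υ M)
    (h' : MellinData w L) : MellinData (υ + w) (fun k s => M k s + L k s) where
  continuous := h.continuous.add h'.continuous
  meromorphic k := fun s => (h.meromorphic k s).add (h'.meromorphic k s)
  decay := h.decay.add h'.decay
  hasMellin k := by
    obtain ⟨σ, hσ⟩ := h.hasMellin k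
    obtain ⟨σ', hσ'⟩ := h'.hasMellin k
    refine ⟨max σ σ', fun s hs => ?_⟩
    obtain ⟨h1, h2⟩ := hσ s ((le_max_left _ _).trans_lt hs)
    obtain ⟨h3, h4⟩ := hσ' s ((le_max_right _ _).trans_lt hs)
    refine ⟨?_, h2.add h4⟩
    have := hasMellin_add h1.1 h3.1
    rw [h1.2, h3.2] at this
    exact hasMellin_congr_Ioi
      (fun x hx => (polarCoeff_zeroExtend_add h.continuous h'.continuous k hx).symm) this

theorem MellinData.smul {υ : ℂˣ → ℂ} {M : ℤ → ℂ → ℂ} (h : MellinData υ M) (c : ℂ) :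
    MellinData (c • υ) (fun k s => c * M k s) where
  continuous := h.continuous.const_smul c
  meromorphic k := fun s => (MeromorphicAt.const c s).mul (h.meromorphic k s)
  decay := h.decay.const_mul c
  hasMellin k := by
    obtain ⟨σ, hσ⟩ := h.hasMellin k
    refine ⟨σ, fun s hs => ?_⟩
    obtain ⟨h1, h2⟩ := hσ s hs
    refine ⟨?_, h2.const_mul c⟩
    have := hasMellin_const_smul h1.1 c
    rw [h1.2] at this
    exact hasMellin_congr_Ioi (fun x _ => (polarCoeff_zeroExtend_smul c υ k x).symm) this

theorem MellinData.zero : MellinData 0 0 where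
  continuous := continuous_const
  meromorphic _ := fun s => MeromorphicAt.const 0 s
  decay := RapidDecay.zero
  hasMellin k := by
    refine ⟨0, fun s _ => ⟨?_, differentiableAt_const 0⟩⟩
    have h0 : polarCoeff k (zeroExtend 0) = fun _ => 0 := by
      funext x
      have := polarCoeff_zeroExtend_smul 0 0 k x
      rwa [zero_smul, zero_mul] at this
    rw [h0]
    simp [HasMellin, MellinConvergent, mellin]

theorem MellinData.sum {ι : Type*} (S : Finset ι) {υ : ι → ℂˣ → ℂ} {M : ι → ℤ → ℂ → ℂ}
    (h : ∀ i ∈ S, MellinData (υ i) (M i)) :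
    MellinData (∑ i ∈ S, υ i) (fun k s => ∑ i ∈ S, M i k s) := by
  classical
  induction S using Finset.induction_on with
  | empty => simpa using! MellinData.zero
  | insert a S ha ih =>
    simp only [Finset.sum_insert ha]
    exact (h a (Finset.mem_insert_self _ _)).add (ih fun i hi => h i (Finset.mem_insert_of_mem hi))

theorem polarCoeff_zeroExtend_sisMap (p : ℂ × ℤ) (j : ℕ) (φ : 𝓢(ℂ, ℂ)) (k : ℤ) {x : ℝ}
    (hx : 0 < x) : polarCoeff k (zeroExtend (sisMap p j φ)) x
      = (x : ℂ) ^ (-p.1) * ((Real.log x : ℂ) ^ j * polarCoeff (k - p.2) φ x) := by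
  have e : ∀ θ : ℝ, zeroExtend (sisMap p j φ) (x * exp (I * θ)) * exp (I * k * θ)
      = ((x : ℂ) ^ (-p.1) * (Real.log x : ℂ) ^ j) *
        (φ (x * exp (I * θ)) * exp (I * ((k - p.2 : ℤ) : ℂ) * θ)) := fun θ => by
    have h0 := ofReal_mul_exp_ne_zero hx (I * θ)
    have h1 : zeroExtend (sisMap p j φ) (x * exp (I * θ))
      = sisMap p j φ (Units.mk0 _ h0) := zeroExtend_coe _ (Units.mk0 _ h0)
    have hx0 : (x : ℂ) ≠ 0 := ofReal_ne_zero.2 hx.ne'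
    rw [h1]
    simp only [sisMap, LinearMap.coe_mk, AddHom.coe_mk, Units.val_mk0, norm_ofReal_mul_exp,
      abs_of_pos hx]
    rw [mul_div_cancel_left₀ _ hx0, ← exp_int_mul,
      show I * ((k - p.2 : ℤ) : ℂ) * θ = ((-p.2 : ℤ) : ℂ) * (I * θ) + I * k * θ by push_cast; ring,
      exp_add]
    ring
  unfold polarCoeff
  simp only [e]
  rw [intervalIntegral.integral_const_mul]
  ring

theorem continuous_sisMap (p : ℂ × ℤ) (j : ℕ) (φ : 𝓢(ℂ, ℂ)) : Continuous (sisMap p j φ) := by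
  have hv : Continuous (Units.val : ℂˣ → ℂ) := Units.continuous_val
  have hn : Continuous fun z : ℂˣ => (‖(z : ℂ)‖ : ℂ) := continuous_ofReal.comp hv.norm
  have hn0 : ∀ z : ℂˣ, (‖(z : ℂ)‖ : ℂ) ≠ 0 := fun z => by simp
  have h1 : Continuous fun z : ℂˣ => ((z : ℂ) / (‖(z : ℂ)‖ : ℂ)) ^ (-p.2) :=
    (hv.div hn hn0).zpow₀ _ fun z => Or.inl (div_ne_zero z.ne_zero (hn0 z))
  have h2 : Continuous fun z : ℂˣ => (‖(z : ℂ)‖ : ℂ) ^ (-p.1) :=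
    hn.cpow continuous_const fun z => Or.inl (by
      rw [ofReal_re]
      exact norm_pos_iff.2 z.ne_zero)
  have h3 : Continuous fun z : ℂˣ => (Real.log ‖(z : ℂ)‖ : ℂ) :=
    continuous_ofReal.comp (hv.norm.log fun z => norm_ne_zero_iff.2 z.ne_zero)
  exact ((h1.mul h2).mul (h3.pow j)).mul (φ.continuous.comp hv)

theorem meromorphic_iteratedDeriv {f : ℂ → ℂ} (hf : Meromorphic f) (j : ℕ) :
    Meromorphic (iteratedDeriv j f) := by
  induction j with
  | zero => simpa using hf
  | succ j ih =>
    rw [iteratedDeriv_succ]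
    exact fun s => (ih s).deriv

/-- Multiplication by `[z]^(-m) |z|^(-λ) (log |z|)^j` shifts the order of the Mellin transforms by
`m` and their argument by `λ`, and differentiates them `j` times. -/
theorem mellinData_sisMap (p : ℂ × ℤ) (j : ℕ) (φ : 𝓢(ℂ, ℂ)) :
    MellinData (sisMap p j φ) (fun k s => iteratedDeriv j (mellinExt (k - p.2) φ) (s - p.1)) where
  continuous := continuous_sisMap p j φ
  meromorphic k := by
    intro s
    have h1 := meromorphic_iteratedDeriv (meromorphic_mellinExt (k - p.2) φ) j (s - p.1)
    exact h1.comp_analyticAt (f := iteratedDeriv j (mellinExt (k - p.2) φ)) (g := fun s => s - p.1)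
      (by fun_prop)
  decay := (rapidDecay_iteratedDeriv_mellinExt j φ).shift p.2 p.1
  hasMellin k := by
    refine ⟨p.1.re, fun s hs => ?_⟩
    have hs' : 0 < (s - p.1).re := by
      rw [sub_re]
      linarith
    constructor
    · have h1 := hasMellin_log_pow_polarCoeff j (k - p.2) φ hs'
      refine hasMellin_congr_Ioi (fun x hx => (polarCoeff_zeroExtend_sisMap p j φ k hx).symm) ?_
      exact hasMellin_cpow_neg_mul h1
    · have h1 := holomorphicOffHalfLine_iteratedDeriv_mellinExt j φ (k - p.2) (s - p.1)
        (Or.inr (by have := abs_nonneg (((k - p.2 : ℤ)) : ℝ); linarith))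
      exact DifferentiableAt.comp s (g := iteratedDeriv j (mellinExt (k - p.2) φ))
        (f := fun s => s - p.1) h1 (by fun_prop)

/-- Two Mellin transforms of the same function agree as meromorphic functions. -/
theorem isMellinC_unique {k : ℤ} {υ : ℂˣ → ℂ} {H K : ℂ → ℂ} (hH : IsMellinC k υ H)
    (hK : IsMellinC k υ K) (s : ℂ) : H =ᶠ[𝓝[≠] s] K := by
  obtain ⟨hm, σ, hσ⟩ := hH
  obtain ⟨hm', σ', hσ'⟩ := hK
  refine eventuallyEq_nhdsNE_of_meromorphicOn isPreconnected_univ (fun w _ => hm w)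
    (fun w _ => hm' w) (mem_univ ((max σ σ' + 1 : ℝ) : ℂ)) (mem_univ s) ?_
  refine Filter.Eventually.filter_mono nhdsWithin_le_nhds ?_
  have : IsOpen {w : ℂ | max σ σ' < w.re} := isOpen_lt continuous_const continuous_re
  filter_upwards [this.mem_nhds (show max σ σ' < ((max σ σ' + 1 : ℝ) : ℂ).re by
    rw [ofReal_re]; linarith)] with w hw
  exact (hσ w ((le_max_left _ _).trans_lt hw)).2.symm.trans
    (hσ' w ((le_max_right _ _).trans_lt hw)).2

/-! ### Principal parts -/

/-- One step of the Taylor expansion of an analytic function. -/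
theorem exists_analyticAt_eq_add_mul {h : ℂ → ℂ} {x : ℂ} (hh : AnalyticAt ℂ h x) :
    ∃ (d : ℂ) (g : ℂ → ℂ), AnalyticAt ℂ g x ∧ ∀ s, h s = d + (s - x) * g s := by
  obtain ⟨p, hp⟩ := hh
  refine ⟨h x, dslope h x, ⟨_, hp.has_fpower_series_dslope_fslope⟩, fun s => ?_⟩
  rw [← smul_eq_mul, sub_smul_dslope]
  ring

theorem exists_principalPart_of_analyticAt (N : ℕ) {h : ℂ → ℂ} {x : ℂ} (hh : AnalyticAt ℂ h x) :
    ∃ (c : ℕ → ℂ) (g : ℂ → ℂ), AnalyticAt ℂ g x ∧ ∀ s, s ≠ x →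
      ((s - x) ^ N)⁻¹ * h s = ∑ j ∈ Finset.range N, c j * ((s - x) ^ (j + 1))⁻¹ + g s := by
  induction N generalizing h with
  | zero => exact ⟨0, h, hh, fun s _ => by simp⟩
  | succ N ih =>
    obtain ⟨d, h₁, hh₁, e⟩ := exists_analyticAt_eq_add_mul hh
    obtain ⟨c, g, hg, hc⟩ := ih hh₁
    refine ⟨Function.update c N d, g, hg, fun s hs => ?_⟩
    have hs' : s - x ≠ 0 := sub_ne_zero.2 hs
    have e2 : ∑ j ∈ Finset.range N, Function.update c N d j * ((s - x) ^ (j + 1))⁻¹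
        = ∑ j ∈ Finset.range N, c j * ((s - x) ^ (j + 1))⁻¹ :=
      Finset.sum_congr rfl fun j hj => by
        rw [Function.update_of_ne (Finset.mem_range.1 hj).ne]
    rw [Finset.sum_range_succ, Function.update_self, e2, e s, add_right_comm, ← hc s hs]
    field_simp
    ring

/-- A meromorphic function with a pole of order at most `N` is the sum of its principal part and an
analytic function. -/
theorem exists_principalPart {f : ℂ → ℂ} {x : ℂ} (N : ℕ) (hf : MeromorphicAt f x)
    (ho : ((-(N : ℤ) : ℤ) : WithTop ℤ) ≤ meromorphicOrderAt f x) :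
    ∃ (c : ℕ → ℂ) (g : ℂ → ℂ), AnalyticAt ℂ g x ∧
      f =ᶠ[𝓝[≠] x] fun s => ∑ j ∈ Finset.range N, c j * ((s - x) ^ (j + 1))⁻¹ + g s := by
  have hp : MeromorphicAt ((· - x) ^ N : ℂ → ℂ) x := by fun_prop
  have h1 : 0 ≤ meromorphicOrderAt (((· - x) ^ N : ℂ → ℂ) * f) x := by
    rw [meromorphicOrderAt_mul hp hf, meromorphicOrderAt_pow_id_sub_const]
    have : (0 : WithTop ℤ) = ((N : ℤ) : WithTop ℤ) + ((-(N : ℤ) : ℤ) : WithTop ℤ) := by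
      rw [← WithTop.coe_add, add_neg_cancel, WithTop.coe_zero]
    rw [this]
    exact add_le_add le_rfl ho
  obtain ⟨h, hh, e⟩ := (hp.mul hf).meromorphicOrderAt_nonneg_iff.1 h1
  obtain ⟨c, g, hg, hc⟩ := exists_principalPart_of_analyticAt N hh
  refine ⟨c, g, hg, ?_⟩
  filter_upwards [e, self_mem_nhdsWithin] with s hs hsx
  have hs' : s - x ≠ 0 := sub_ne_zero.2 hsx
  rw [← hc s hsx, ← hs, Pi.mul_apply, Pi.pow_apply]
  field_simp

theorem meromorphicOrderAt_ge_of_eventuallyEq {f g : ℂ → ℂ} {x c : ℂ} {N : ℕ}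
    (hf : MeromorphicAt f x) (hg : AnalyticAt ℂ g x)
    (e : f =ᶠ[𝓝[≠] x] fun s => c * ((s - x) ^ N)⁻¹ + g s) :
    ((-(N : ℤ) : ℤ) : WithTop ℤ) ≤ meromorphicOrderAt f x := by
  have hp : MeromorphicAt ((· - x) ^ N : ℂ → ℂ) x := by fun_prop
  have h1 : 0 ≤ meromorphicOrderAt (((· - x) ^ N : ℂ → ℂ) * f) x := by
    refine (hp.mul hf).meromorphicOrderAt_nonneg_iff.2
      ⟨fun s => c + (s - x) ^ N * g s, by fun_prop, ?_⟩
    filter_upwards [e, self_mem_nhdsWithin] with s hs hsx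
    have hs' : s - x ≠ 0 := sub_ne_zero.2 hsx
    rw [Pi.mul_apply, Pi.pow_apply, hs]
    field_simp
  rw [meromorphicOrderAt_mul hp hf, meromorphicOrderAt_pow_id_sub_const] at h1
  rcases hx : meromorphicOrderAt f x with _ | y
  · exact le_top
  · rw [hx] at h1
    have h2 : (0 : ℤ) ≤ N + y := WithTop.coe_le_coe.1 h1
    exact WithTop.coe_le_coe.2 (by omega)

theorem eventuallyEq_nhdsNE_deriv {f g : ℂ → ℂ} {x : ℂ} (h : f =ᶠ[𝓝[≠] x] g) :
    deriv f =ᶠ[𝓝[≠] x] deriv g := by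
  rw [EventuallyEq, ← eventually_eventually_nhdsWithin] at h
  filter_upwards [h, self_mem_nhdsWithin] with s hs hsx
  rw [isOpen_compl_singleton.nhdsWithin_eq hsx] at hs
  exact EventuallyEq.deriv_eq hs

/-- Differentiation of a simple pole. -/
theorem iteratedDeriv_eventuallyEq_of_simple_pole {f g : ℂ → ℂ} {x d : ℂ} (hg : AnalyticAt ℂ g x)
    (h : f =ᶠ[𝓝[≠] x] fun s => d / (s - x) + g s) (j : ℕ) :
    iteratedDeriv j f =ᶠ[𝓝[≠] x] fun s =>
      (-1) ^ j * j.factorial * d * ((s - x) ^ (j + 1))⁻¹ + iteratedDeriv j g s := by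
  induction j with
  | zero =>
    filter_upwards [h] with s hs
    simp [hs, div_eq_mul_inv]
  | succ j ih =>
    rw [iteratedDeriv_succ, iteratedDeriv_succ]
    refine (eventuallyEq_nhdsNE_deriv ih).trans ?_
    have hgj : AnalyticAt ℂ (iteratedDeriv j g) x := by
      rw [iteratedDeriv_eq_iterate]
      exact hg.iterated_deriv j
    filter_upwards [self_mem_nhdsWithin,
      hgj.eventually_analyticAt.filter_mono nhdsWithin_le_nhds] with s hsx hgs
    have hs' : s - x ≠ 0 := sub_ne_zero.2 hsx
    have h1 : HasDerivAt (fun s => (s - x) ^ (j + 1)) ((j + 1 : ℕ) * (s - x) ^ j * 1) s :=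
      ((hasDerivAt_id s).sub_const x).fun_pow (j + 1)
    have h2 := ((h1.inv (pow_ne_zero _ hs')).const_mul
      ((-1) ^ j * j.factorial * d : ℂ)).add hgs.differentiableAt.hasDerivAt
    have h3 := h2.deriv
    simp only [Pi.add_def] at h3
    refine h3.trans ?_
    congr 1
    rw [Nat.factorial_succ, pow_succ (-1 : ℂ)]
    push_cast
    field_simp
    ring

/-- The Mellin transform of the `k`-th polar coefficient of a Schwartz function has at most simple
poles, at the points `-(|k| + 2 i)`. -/
theorem mellinExt_simple_pole (k : ℤ) (φ : 𝓢(ℂ, ℂ)) (s₀ : ℂ) :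
    ∃ (d : ℂ) (g : ℂ → ℂ), AnalyticAt ℂ g s₀ ∧
      mellinExt k φ =ᶠ[𝓝[≠] s₀] (fun s => d / (s - s₀) + g s) ∧
      (d ≠ 0 → ∃ i : ℕ, s₀ + k.natAbs + 2 * i = 0) := by
  obtain ⟨N, hN⟩ := exists_re_add_nat_pos s₀
  have hU : IsOpen {w : ℂ | 0 < w.re + N} := isOpen_lt continuous_const (by fun_prop)
  have han : AnalyticAt ℂ (fun s => mellin (polarCoeff (signedShift k N)
      (signedWirtinger k N φ)) (s + N)) s₀ := by
    refine DifferentiableOn.analyticAt (s := {w : ℂ | 0 < w.re + N}) (fun w hw => ?_)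
      (hU.mem_nhds hN)
    exact (differentiableAt_mellin_shift _ _ hw).differentiableWithinAt
  have hev : mellinExt k φ =ᶠ[𝓝[≠] s₀] mellinExtAux N k φ :=
    (mellinExt_eventuallyEq k φ hN).filter_mono nhdsWithin_le_nhds
  have hprod : ∀ S : Finset ℕ, (∀ i ∈ S, s₀ + k.natAbs + 2 * i ≠ 0) →
      AnalyticAt ℂ (fun s : ℂ => (-2) ^ N / (∏ i ∈ S, (s + k.natAbs + 2 * i)) *
        mellin (polarCoeff (signedShift k N) (signedWirtinger k N φ)) (s + N)) s₀ := fun S hS => by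
    have h1 : AnalyticAt ℂ (fun s : ℂ => ∏ i ∈ S, (s + k.natAbs + 2 * i)) s₀ := by fun_prop
    exact (analyticAt_const.div h1 (Finset.prod_ne_zero_iff.2 hS)).mul han
  by_cases h : ∃ i ∈ Finset.range N, s₀ + k.natAbs + 2 * (i : ℂ) = 0
  · obtain ⟨i, hi, h0⟩ := h
    have h1 := hprod ((Finset.range N).erase i) fun i' hi' h0' => by
      apply Finset.ne_of_mem_erase hi'
      have : (2 * i' : ℂ) = 2 * i := by linear_combination h0' - h0
      exact_mod_cast mul_left_cancel₀ two_ne_zero this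
    obtain ⟨d, g, hg, e⟩ := exists_analyticAt_eq_add_mul h1
    refine ⟨d, g, hg, ?_, fun _ => ⟨i, h0⟩⟩
    filter_upwards [hev, self_mem_nhdsWithin] with s hs hsx
    have hs' : s - s₀ ≠ 0 := sub_ne_zero.2 hsx
    rw [div_add' _ _ _ hs', mul_comm (g s), ← e s, hs, mellinExtAux, ← Finset.mul_prod_erase _ _ hi,
      show s + k.natAbs + 2 * i = s - s₀ by linear_combination h0, ← div_div]
    ring
  · push Not at h
    refine ⟨0, _, hprod _ h, ?_, fun h0 => absurd rfl h0⟩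
    filter_upwards [hev] with s hs
    rw [hs, zero_div, zero_add, mellinExtAux]

theorem sisLE_iff_natAbs (p q : ℂ × ℤ) :
    SisLE p q ↔ ∃ i : ℕ, (p.1 - q.1) + (p.2 - q.2).natAbs + 2 * i = 0 := by
  have e : ((|q.2 - p.2| : ℤ) : ℂ) = ((p.2 - q.2).natAbs : ℂ) := by
    rw [abs_sub_comm, ← Int.natCast_natAbs, Int.cast_natCast]
  refine exists_congr fun i => ?_
  rw [e]
  constructor <;> intro h <;> linear_combination -h

theorem sisMult_mono {n : ℕ} (μ : Fin n → ℂ) (m : Fin n → ℤ) {p q : ℂ × ℤ} (h : SisLE p q) :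
    sisMult μ m q ≤ sisMult μ m p :=
  Nat.card_le_card_of_injective
    (fun l : {l : Fin n // SisLE q (2 * μ l, m l)} => (⟨l.1, h.trans l.2⟩ :
      {l : Fin n // SisLE p (2 * μ l, m l)}))
    fun _ _ hl => Subtype.ext (congrArg (fun x => x.1) hl)

/-- The meromorphic families that are to be characterised as Mellin transforms of functions in
`sisSpace μ m`: rapid decay, and poles of order at most `sisMult μ m (s, k)`. -/
structure SisData {n : ℕ} (μ : Fin n → ℂ) (m : Fin n → ℤ) (H : ℤ → ℂ → ℂ) : Prop where
  meromorphic : ∀ k, Meromorphic (H k)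
  order : ∀ k s, ((-(sisMult μ m (s, k) : ℤ) : ℤ) : WithTop ℤ) ≤ meromorphicOrderAt (H k) s
  decay : RapidDecay H

/-- The principal part of the Mellin transform of `sisMap p j φ`: a single term of order `j + 1`, as
the poles of `mellinExt` are simple. -/
theorem iteratedDeriv_mellinExt_principalPart (p : ℂ × ℤ) (j : ℕ) {φ : 𝓢(ℂ, ℂ)} {k : ℤ} {s₀ d : ℂ}
    {g : ℂ → ℂ} (hg : AnalyticAt ℂ g (s₀ - p.1))
    (h : mellinExt (k - p.2) φ =ᶠ[𝓝[≠] (s₀ - p.1)] fun s => d / (s - (s₀ - p.1)) + g s) :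
    ∃ g' : ℂ → ℂ, AnalyticAt ℂ g' s₀ ∧
      (fun s => iteratedDeriv j (mellinExt (k - p.2) φ) (s - p.1)) =ᶠ[𝓝[≠] s₀] fun s =>
        (-1) ^ j * j.factorial * d * ((s - s₀) ^ (j + 1))⁻¹ + g' s := by
  have hgj : AnalyticAt ℂ (iteratedDeriv j g) (s₀ - p.1) := by
    rw [iteratedDeriv_eq_iterate]
    exact hg.iterated_deriv j
  refine ⟨fun s => iteratedDeriv j g (s - p.1),
    AnalyticAt.fun_comp (g := iteratedDeriv j g) (f := fun s => s - p.1) hgj (by fun_prop), ?_⟩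
  have ht : Tendsto (fun s : ℂ => s - p.1) (𝓝[≠] s₀) (𝓝[≠] (s₀ - p.1)) := by
    refine tendsto_nhdsWithin_iff.2 ⟨?_, ?_⟩
    · exact ((continuous_id.sub continuous_const).tendsto s₀).mono_left nhdsWithin_le_nhds
    · filter_upwards [self_mem_nhdsWithin] with s hs h0
      exact hs (sub_left_injective h0)
  filter_upwards [ht.eventually (iteratedDeriv_eventuallyEq_of_simple_pole hg h j)] with s hs
  rw [hs, sub_sub_sub_cancel_right]

/-- The Mellin transforms of a function in `sisSpace μ m` satisfy the conditions in `SisData μ m`. -/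
theorem exists_mellinData_of_mem_sisSpace {n : ℕ} (μ : Fin n → ℂ) (m : Fin n → ℤ) {υ : ℂˣ → ℂ}
    (hυ : υ ∈ sisSpace μ m) : ∃ M, MellinData υ M ∧ SisData μ m M := by
  let V : Submodule ℂ (ℂˣ → ℂ) :=
    { carrier := {υ | ∃ M, MellinData υ M ∧ SisData μ m M}
      zero_mem' := ⟨0, MellinData.zero, MellinData.zero.meromorphic, fun k s => by
        have : meromorphicOrderAt ((0 : ℤ → ℂ → ℂ) k) s = ⊤ :=
          meromorphicOrderAt_eq_top_iff.2 (Eventually.of_forall fun _ => rfl)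
        rw [this]
        exact le_top, RapidDecay.zero⟩
      add_mem' := by
        rintro υ w ⟨M, hM, hM'⟩ ⟨L, hL, hL'⟩
        refine ⟨_, hM.add hL, (hM.add hL).meromorphic, fun k s => ?_, (hM.add hL).decay⟩
        exact (le_min (hM'.order k s) (hL'.order k s)).trans
          (meromorphicOrderAt_add (hM.meromorphic k s) (hL.meromorphic k s))
      smul_mem' := by
        rintro c υ ⟨M, hM, hM'⟩
        refine ⟨_, hM.smul c, (hM.smul c).meromorphic, fun k s => ?_, (hM.smul c).decay⟩
        have h1 := meromorphicOrderAt_mul (MeromorphicAt.const c s) (hM.meromorphic k s)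
        have h2 : 0 ≤ meromorphicOrderAt (fun _ : ℂ => c) s :=
          (analyticAt_const : AnalyticAt ℂ (fun _ : ℂ => c) s).meromorphicOrderAt_nonneg
        refine (hM'.order k s).trans ?_
        refine le_trans ?_ h1.symm.le
        exact le_add_of_nonneg_left h2 }
  suffices h : sisSpace μ m ≤ V from h hυ
  refine iSup_le fun p => iSup_le fun j => iSup_le fun hj => ?_
  rintro _ ⟨φ, rfl⟩
  have hM := mellinData_sisMap p j φ
  refine ⟨_, hM, hM.meromorphic, fun k s₀ => ?_, hM.decay⟩
  obtain ⟨d, g, hg, e, hd⟩ := mellinExt_simple_pole (k - p.2) φ (s₀ - p.1)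
  obtain ⟨g', hg', e'⟩ := iteratedDeriv_mellinExt_principalPart p j hg e
  by_cases h0 : d = 0
  · have h1 := meromorphicOrderAt_ge_of_eventuallyEq (N := 0) (c := 0) (hM.meromorphic k s₀) hg'
      (e'.trans (by simp [h0]))
    exact le_trans (WithTop.coe_le_coe.2 (by simp)) h1
  · have h1 := meromorphicOrderAt_ge_of_eventuallyEq (hM.meromorphic k s₀) hg' e'
    refine le_trans (WithTop.coe_le_coe.2 ?_) h1
    have h2 : SisLE (s₀, k) p := (sisLE_iff_natAbs _ _).2 (hd h0)
    have := sisMult_mono μ m h2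
    omega

/-! ### Lower bounds for the order `SisLE` -/

/-- In the coordinates `((λ + m) / 2, (λ - m) / 2)` on `ℂ × ℤ`, the relation `SisLE p q` says that
`q` arises from `p` by adding a pair of natural numbers. -/
theorem sisLE_iff_exists_add (p q : ℂ × ℤ) :
    SisLE p q ↔ ∃ a b : ℕ, q.1 = p.1 + (a + b : ℕ) ∧ q.2 = p.2 + (a - b) := by
  constructor
  · rintro ⟨i, hi⟩
    rcases le_total 0 (q.2 - p.2) with h | h
    · obtain ⟨d, hd⟩ := Int.eq_ofNat_of_zero_le h
      refine ⟨d + i, i, ?_, by push_cast; omega⟩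
      rw [hd, abs_of_nonneg (by positivity)] at hi
      push_cast at hi ⊢
      linear_combination hi
    · obtain ⟨d, hd⟩ := Int.exists_eq_neg_ofNat h
      refine ⟨i, d + i, ?_, by push_cast; omega⟩
      rw [hd, abs_neg, abs_of_nonneg (by positivity)] at hi
      push_cast at hi ⊢
      linear_combination hi
  · rintro ⟨a, b, h1, h2⟩
    obtain ⟨i, e⟩ : ∃ i : ℕ, ((a + b : ℕ) : ℤ) = |q.2 - p.2| + 2 * (i : ℤ) :=
      ⟨min a b, by rw [h2]; grind⟩
    refine ⟨i, ?_⟩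
    have e' := congrArg (Int.cast : ℤ → ℂ) e
    push_cast at e' h1 ⊢
    rw [h1]
    linear_combination e'

/-- A non-empty finite family that is bounded below has a greatest lower bound. -/
theorem exists_sisLE_glb {ι : Type*} (S : Finset ι) (hS : S.Nonempty) (f : ι → ℂ × ℤ) (p₀ : ℂ × ℤ)
    (h : ∀ i ∈ S, SisLE p₀ (f i)) :
    ∃ q, (∀ i ∈ S, SisLE q (f i)) ∧ ∀ p, (∀ i ∈ S, SisLE p (f i)) → SisLE p q := by
  have h' : ∀ i : S, ∃ a b : ℕ, (f i).1 = p₀.1 + (a + b : ℕ) ∧ (f i).2 = p₀.2 + (a - b) := fun i =>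
    (sisLE_iff_exists_add _ _).1 (h i i.2)
  choose a b h1 h2 using h'
  obtain ⟨i₀, hi₀⟩ := hS
  have hne : (Finset.univ : Finset S).Nonempty := ⟨⟨i₀, hi₀⟩, Finset.mem_univ _⟩
  obtain ⟨i, -, hi⟩ := Finset.exists_min_image Finset.univ a hne
  obtain ⟨l, -, hl⟩ := Finset.exists_min_image Finset.univ b hne
  refine ⟨(p₀.1 + (a i + b l : ℕ), p₀.2 + (a i - b l)), fun x hx => ?_, fun p hp => ?_⟩
  · have hia := hi ⟨x, hx⟩ (Finset.mem_univ _)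
    have hlb := hl ⟨x, hx⟩ (Finset.mem_univ _)
    refine (sisLE_iff_exists_add _ _).2 ⟨a ⟨x, hx⟩ - a i, b ⟨x, hx⟩ - b l, ?_, ?_⟩
    · rw [h1 ⟨x, hx⟩]
      push_cast [hia, hlb]
      ring
    · rw [h2 ⟨x, hx⟩]
      push_cast [hia, hlb]
      ring
  · obtain ⟨a', b', e1, e2⟩ := (sisLE_iff_exists_add _ _).1 (hp i i.2)
    obtain ⟨a'', b'', e3, e4⟩ := (sisLE_iff_exists_add _ _).1 (hp l l.2)
    have E1 := (h1 i).symm.trans e1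
    have E2 := (h2 i).symm.trans e2
    have E3 := (h1 l).symm.trans e3
    have E4 := (h2 l).symm.trans e4
    have E5 : a i + b i + (a'' + b'') = a' + b' + (a l + b l) := by
      have : ((a i + b i + (a'' + b'') : ℕ) : ℂ) = (a' + b' + (a l + b l) : ℕ) := by
        push_cast at E1 E3 ⊢
        linear_combination E1 - E3
      exact_mod_cast this
    have E6 : b' + b l = b i + b'' := by omega
    refine (sisLE_iff_exists_add _ _).2 ⟨a', b'', ?_, ?_⟩
    · have E6' := congrArg (Nat.cast : ℕ → ℂ) E6
      push_cast at E1 E6' ⊢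
      linear_combination E1 + E6'
    · simp only
      omega

/-! ### Functions with prescribed Mellin transforms -/

open Classical in
/-- The set of the indices `l` with `p ≼ (2 μ_l, m_l)`, which `sisMult μ m p` counts. -/
noncomputable def upperIndices {n : ℕ} (μ : Fin n → ℂ) (m : Fin n → ℤ) (p : ℂ × ℤ) :
    Finset (Fin n) := Finset.univ.filter fun l => SisLE p (2 * μ l, m l)

theorem mem_upperIndices {n : ℕ} {μ : Fin n → ℂ} {m : Fin n → ℤ} {p : ℂ × ℤ} {l : Fin n} :
    l ∈ upperIndices μ m p ↔ SisLE p (2 * μ l, m l) := by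
  simp [upperIndices]

theorem sisMult_eq_card {n : ℕ} (μ : Fin n → ℂ) (m : Fin n → ℤ) (p : ℂ × ℤ) :
    sisMult μ m p = (upperIndices μ m p).card := by
  classical
  rw [sisMult, Nat.card_eq_fintype_card, Fintype.card_subtype, upperIndices]

theorem sisMap_mem_sisSpace {n : ℕ} {μ : Fin n → ℂ} {m : Fin n → ℤ} {p : ℂ × ℤ} {j : ℕ}
    (hj : j < sisMult μ m p) (φ : 𝓢(ℂ, ℂ)) : sisMap p j φ ∈ sisSpace μ m := by
  have h : sisPiece p j ≤ sisSpace μ m :=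
    le_iSup_of_le p (le_iSup_of_le j (le_iSup_of_le hj le_rfl))
  exact h ⟨φ, rfl⟩

open Classical in
/-- The poles of order `j + 1` at the points with a given set `S` of indices above them can be
prescribed. All these points lie below the greatest lower bound `q` of the entries with index in
`S`, and a single function `[z]^(-q.2) |z|^(-q.1) (log |z|)^j φ(z)` with a suitable Taylor series
of `φ` at the origin takes care of all of them. -/
theorem exists_mem_sisSpace_pole {n : ℕ} (μ : Fin n → ℂ) (m : Fin n → ℤ) (S : Finset (Fin n))
    (j : ℕ) (c : ℤ → ℂ → ℂ) : ∃ υ ∈ sisSpace μ m, ∃ M, MellinData υ M ∧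
      ∀ k s₀, ∃ g : ℂ → ℂ, AnalyticAt ℂ g s₀ ∧ M k =ᶠ[𝓝[≠] s₀] fun s =>
        (if upperIndices μ m (s₀, k) = S ∧ j < S.card then c k s₀ else 0)
          * ((s - s₀) ^ (j + 1))⁻¹ + g s := by
  by_cases hS : j < S.card ∧ ∃ p₀, ∀ l ∈ S, SisLE p₀ (2 * μ l, m l)
  swap
  · refine ⟨0, zero_mem _, 0, MellinData.zero, fun k s₀ => ⟨0, analyticAt_const, ?_⟩⟩
    rw [if_neg]
    · exact Eventually.of_forall fun s => by simp
    · rintro ⟨h1, h2⟩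
      exact hS ⟨h2, (s₀, k), fun l hl => mem_upperIndices.1 (h1 ▸ hl)⟩
  obtain ⟨hj, p₀, hp₀⟩ := hS
  obtain ⟨q, hq, hglb⟩ := exists_sisLE_glb S (Finset.card_pos.1 (by omega)) _ p₀ hp₀
  have hjq : j < sisMult μ m q := by
    rw [sisMult_eq_card]
    exact hj.trans_le (Finset.card_le_card fun l hl => mem_upperIndices.2 (hq l hl))
  obtain ⟨φ, hφ⟩ := exists_schwartz_mellinExt_residue
    (fun k s => if upperIndices μ m (s + q.1, k + q.2) = S then
      (-1) ^ j / j.factorial * c (k + q.2) (s + q.1) else 0) (by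
    intro k s hne
    have h1 : upperIndices μ m (s + q.1, k + q.2) = S := by
      by_contra h2
      exact hne (if_neg h2)
    obtain ⟨a, b, e1, e2⟩ := (sisLE_iff_exists_add _ _).1
      (hglb (s + q.1, k + q.2) fun l hl => mem_upperIndices.1 (h1 ▸ hl))
    refine ⟨a, b, ?_, ?_⟩
    · simp only at e1
      linear_combination -e1
    · simp only at e2
      omega)
  refine ⟨sisMap q j φ, sisMap_mem_sisSpace hjq φ, _, mellinData_sisMap q j φ, fun k s₀ => ?_⟩
  obtain ⟨g, hg, e⟩ := hφ (k - q.2) (s₀ - q.1)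
  obtain ⟨g', hg', e'⟩ := iteratedDeriv_mellinExt_principalPart q j hg e
  refine ⟨g', hg', e'.trans (Eventually.of_forall fun s => ?_)⟩
  have hfac : (j.factorial : ℂ) ≠ 0 := Nat.cast_ne_zero.2 j.factorial_ne_zero
  have hsq : ((-1 : ℂ) ^ j) * (-1) ^ j = 1 := by rw [← mul_pow]; simp
  simp only [sub_add_cancel, hj, and_true]
  split_ifs
  · field_simp
    linear_combination (c k s₀ / (s - s₀) ^ (j + 1)) * hsq
  · ring

/-- All the principal parts of a family in `SisData μ m` are those of a function in
`sisSpace μ m`. -/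
theorem exists_mem_sisSpace_principalParts {n : ℕ} {μ : Fin n → ℂ} {m : Fin n → ℤ}
    {H : ℤ → ℂ → ℂ} (hH : SisData μ m H) : ∃ υ ∈ sisSpace μ m, ∃ M, MellinData υ M ∧
      ∀ k s₀, ∃ g : ℂ → ℂ, AnalyticAt ℂ g s₀ ∧ (fun s => H k s - M k s) =ᶠ[𝓝[≠] s₀] g := by
  classical
  choose c g hg e using fun k s₀ => exists_principalPart _ (hH.meromorphic k s₀) (hH.order k s₀)
  choose υ hυ M hM g' hg' e' using fun Sj : Finset (Fin n) × ℕ =>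
    exists_mem_sisSpace_pole μ m Sj.1 Sj.2 fun k s => c k s Sj.2
  set T : Finset (Finset (Fin n) × ℕ) := Finset.univ ×ˢ Finset.range n with hT
  refine ⟨∑ Sj ∈ T, υ Sj, sum_mem fun Sj _ => hυ Sj, _, MellinData.sum T fun Sj _ => hM Sj,
    fun k s₀ => ⟨fun s => g k s₀ s - ∑ Sj ∈ T, g' Sj k s₀ s,
      (hg k s₀).sub (Finset.analyticAt_fun_sum _ fun Sj _ => hg' Sj k s₀), ?_⟩⟩
  have hall : ∀ᶠ s in 𝓝[≠] s₀, ∀ Sj ∈ T, M Sj k s =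
      (if upperIndices μ m (s₀, k) = Sj.1 ∧ Sj.2 < Sj.1.card then c k s₀ Sj.2 else 0)
          * ((s - s₀) ^ (Sj.2 + 1))⁻¹ + g' Sj k s₀ s :=
    (Finset.eventually_all T).2 fun Sj _ => e' Sj k s₀
  filter_upwards [e k s₀, hall] with s hs hs'
  rw [hs, Finset.sum_congr rfl hs', Finset.sum_add_distrib]
  have hcard : (upperIndices μ m (s₀, k)).card ≤ n := by
    simpa using Finset.card_le_univ (upperIndices μ m (s₀, k))
  have key : ∑ Sj ∈ T, (if upperIndices μ m (s₀, k) = Sj.1 ∧ Sj.2 < Sj.1.card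
      then c k s₀ Sj.2 else 0) * ((s - s₀) ^ (Sj.2 + 1))⁻¹
      = ∑ j ∈ Finset.range (sisMult μ m (s₀, k)), c k s₀ j * ((s - s₀) ^ (j + 1))⁻¹ := by
    rw [hT, Finset.sum_product, Finset.sum_eq_single (upperIndices μ m (s₀, k)),
      sisMult_eq_card]
    · simp only [true_and, ite_mul, zero_mul]
      rw [← Finset.sum_filter]
      refine Finset.sum_congr ?_ fun _ _ => rfl
      ext j
      simp only [Finset.mem_filter, Finset.mem_range]
      omega
    · intro S _ hS
      refine Finset.sum_eq_zero fun j _ => ?_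
      rw [if_neg fun h => hS h.1.symm, zero_mul]
    · intro h
      exact absurd (Finset.mem_univ _) h
  rw [key]
  ring

/-- A family of rapid decay with removable singularities only. -/
theorem exists_entireDecay {R : ℤ → ℂ → ℂ} (hR : RapidDecay R)
    (h : ∀ k s₀, ∃ g : ℂ → ℂ, AnalyticAt ℂ g s₀ ∧ R k =ᶠ[𝓝[≠] s₀] g) :
    ∃ E, EntireDecay E ∧ ∀ k s₀, R k =ᶠ[𝓝[≠] s₀] E k := by
  choose g hg e using h
  set E : ℤ → ℂ → ℂ := fun k s => g k s s with hE
  have hnear : ∀ k s₀, E k =ᶠ[𝓝 s₀] g k s₀ := by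
    intro k s₀
    have h1 : ∀ᶠ s in 𝓝[≠] s₀, E k s = g k s₀ s := by
      filter_upwards [eventually_eventually_nhdsWithin.2 (e k s₀), self_mem_nhdsWithin,
        (hg k s₀).eventually_analyticAt.filter_mono nhdsWithin_le_nhds] with s hs hsx hgs
      rw [isOpen_compl_singleton.nhdsWithin_eq hsx] at hs
      have h2 : g k s =ᶠ[𝓝[≠] s] g k s₀ :=
        (e k s).symm.trans (EventuallyEq.filter_mono hs nhdsWithin_le_nhds)
      have h3 : Tendsto (g k s) (𝓝[≠] s) (𝓝 (g k s s)) :=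
        (hg k s).continuousAt.tendsto.mono_left nhdsWithin_le_nhds
      have h4 : Tendsto (g k s₀) (𝓝[≠] s) (𝓝 (g k s₀ s)) :=
        hgs.continuousAt.tendsto.mono_left nhdsWithin_le_nhds
      exact tendsto_nhds_unique h3 (h4.congr' h2.symm)
    rw [eventually_nhdsWithin_iff] at h1
    filter_upwards [h1] with s hs
    by_cases hsx : s = s₀
    · rw [hsx]
    · exact hs hsx
  have hent : ∀ k, Differentiable ℂ (E k) := fun k s =>
    ((hg k s).congr (hnear k s).symm).differentiableAt
  have hRE : ∀ k s₀, R k =ᶠ[𝓝[≠] s₀] E k := fun k s₀ =>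
    (e k s₀).trans ((hnear k s₀).symm.filter_mono nhdsWithin_le_nhds)
  refine ⟨E, ⟨hent, fun a b N => ?_⟩, hRE⟩
  obtain ⟨K, C, hC⟩ := hR (a - 1) (b + 1) N
  -- The bound in the unbounded region passes to the limit.
  have hfar : ∀ (k : ℤ) (s : ℂ), a ≤ s.re → s.re ≤ b → (K + 1 ≤ |s.im| ∨ K ≤ |(k : ℝ)|) →
      ‖E k s‖ * (1 + |(k : ℝ)| + |s.im|) ^ N ≤ C := by
    intro k s ha hb hK
    have hcont : Tendsto (fun w => ‖E k w‖ * (1 + |(k : ℝ)| + |w.im|) ^ N) (𝓝[≠] s)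
        (𝓝 (‖E k s‖ * (1 + |(k : ℝ)| + |s.im|) ^ N)) := by
      have : Continuous fun w => ‖E k w‖ * (1 + |(k : ℝ)| + |w.im|) ^ N := by
        have := (hent k).continuous
        fun_prop
      exact this.continuousAt.tendsto.mono_left nhdsWithin_le_nhds
    refine le_of_tendsto hcont ?_
    have hball : ∀ᶠ w in 𝓝[≠] s, dist w s < 1 :=
      nhdsWithin_le_nhds (Metric.ball_mem_nhds s one_pos)
    filter_upwards [hRE k s, hball] with w hw hd
    rw [dist_eq] at hd
    have h1 := (abs_re_le_norm (w - s)).trans_lt hd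
    have h2 := (abs_im_le_norm (w - s)).trans_lt hd
    rw [sub_re, abs_lt] at h1
    rw [sub_im] at h2
    rw [← hw]
    refine hC k w (by linarith) (by linarith) (hK.imp (fun h => ?_) id)
    have := abs_sub_abs_le_abs_sub s.im w.im
    rw [abs_sub_comm] at this
    linarith
  -- The remaining region is compact.
  have hnearby : ∀ k : ℤ, ∃ B, ∀ s : ℂ, a ≤ s.re → s.re ≤ b → |s.im| ≤ K + 1 →
      ‖E k s‖ * (1 + |(k : ℝ)| + |s.im|) ^ N ≤ B := by
    intro k
    have hcpt : IsCompact (Icc a b ×ℂ Icc (-(K + 1)) (K + 1)) :=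
      isCompact_Icc.reProdIm isCompact_Icc
    have hcont : Continuous fun w => ‖E k w‖ * (1 + |(k : ℝ)| + |w.im|) ^ N := by
      have := (hent k).continuous
      fun_prop
    obtain ⟨B, hB⟩ := hcpt.exists_bound_of_continuousOn hcont.continuousOn
    refine ⟨B, fun s ha hb hK => (le_abs_self _).trans (hB s ?_)⟩
    exact ⟨⟨ha, hb⟩, abs_le.1 hK⟩
  choose B hB using hnearby
  set T : Finset ℤ := Finset.Icc (-⌈K⌉) ⌈K⌉ with hT
  refine ⟨|C| + ∑ k ∈ T, |B k|, fun k s ha hb => ?_⟩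
  have hsum : 0 ≤ ∑ k ∈ T, |B k| := Finset.sum_nonneg fun k _ => abs_nonneg _
  by_cases hK : K + 1 ≤ |s.im| ∨ K ≤ |(k : ℝ)|
  · have := hfar k s ha hb hK
    have := le_abs_self C
    linarith
  · push Not at hK
    have hkT : k ∈ T := by
      have h1 : ((|k| : ℤ) : ℝ) ≤ ⌈K⌉ := by
        rw [Int.cast_abs]
        exact hK.2.le.trans (Int.le_ceil K)
      have h2 : |k| ≤ ⌈K⌉ := by exact_mod_cast h1
      exact Finset.mem_Icc.2 (abs_le.1 h2)
    have h1 := hB k s ha hb hK.1.le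
    have h2 := Finset.single_le_sum (f := fun k => |B k|) (fun k _ => abs_nonneg (B k)) hkT
    have := le_abs_self (B k)
    have := abs_nonneg C
    linarith

theorem EntireDecay.shift {R : ℤ → ℂ → ℂ} (h : EntireDecay R) (κ : ℤ) (c : ℂ) :
    EntireDecay (fun k s => R (k - κ) (s - c)) := by
  refine ⟨fun k => (h.entire (k - κ)).comp (differentiable_id.sub_const c), fun a b N => ?_⟩
  obtain ⟨C, hC⟩ := h.bound (a - c.re) (b - c.re) N
  refine ⟨(1 + |(κ : ℝ)| + |c.im|) ^ N * C, fun k s ha hb => ?_⟩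
  have h1 := hC (k - κ) (s - c) (by simp; linarith) (by simp; linarith)
  push_cast at h1
  rw [sub_im] at h1
  have hw := weight_shift_le k s.im κ c.im
  calc _ ≤ ‖R (k - κ) (s - c)‖ * ((1 + |(κ : ℝ)| + |c.im|)
          * (1 + |(k : ℝ) - κ| + |s.im - c.im|)) ^ N := by gcongr
    _ = (1 + |(κ : ℝ)| + |c.im|) ^ N
          * (‖R (k - κ) (s - c)‖ * (1 + |(k : ℝ) - κ| + |s.im - c.im|) ^ N) := by
        rw [mul_pow]; ring
    _ ≤ _ := by gcongr

/-- A family in `EntireDecay` is the family of Mellin transforms of a function with a zero of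
infinite order at the origin, in every space of functions with simple singularities. -/
theorem exists_mem_sisSpace_flat {n : ℕ} (hn : 0 < n) (μ : Fin n → ℂ) (m : Fin n → ℤ)
    {E : ℤ → ℂ → ℂ} (hE : EntireDecay E) : ∃ υ ∈ sisSpace μ m, ∃ M, MellinData υ M ∧
      ∀ k s₀, M k =ᶠ[𝓝[≠] s₀] E k := by
  set p : ℂ × ℤ := (2 * μ ⟨0, hn⟩, m ⟨0, hn⟩) with hp
  have hmult : 0 < sisMult μ m p := by
    rw [sisMult_eq_card, Finset.card_pos]
    exact ⟨⟨0, hn⟩, mem_upperIndices.2 ⟨0, by simp [hp]⟩⟩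
  have hpi : (8 * Real.pi ^ 2 : ℂ) ≠ 0 := by simp [Real.pi_ne_zero]
  have hE' := (hE.shift (-p.2) (-p.1)).affine_mul 0 0 (8 * Real.pi ^ 2)⁻¹
  have hM := mellinData_sisMap p 0 hE'.toSchwartz
  refine ⟨_, sisMap_mem_sisSpace hmult hE'.toSchwartz, _, hM, fun k s₀ => ?_⟩
  refine eventuallyEq_nhdsNE_of_meromorphicOn isPreconnected_univ (fun w _ => hM.meromorphic k w)
    (fun w _ => ((hE.entire k).analyticAt w).meromorphicAt) (mem_univ (p.1 + 1)) (mem_univ s₀) ?_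
  refine Filter.Eventually.filter_mono nhdsWithin_le_nhds ?_
  have : IsOpen {w : ℂ | 0 < (w - p.1).re} :=
    isOpen_lt continuous_const (continuous_re.comp (continuous_id.sub continuous_const))
  filter_upwards [this.mem_nhds (show 0 < (p.1 + 1 - p.1).re by simp)] with w hw
  rw [iteratedDeriv_zero, mellinExt_eq_mellin _ _ hw, (hE'.hasMellin_toSchwartz (k - p.2) hw).2,
    zero_mul, zero_mul, zero_add, zero_add, ← mul_assoc, mul_inv_cancel₀ hpi, one_mul,
    sub_neg_eq_add, sub_neg_eq_add, sub_add_cancel, sub_add_cancel]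

/-- Families in `SisData μ m` are the Mellin transforms of the functions in `sisSpace μ m`. -/
theorem exists_mem_sisSpace_mellinData {n : ℕ} (hn : 0 < n) {μ : Fin n → ℂ} {m : Fin n → ℤ}
    {H : ℤ → ℂ → ℂ} (hH : SisData μ m H) : ∃ υ ∈ sisSpace μ m, ∃ M, MellinData υ M ∧
      ∀ k s₀, M k =ᶠ[𝓝[≠] s₀] H k := by
  obtain ⟨υ, hυ, M, hM, hR⟩ := exists_mem_sisSpace_principalParts hH
  have hdec : RapidDecay fun k s => H k s - M k s := by
    have := hH.decay.add (hM.decay.const_mul (-1))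
    simpa only [neg_one_mul, ← sub_eq_add_neg] using this
  obtain ⟨E, hE, hRE⟩ := exists_entireDecay hdec hR
  obtain ⟨w, hw, L, hL, hLE⟩ := exists_mem_sisSpace_flat hn μ m hE
  refine ⟨υ + w, add_mem hυ hw, _, hM.add hL, fun k s₀ => ?_⟩
  filter_upwards [hLE k s₀, hRE k s₀] with s h1 h2
  rw [h1, ← h2]
  ring

/-! ### The family of Mellin transforms of the Hankel transform -/

theorem RapidDecay.reflect {H : ℤ → ℂ → ℂ} (h : RapidDecay H) (c : ℂ) :
    RapidDecay (fun k s => H (-k) (c - s)) := by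
  intro a b N
  obtain ⟨K, C, hC⟩ := h (c.re - b) (c.re - a) N
  refine ⟨K + |c.im|, (1 + |c.im|) ^ N * C, fun k s ha hb hK => ?_⟩
  have h1 := hC (-k) (c - s) (by simp; linarith) (by simp; linarith) (by
    push_cast
    rw [abs_neg, sub_im, abs_sub_comm]
    have := abs_sub_abs_le_abs_sub s.im c.im
    have := abs_nonneg c.im
    rcases hK with hK | hK
    · left; linarith
    · right; linarith)
  push_cast at h1
  rw [abs_neg, sub_im, abs_sub_comm] at h1
  have hw := weight_shift_le k s.im 0 c.im
  rw [abs_zero, add_zero, sub_zero] at hw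
  calc _ ≤ ‖H (-k) (c - s)‖ * ((1 + |c.im|) * (1 + |(k : ℝ)| + |s.im - c.im|)) ^ N := by gcongr
    _ = (1 + |c.im|) ^ N * (‖H (-k) (c - s)‖ * (1 + |(k : ℝ)| + |s.im - c.im|) ^ N) := by
        rw [mul_pow]; ring
    _ ≤ _ := by gcongr

open Classical in
/-- The order of the gamma factor at a point, in terms of the points where its numerator and its
denominator have poles. -/
theorem meromorphicOrderAt_gammaFactor_ge {n : ℕ} (μ : Fin n → ℂ) (m : Fin n → ℤ) (κ : ℤ) (s₀ : ℂ) :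
    MeromorphicAt (fun s => gammaFactor μ (fun l => m l + -κ) (s / 2)) s₀ ∧
    ((-(sisMult μ m (s₀, κ) : ℤ) + (sisMult (-μ) (-m) (2 - s₀, -κ) : ℤ) : ℤ) : WithTop ℤ)
      ≤ meromorphicOrderAt (fun s => gammaFactor μ (fun l => m l + -κ) (s / 2)) s₀ := by
  set o : Fin n → ℤ := fun l => (if SisLE (s₀, κ) (2 * μ l, m l) then -1 else 0)
    + (if SisLE (2 - s₀, -κ) (2 * (-μ) l, (-m) l) then 1 else 0) with ho
  have hone : ∀ l, MeromorphicAt (fun s => gammaFactorOne (m l + -κ) (s / 2 - μ l)) s₀ ∧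
      (o l : WithTop ℤ) ≤
        meromorphicOrderAt (fun s => gammaFactorOne (m l + -κ) (s / 2 - μ l)) s₀ := by
    intro l
    obtain ⟨h1, h2⟩ := meromorphicOrderAt_gammaFactorOne_ge (m l + -κ) (s₀ / 2 - μ l)
    have hg : AnalyticAt ℂ (fun s : ℂ => s / 2 - μ l) s₀ := by fun_prop
    have hg' : deriv (fun s : ℂ => s / 2 - μ l) s₀ ≠ 0 := by
      have := ((hasDerivAt_id s₀).div_const 2).sub_const (μ l)
      rw [show (fun s : ℂ => s / 2 - μ l) = fun s => id s / 2 - μ l from rfl, this.deriv]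
      norm_num
    have h3 := meromorphicOrderAt_comp_of_deriv_ne_zero (f := gammaFactorOne (m l + -κ)) hg hg'
    refine ⟨h1.comp_analyticAt (f := gammaFactorOne (m l + -κ)) (g := fun s : ℂ => s / 2 - μ l) hg,
      ?_⟩
    refine le_trans ?_ (h2.trans h3.symm.le)
    rw [WithTop.coe_le_coe]
    have e1 : SisLE (s₀, κ) (2 * μ l, m l) ↔
        ∃ a : ℕ, s₀ / 2 - μ l + ((m l + -κ).natAbs : ℂ) / 2 = -a := by
      rw [sisLE_iff_natAbs, ← Int.natAbs_neg (m l + -κ), show -(m l + -κ) = κ - m l by ring]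
      refine exists_congr fun a => ?_
      simp only
      constructor <;> intro h <;> [linear_combination h / 2; linear_combination 2 * h]
    have e2 : SisLE (2 - s₀, -κ) (2 * (-μ) l, (-m) l) ↔
        ∃ a : ℕ, 1 - (s₀ / 2 - μ l) + ((m l + -κ).natAbs : ℂ) / 2 = -a := by
      rw [sisLE_iff_natAbs]
      refine exists_congr fun a => ?_
      simp only [Pi.neg_apply]
      rw [show -κ - -m l = m l + -κ by ring]
      constructor <;> intro h <;> [linear_combination h / 2; linear_combination 2 * h]
    simp only [ho, e1, e2, le_refl]
  have hsum : ∑ l, o l = -(sisMult μ m (s₀, κ) : ℤ) + (sisMult (-μ) (-m) (2 - s₀, -κ) : ℤ) := by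
    rw [Finset.sum_add_distrib, Finset.sum_ite, Finset.sum_ite, sisMult_eq_card, sisMult_eq_card,
      upperIndices, upperIndices]
    simp
  refine ⟨MeromorphicAt.fun_prod fun l _ => (hone l).1, ?_⟩
  have hp := meromorphicOrderAt_fun_prod (s := Finset.univ) fun l _ => (hone l).1
  rw [show (fun s => gammaFactor μ (fun l => m l + -κ) (s / 2)) =
    fun s => ∏ l, gammaFactorOne (m l + -κ) (s / 2 - μ l) from rfl, hp, ← hsum]
  have hcoe : ((∑ l, o l : ℤ) : WithTop ℤ) = ∑ l, (o l : WithTop ℤ) :=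
    map_sum (WithTop.addHom : ℤ →+ WithTop ℤ) o Finset.univ
  rw [hcoe]
  exact Finset.sum_le_sum fun l _ => (hone l).2

/-- Multiplication by the gamma factors takes the Mellin transforms for the parameters `(-μ, -m)`,
reflected, to families of the type of Mellin transforms for `(μ, m)`: the zeros of the gamma factors
cancel the poles at the wrong places, and the poles of the gamma factors have the right ones. -/
theorem sisData_gammaFactor_mul {n : ℕ} {μ : Fin n → ℂ} {m : Fin n → ℤ} {K : ℤ → ℂ → ℂ}
    (hK : SisData (-μ) (-m) K) :
    SisData μ m fun κ s => gammaFactor μ (fun l => m l + -κ) (s / 2) * K (-κ) (2 - s) := by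
  have hK' : ∀ κ s₀, MeromorphicAt (fun s => K (-κ) (2 - s)) s₀ ∧
      ((-(sisMult (-μ) (-m) (2 - s₀, -κ) : ℤ) : ℤ) : WithTop ℤ)
        ≤ meromorphicOrderAt (fun s => K (-κ) (2 - s)) s₀ := by
    intro κ s₀
    have hg : AnalyticAt ℂ (fun s : ℂ => 2 - s) s₀ := by fun_prop
    have hg' : deriv (fun s : ℂ => 2 - s) s₀ ≠ 0 := by
      have := (hasDerivAt_id s₀).const_sub 2
      rw [show (fun s : ℂ => 2 - s) = fun s => 2 - id s from rfl, this.deriv]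
      norm_num
    exact ⟨(hK.meromorphic (-κ) (2 - s₀)).comp_analyticAt (f := K (-κ))
      (g := fun s : ℂ => 2 - s) hg,
      (hK.order (-κ) (2 - s₀)).trans
        (meromorphicOrderAt_comp_of_deriv_ne_zero (f := K (-κ)) hg hg').symm.le⟩
  refine ⟨fun κ s₀ => (meromorphicOrderAt_gammaFactor_ge μ m κ s₀).1.mul (hK' κ s₀).1,
    fun κ s₀ => ?_, RapidDecay.mul (polyGrowth_gammaFactor μ m) (hK.decay.reflect 2)⟩
  obtain ⟨h1, h2⟩ := meromorphicOrderAt_gammaFactor_ge μ m κ s₀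
  obtain ⟨h3, h4⟩ := hK' κ s₀
  have h5 := meromorphicOrderAt_mul h1 h3
  refine le_trans ?_ ((add_le_add h2 h4).trans h5.symm.le)
  rw [← WithTop.coe_add, WithTop.coe_le_coe]
  omega

theorem tendsto_nhdsNE_of_injective {f : ℂ → ℂ} (hf : Continuous f) (hi : Function.Injective f)
    (x : ℂ) : Tendsto f (𝓝[≠] x) (𝓝[≠] f x) :=
  tendsto_nhdsWithin_iff.2 ⟨(hf.tendsto x).mono_left nhdsWithin_le_nhds, by
    filter_upwards [self_mem_nhdsWithin] with s hs h0 using hs (hi h0)⟩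

theorem eventuallyEq_codiscrete_iff {f g : ℂ → ℂ} :
    f =ᶠ[codiscrete ℂ] g ↔ ∀ s₀, f =ᶠ[𝓝[≠] s₀] g := by
  simp only [EventuallyEq, Filter.Eventually, codiscrete,
    mem_codiscreteWithin_iff_forall_mem_nhdsNE,
    mem_univ, compl_univ, union_empty, forall_const]

theorem hankelIdentity_iff {n : ℕ} {μ : Fin n → ℂ} {m : Fin n → ℤ} {υ Υ : ℂˣ → ℂ}
    {K M : ℤ → ℂ → ℂ} (hK : MellinData υ K) (hM : MellinData Υ M) :
    HankelIdentity μ m υ Υ ↔ ∀ k s₀, ∀ᶠ s in 𝓝[≠] s₀,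
      M (-k) (2 * s) = gammaFactor μ (fun l => m l + k) s * K k (2 * (1 - s)) := by
  constructor
  · intro h k s₀
    obtain ⟨H, L, hH, hL, e⟩ := h k
    have t1 : Tendsto (fun s : ℂ => 2 * s) (𝓝[≠] s₀) (𝓝[≠] (2 * s₀)) :=
      tendsto_nhdsNE_of_injective (by fun_prop) (fun x y h => by simpa using h) s₀
    have t2 : Tendsto (fun s : ℂ => 2 * (1 - s)) (𝓝[≠] s₀) (𝓝[≠] (2 * (1 - s₀))) :=
      tendsto_nhdsNE_of_injective (by fun_prop) (fun x y h => by simpa using h) s₀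
    filter_upwards [eventuallyEq_codiscrete_iff.1 e s₀,
      t1.eventually (isMellinC_unique hH (hM.isMellinC (-k)) _),
      t2.eventually (isMellinC_unique hL (hK.isMellinC k) _)] with s h1 h2 h3
    rw [← h2, h1, h3]
  · intro h k
    exact ⟨M (-k), K k, hM.isMellinC (-k), hK.isMellinC k, eventuallyEq_codiscrete_iff.2 (h k)⟩

/-! ### Uniqueness -/

theorem eq_zero_of_fourier_integral_eq_zero {g : ℝ → ℂ} (hg : Continuous g)
    (hp : Function.Periodic g (2 * Real.pi))
    (h : ∀ k : ℤ, ∫ θ in (0 : ℝ)..(2 * Real.pi), g θ * exp (I * k * θ) = 0) (θ : ℝ) : g θ = 0 := by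
  have : Fact (0 < 2 * Real.pi) := ⟨Real.two_pi_pos⟩
  let G : C(AddCircle (2 * Real.pi), ℂ) := ⟨hp.lift, continuous_coinduced_dom.2 hg⟩
  have h0 : fourierCoeff G = 0 := by
    funext n
    rw [fourierCoeff_eq_intervalIntegral _ n 0, zero_add]
    have e : ∀ x : ℝ, (fourier (-n) (x : AddCircle (2 * Real.pi)) • G x : ℂ)
        = g x * exp (I * (-n : ℤ) * x) := fun x => by
      rw [fourier_coe_apply, smul_eq_mul, mul_comm]
      have hpi : (Real.pi : ℂ) ≠ 0 := ofReal_ne_zero.2 Real.pi_ne_zero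
      congr 2
      push_cast
      field_simp
    simp only [e, h (-n), smul_zero, Pi.zero_apply]
  have h1 := has_pointwise_sum_fourier_series_of_summable (f := G)
    (by rw [h0]; exact summable_zero) (θ : AddCircle (2 * Real.pi))
  simp only [h0, Pi.zero_apply, zero_smul] at h1
  exact (hasSum_zero.unique h1).symm

theorem eq_zero_of_polarCoeff_eq_zero {υ : ℂˣ → ℂ} (hυ : Continuous υ)
    (h : ∀ k x, 0 < x → polarCoeff k (zeroExtend υ) x = 0) : υ = 0 := by
  funext z
  have hz : 0 < ‖(z : ℂ)‖ := norm_pos_iff.2 z.ne_zero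
  set g : ℝ → ℂ := fun θ => zeroExtend υ (‖(z : ℂ)‖ * exp (I * θ)) with hg
  have hgc : Continuous g :=
    continuous_zeroExtend_comp hυ (by fun_prop) fun θ => ofReal_mul_exp_ne_zero hz _
  have hgp : Function.Periodic g (2 * Real.pi) := fun θ => by
    simp only [hg]
    rw [show I * ((θ + 2 * Real.pi : ℝ) : ℂ) = I * θ + 2 * Real.pi * I by push_cast; ring,
      exp_periodic]
  have h0 := eq_zero_of_fourier_integral_eq_zero hgc hgp (fun k => by
    have := h k _ hz
    simpa [polarCoeff] using this) (arg (z : ℂ))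
  simp only [hg] at h0
  rw [mul_comm I, norm_mul_exp_arg_mul_I, zeroExtend_coe] at h0
  exact h0

/-- A function on `ℂˣ` all of whose Mellin transforms vanish is zero. -/
theorem MellinData.eq_zero {υ : ℂˣ → ℂ} {M : ℤ → ℂ → ℂ} (hM : MellinData υ M)
    (h : ∀ k s₀, M k =ᶠ[𝓝[≠] s₀] 0) : υ = 0 := by
  refine eq_zero_of_polarCoeff_eq_zero hM.continuous fun k x hx => ?_
  obtain ⟨σ, hσ⟩ := hM.hasMellin k
  have h0 : ∀ s : ℂ, σ < s.re → mellin (polarCoeff k (zeroExtend υ)) s = 0 := fun s hs => by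
    obtain ⟨h1, h2⟩ := hσ s hs
    rw [h1.2]
    have h3 : Tendsto (M k) (𝓝[≠] s) (𝓝 (M k s)) :=
      h2.continuousAt.tendsto.mono_left nhdsWithin_le_nhds
    exact tendsto_nhds_unique h3 (tendsto_const_nhds.congr' (h k s).symm)
  have hline : ∀ y : ℝ, mellin (polarCoeff k (zeroExtend υ)) ((σ + 1 : ℝ) + y * I) = 0 :=
    fun y => h0 _ (by simp)
  have h1 := mellinInv_mellin_eq (σ + 1) (polarCoeff k (zeroExtend υ)) hx
    (hσ ((σ + 1 : ℝ) : ℂ) (by simp)).1.1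
    (by simp only [VerticalIntegrable, hline]; exact integrable_zero _ _ _)
    (continuousAt_polarCoeff_zeroExtend hM.continuous k hx)
  rw [← h1, mellinInv]
  simp only [hline, smul_zero, integral_zero]

/-- The Mellin transforms of a function on `ℂˣ` determine its Hankel transform. -/
theorem hankelIdentity_unique {n : ℕ} {μ : Fin n → ℂ} {m : Fin n → ℤ} {υ Υ Υ' : ℂˣ → ℂ}
    {K M M' : ℤ → ℂ → ℂ} (hK : MellinData υ K) (hM : MellinData Υ M) (hM' : MellinData Υ' M')
    (h : HankelIdentity μ m υ Υ) (h' : HankelIdentity μ m υ Υ') : Υ = Υ' := by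
  have hD := hM.add (hM'.smul (-1))
  have h0 : Υ + (-1 : ℂ) • Υ' = 0 := hD.eq_zero fun k s₀ => by
    have t : Tendsto (fun s : ℂ => s / 2) (𝓝[≠] s₀) (𝓝[≠] (s₀ / 2)) :=
      tendsto_nhdsNE_of_injective (by fun_prop) (fun x y h => by simpa using h) s₀
    filter_upwards [t.eventually ((hankelIdentity_iff hK hM).1 h (-k) (s₀ / 2)),
      t.eventually ((hankelIdentity_iff hK hM').1 h' (-k) (s₀ / 2))] with s h1 h2
    rw [neg_neg, mul_div_cancel₀ _ two_ne_zero] at h1 h2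
    rw [h1, h2, Pi.zero_apply]
    ring
  rw [neg_one_smul, ← sub_eq_add_neg, sub_eq_zero] at h0
  exact h0

/-! ### Inversion -/

theorem polarCoeff_zeroExtend_comp_neg (υ : ℂˣ → ℂ) (k : ℤ) {x : ℝ} (hx : 0 < x) :
    polarCoeff k (zeroExtend fun z => υ (-z)) x = (-1) ^ k * polarCoeff k (zeroExtend υ) x := by
  set G : ℝ → ℂ := fun θ => zeroExtend υ (x * exp (I * θ)) * exp (I * k * θ) with hG
  have hper : Function.Periodic G (2 * Real.pi) := fun θ => by
    simp only [hG]
    rw [show I * ((θ + 2 * Real.pi : ℝ) : ℂ) = I * θ + 2 * Real.pi * I by push_cast; ring,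
      exp_periodic, show I * k * ((θ + 2 * Real.pi : ℝ) : ℂ) = I * k * θ + k * (2 * Real.pi * I) by
        push_cast; ring, exp_add, exp_int_mul_two_pi_mul_I, mul_one]
  have hk : exp (k * (Real.pi * I)) = (-1) ^ k := by
    rw [exp_int_mul, exp_pi_mul_I]
  have hk2 : ((-1 : ℂ) ^ k) * (-1) ^ k = 1 := by
    rw [← mul_zpow]; simp
  have e : ∀ θ : ℝ, zeroExtend (fun z => υ (-z)) (x * exp (I * θ)) * exp (I * k * θ)
      = (-1) ^ k * G (θ + Real.pi) := fun θ => by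
    have h0 := ofReal_mul_exp_ne_zero hx (I * θ)
    have h1 : zeroExtend (fun z => υ (-z)) (x * exp (I * θ)) = υ (-Units.mk0 _ h0) :=
      zeroExtend_coe _ (Units.mk0 _ h0)
    have h2 := zeroExtend_coe υ (-Units.mk0 _ h0)
    rw [Units.val_neg, Units.val_mk0] at h2
    simp only [hG]
    rw [h1, ← h2,
      show I * ((θ + Real.pi : ℝ) : ℂ) = I * θ + Real.pi * I by push_cast; ring, exp_add,
      exp_pi_mul_I, show I * k * ((θ + Real.pi : ℝ) : ℂ) = I * k * θ + k * (Real.pi * I) by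
        push_cast; ring, exp_add, hk, mul_neg_one, mul_neg]
    linear_combination (-zeroExtend υ (-(x * exp (I * θ))) * exp (I * k * θ)) * hk2
  unfold polarCoeff
  simp only [e]
  rw [intervalIntegral.integral_const_mul, intervalIntegral.integral_comp_add_right G, zero_add,
    add_comm (2 * Real.pi), hper.intervalIntegral_add_eq Real.pi 0, zero_add]
  ring

theorem MellinData.comp_neg {υ : ℂˣ → ℂ} {M : ℤ → ℂ → ℂ} (h : MellinData υ M) :
    MellinData (fun z => υ (-z)) (fun k s => (-1) ^ k * M k s) where
  continuous := h.continuous.comp ((continuous_const_mul (-1 : ℂˣ)).congr neg_one_mul)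
  meromorphic k := fun s => (MeromorphicAt.const _ s).mul (h.meromorphic k s)
  decay := RapidDecay.mul (fun _ _ => ⟨0, 0, 1, fun k _ _ _ _ => by simp⟩) h.decay
  hasMellin k := by
    obtain ⟨σ, hσ⟩ := h.hasMellin k
    refine ⟨σ, fun s hs => ?_⟩
    obtain ⟨h1, h2⟩ := hσ s hs
    refine ⟨?_, h2.const_mul _⟩
    have := hasMellin_const_smul h1.1 ((-1 : ℂ) ^ k)
    rw [h1.2] at this
    exact hasMellin_congr_Ioi (fun x hx => (polarCoeff_zeroExtend_comp_neg υ k hx).symm) this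

theorem MellinData.comp_neg_one_pow {υ : ℂˣ → ℂ} {M : ℤ → ℂ → ℂ} (h : MellinData υ M) (n : ℕ) :
    MellinData (fun z => υ ((-1) ^ n * z)) (fun k s => ((-1) ^ k) ^ n * M k s) := by
  induction n with
  | zero => simpa using h
  | succ n ih =>
    have e : (fun z : ℂˣ => υ ((-1) ^ (n + 1) * z)) = fun z => υ ((-1) ^ n * -z) := by
      funext z
      rw [pow_succ, mul_assoc, neg_one_mul]
    have e' : (fun (k : ℤ) (s : ℂ) => ((-1 : ℂ) ^ k) ^ (n + 1) * M k s)
        = fun k s => (-1) ^ k * (((-1) ^ k) ^ n * M k s) := by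
      funext k s
      ring
    rw [e, e']
    exact ih.comp_neg

theorem comp_neg_mem_sisSpace {n : ℕ} {μ : Fin n → ℂ} {m : Fin n → ℤ} {υ : ℂˣ → ℂ}
    (hυ : υ ∈ sisSpace μ m) : (fun z => υ (-z)) ∈ sisSpace μ m := by
  suffices h : sisSpace μ m ≤ (sisSpace μ m).comap
      (LinearMap.funLeft ℂ ℂ (fun z : ℂˣ => -z)) from h hυ
  refine iSup_le fun p => iSup_le fun j => iSup_le fun hj => ?_
  rintro _ ⟨φ, rfl⟩
  have hφ : ∃ ψ : 𝓢(ℂ, ℂ), ∀ z, ψ z = φ (-z) :=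
    ⟨SchwartzMap.compCLMOfContinuousLinearEquiv ℂ (ContinuousLinearEquiv.neg ℝ) φ, fun z => rfl⟩
  obtain ⟨ψ, hψ⟩ := hφ
  have e : LinearMap.funLeft ℂ ℂ (fun z : ℂˣ => -z) (sisMap p j φ)
      = (-1 : ℂ) ^ p.2 • sisMap p j ψ := by
    funext z
    simp only [LinearMap.funLeft_apply, sisMap, LinearMap.coe_mk, AddHom.coe_mk, Units.val_neg,
      norm_neg, hψ, Pi.smul_apply, smul_eq_mul, neg_div]
    rw [← neg_one_mul, mul_zpow, zpow_neg (-1 : ℂ), ← inv_zpow, inv_neg_one]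
    ring
  rw [Submodule.mem_comap, e]
  exact Submodule.smul_mem _ _ (sisMap_mem_sisSpace hj ψ)

theorem comp_neg_one_pow_mem_sisSpace {n : ℕ} {μ : Fin n → ℂ} {m : Fin n → ℤ} {υ : ℂˣ → ℂ}
    (hυ : υ ∈ sisSpace μ m) (N : ℕ) : (fun z => υ ((-1) ^ N * z)) ∈ sisSpace μ m := by
  induction N with
  | zero => simpa using hυ
  | succ N ih =>
    have e : (fun z : ℂˣ => υ ((-1) ^ (N + 1) * z)) = fun z => υ ((-1) ^ N * -z) := by
      funext z
      rw [pow_succ, mul_assoc, neg_one_mul]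
    rw [e]
    exact comp_neg_mem_sisSpace ih

theorem eventually_Gamma_ne_zero (w₀ : ℂ) : ∀ᶠ w in 𝓝[≠] w₀, Gamma w ≠ 0 := by
  have han : AnalyticOnNhd ℂ (fun w => (Gamma w)⁻¹) univ := fun w _ =>
    differentiable_one_div_Gamma.analyticAt w
  rcases (han w₀ (mem_univ _)).eventually_eq_zero_or_eventually_ne_zero with h | h
  · have h1 := han.eqOn_zero_of_preconnected_of_eventuallyEq_zero isPreconnected_univ
      (mem_univ w₀) h (mem_univ 1)
    simp at h1
  · filter_upwards [h] with w hw h0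
    rw [h0, inv_zero] at hw
    exact hw rfl

/-- The functional equation of the gamma factors. -/
theorem gammaFactorOne_neg_mul_gammaFactorOne (m : ℤ) (s₀ : ℂ) :
    ∀ᶠ s in 𝓝[≠] s₀, gammaFactorOne (-m) s * gammaFactorOne m (1 - s) = (-1) ^ m := by
  have t1 : Tendsto (fun s : ℂ => s + (m.natAbs : ℂ) / 2) (𝓝[≠] s₀)
      (𝓝[≠] (s₀ + (m.natAbs : ℂ) / 2)) :=
    tendsto_nhdsNE_of_injective (by fun_prop) (fun x y h => by simpa using h) s₀
  have t2 : Tendsto (fun s : ℂ => 1 - s + (m.natAbs : ℂ) / 2) (𝓝[≠] s₀)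
      (𝓝[≠] (1 - s₀ + (m.natAbs : ℂ) / 2)) :=
    tendsto_nhdsNE_of_injective (by fun_prop) (fun x y h => by simpa using h) s₀
  filter_upwards [t1.eventually (eventually_Gamma_ne_zero _),
    t2.eventually (eventually_Gamma_ne_zero _)] with s h1 h2
  have hI : I ^ m.natAbs * I ^ m.natAbs = (-1) ^ m := by
    rw [← mul_pow, I_mul_I]
    rcases Int.natAbs_eq m with h | h
    · conv_rhs => rw [h, zpow_natCast]
    · conv_rhs => rw [h, zpow_neg, zpow_natCast, ← inv_pow, inv_neg_one]
  have hpi : (2 * (Real.pi : ℂ)) ^ (1 - 2 * s) * (2 * (Real.pi : ℂ)) ^ (1 - 2 * (1 - s)) = 1 := by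
    have h0 : (2 * (Real.pi : ℂ)) ≠ 0 := by simp [Real.pi_ne_zero]
    rw [← cpow_add _ _ h0, show 1 - 2 * s + (1 - 2 * (1 - s)) = 0 by ring, cpow_zero]
  simp only [gammaFactorOne, Int.natAbs_neg, sub_sub_cancel]
  generalize Gamma (s + (m.natAbs : ℂ) / 2) = A at *
  generalize Gamma (1 - s + (m.natAbs : ℂ) / 2) = B at *
  generalize (2 * (Real.pi : ℂ)) ^ (1 - 2 * s) = C at *
  generalize (2 * (Real.pi : ℂ)) ^ (1 - 2 * (1 - s)) = D at *
  rw [← hI]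
  field_simp
  linear_combination hpi

theorem gammaFactor_neg_mul_gammaFactor {n : ℕ} (μ : Fin n → ℂ) (m : Fin n → ℤ) (k : ℤ) (s₀ : ℂ) :
    ∀ᶠ s in 𝓝[≠] s₀, gammaFactor (-μ) (fun l => (-m) l + k) s *
      gammaFactor μ (fun l => m l + -k) (1 - s) = (-1) ^ (∑ l, m l) * ((-1) ^ (-k)) ^ n := by
  have h : ∀ᶠ s in 𝓝[≠] s₀, ∀ l, gammaFactorOne (-(m l + -k)) (s + μ l) *
      gammaFactorOne (m l + -k) (1 - (s + μ l)) = (-1) ^ (m l + -k) :=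
    eventually_all.2 fun l =>
      (tendsto_nhdsNE_of_injective (f := fun s => s + μ l) (by fun_prop)
        (fun x y h => by simpa using h) s₀).eventually (gammaFactorOne_neg_mul_gammaFactorOne _ _)
  filter_upwards [h] with s hs
  have e : (-1 : ℂ) ^ (∑ l, m l) = ∏ l, (-1 : ℂ) ^ m l := by
    induction (Finset.univ : Finset (Fin n)) using Finset.induction_on with
    | empty => simp
    | insert a S ha ih =>
      rw [Finset.sum_insert ha, Finset.prod_insert ha, zpow_add₀ (by norm_num), ih]
  have e2 : ((-1 : ℂ) ^ (-k)) ^ n = ∏ _l : Fin n, (-1 : ℂ) ^ (-k) := by simp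
  rw [gammaFactor, gammaFactor, ← Finset.prod_mul_distrib, e, e2, ← Finset.prod_mul_distrib]
  refine Finset.prod_congr rfl fun l _ => ?_
  rw [← zpow_add₀ (by norm_num), ← hs l]
  congr 2
  · simp only [Pi.neg_apply]
    ring
  · simp only [Pi.neg_apply]
    ring
  · ring

/-! ### The Hankel transform -/

theorem sisSpace_zero_eq_bot (μ : Fin 0 → ℂ) (m : Fin 0 → ℤ) : sisSpace μ m = ⊥ := by
  refine le_bot_iff.1 (iSup_le fun p => iSup_le fun j => iSup_le fun hj => ?_)
  have : sisMult μ m p = 0 := by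
    rw [sisMult_eq_card, Finset.card_eq_zero]
    exact Finset.eq_empty_of_isEmpty _
  omega

theorem exists_hankelIdentity {n : ℕ} {μ : Fin n → ℂ} {m : Fin n → ℤ} {υ : ℂˣ → ℂ}
    (hυ : υ ∈ sisSpace (-μ) (-m)) : ∃ Υ ∈ sisSpace μ m, HankelIdentity μ m υ Υ := by
  rcases Nat.eq_zero_or_pos n with rfl | hn
  · rw [sisSpace_zero_eq_bot, Submodule.mem_bot] at hυ
    refine ⟨0, zero_mem _, ?_⟩
    rw [hυ, hankelIdentity_iff MellinData.zero MellinData.zero]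
    exact fun k s₀ => Eventually.of_forall fun s => by simp
  obtain ⟨K, hK, hK'⟩ := exists_mellinData_of_mem_sisSpace _ _ hυ
  obtain ⟨Υ, hΥ, M, hM, e⟩ := exists_mem_sisSpace_mellinData hn (sisData_gammaFactor_mul hK')
  refine ⟨Υ, hΥ, (hankelIdentity_iff hK hM).2 fun k s₀ => ?_⟩
  have t : Tendsto (fun s : ℂ => 2 * s) (𝓝[≠] s₀) (𝓝[≠] (2 * s₀)) :=
    tendsto_nhdsNE_of_injective (by fun_prop) (fun x y h => by simpa using h) s₀
  filter_upwards [t.eventually (e (-k) (2 * s₀))] with s hs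
  rw [hs, neg_neg, mul_div_cancel_left₀ _ two_ne_zero, mul_sub, mul_one]

theorem existsUnique_hankelIdentity {n : ℕ} {μ : Fin n → ℂ} {m : Fin n → ℤ} {υ : ℂˣ → ℂ}
    (hυ : υ ∈ sisSpace (-μ) (-m)) :
    ∃! Υ : ℂˣ → ℂ, Υ ∈ sisSpace μ m ∧ HankelIdentity μ m υ Υ := by
  obtain ⟨Υ, hΥ, h⟩ := exists_hankelIdentity hυ
  refine ⟨Υ, ⟨hΥ, h⟩, fun Υ' hΥ' => ?_⟩
  obtain ⟨K, hK, -⟩ := exists_mellinData_of_mem_sisSpace _ _ hυ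
  obtain ⟨M, hM, -⟩ := exists_mellinData_of_mem_sisSpace _ _ hΥ
  obtain ⟨M', hM', -⟩ := exists_mellinData_of_mem_sisSpace _ _ hΥ'.1
  exact hankelIdentity_unique hK hM' hM hΥ'.2 h

/-- The Hankel transform for `(-μ, -m)` reverses the Hankel transform for `(μ, m)`, up to signs. -/
theorem HankelIdentity.inverse {n : ℕ} {μ : Fin n → ℂ} {m : Fin n → ℤ} {υ Υ : ℂˣ → ℂ}
    {K M : ℤ → ℂ → ℂ} (hK : MellinData υ K) (hM : MellinData Υ M) (h : HankelIdentity μ m υ Υ) :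
    HankelIdentity (-μ) (-m) Υ ((-1 : ℂ) ^ (∑ l, m l) • fun z => υ ((-1) ^ n * z)) := by
  refine (hankelIdentity_iff hM ((hK.comp_neg_one_pow n).smul _)).2 fun k s₀ => ?_
  have t : Tendsto (fun s : ℂ => 1 - s) (𝓝[≠] s₀) (𝓝[≠] (1 - s₀)) :=
    tendsto_nhdsNE_of_injective (by fun_prop) (fun x y h => by simpa using h) s₀
  filter_upwards [t.eventually ((hankelIdentity_iff hK hM).1 h (-k) (1 - s₀)),
    gammaFactor_neg_mul_gammaFactor μ m k s₀] with s h1 h2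
  rw [neg_neg, sub_sub_cancel] at h1
  rw [h1, ← mul_assoc, ← mul_assoc, h2]

end SimpleSingularity

theorem mainTheorem1 {n : ℕ} (μ : Fin n → ℂ) (m : Fin n → ℤ) (υ : ℂˣ → ℂ)
    (hυ : υ ∈ sisSpace (-μ) (-m)) :
    (∃! Υ : ℂˣ → ℂ, Υ ∈ sisSpace μ m ∧ HankelIdentity μ m υ Υ) ∧
    (hankel μ m υ ∈ sisSpace μ m ∧ HankelIdentity μ m υ (hankel μ m υ)) ∧
    hankel (-μ) (-m) (hankel μ m υ) =
      fun z : ℂˣ => (-1 : ℂ) ^ (∑ l, m l) * υ ((-1) ^ n * z) := by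
  have huniq := SimpleSingularity.existsUnique_hankelIdentity hυ
  have hspec : hankel μ m υ ∈ sisSpace μ m ∧ HankelIdentity μ m υ (hankel μ m υ) :=
    Classical.epsilon_spec huniq.exists
  refine ⟨huniq, hspec, ?_⟩
  have hmem : hankel μ m υ ∈ sisSpace (-(-μ)) (-(-m)) := by
    rw [neg_neg, neg_neg]
    exact hspec.1
  have huniq' := SimpleSingularity.existsUnique_hankelIdentity hmem
  obtain ⟨K, hK, -⟩ := SimpleSingularity.exists_mellinData_of_mem_sisSpace _ _ hυ
  obtain ⟨M, hM, -⟩ := SimpleSingularity.exists_mellinData_of_mem_sisSpace _ _ hspec.1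
  exact huniq'.unique (Classical.epsilon_spec huniq'.exists)
    ⟨Submodule.smul_mem _ _ (SimpleSingularity.comp_neg_one_pow_mem_sisSpace hυ n),
      SimpleSingularity.HankelIdentity.inverse hK hM hspec.2⟩
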